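/- **Proposition.** Let $i(\mathbf x)=\mathbf x/\|\mathbf x\|^2$ on $\mathbb R^3\setminus\{0\}$, and for $\mathbf a\in\mathbb R^3$ let $\mathrm{SCT}_{\mathbf a}=i\circ t_{\mathbf a}\circ i$ with $t_{\mathbf a}(\mathbf x)=\mathbf x+\mathbf a$. Let $T_{\sqrt2}=\{((\sqrt2+\sin v)\cos u,(\sqrt2+\sin v)\sin u,\cos v): u,v\in[0,2\pi]\}$ be the Clifford torus. For real $t$ with $|t|<\sqrt2-1$ let $A(t)$ be the area of the surface $\mathrm{SCT}_{[t,0,0]}(T_{\sqrt2})$ and $V(t)$ the volume it encloses, i.e. the volume of the image under $\mathrm{SCT}_{[t,0,0]}$ of the solid torus bounded by $T_{\sqrt2}$. Then $A$ and $V$ are even and given on $|t|<\sqrt2-1$ by their Taylor series at $0$, $$A(t)=\sum_{n\ge0}a_n t^{2n},\qquad V(t)=\sum_{n\ge0}v_n t^{2n}.$$ Put $$d_n=2\sum_{i=0}^{n}(i+1)v_{i+1}a_{n-i}-3\sum_{i=0}^{n}(i+1)a_{i+1}v_{n-i},$$ so that $2V'(t)A(t)-3V(t)A'(t)=\sum_{n\ge0}2d_n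 t^{2n+1}$ for $|t|<\sqrt2-1$. Then for all integers $n\ge0$ $$\sum_{i=0}^3p_i(n)a_{n+i}=0,\qquad \sum_{i=0}^3q_i(n)v_{n+i}=0,\qquad \sum_{i=0}^7r_i(n)d_{n+i}=0,$$ where $[p_0(n),\dots,p_3(n)]^T=P\,[1,n,\dots,n^4]^T$, $[q_0(n),\dots,q_3(n)]^T=Q\,[1,n,\dots,n^4]^T$, $[r_0(n),\dots,r_7(n)]^T=M\,[1,n,\dots,n^7]^T$ with $$P=\begin{bmatrix}-84 & -136 & -81 & -21 & -2 \\ 399 & 730 & 484 & 137 & 14 \\ -474 & -835 & -529 & -143 & -14 \\ 54 & 99 & 66 & 19 & 2\end{bmatrix},$$ $$Q=\begin{bmatrix}-252 & -303 & -136 & -27 & -2 \\ 960 & 1384 & 730 & 167 & 14 \\ -1008 & -1436 & -748 & -169 & -14 \\ 90 & 141 & 82 & 21 & 2\end{bmatrix},$$ $$M=\begin{bmatrix}-\tfrac{1630207404}{1529} & -\tfrac{3176073675}{3058} & -\tfrac{660587685}{1529} & -\tfrac{1216898711}{12232} & -\tfrac{167529251}{12232} & -\tfrac{626799}{556} & -\tfrac{7141}{139}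 & -1 \\ \tfrac{18219511026}{1529} & \tfrac{6798395835}{556} & \tfrac{16328931207}{3058} & \tfrac{15735207287}{12232} & \tfrac{2258693435}{12232} & \tfrac{8782801}{556} & \tfrac{103675}{139} & 15 \\ -\tfrac{80949464718}{1529} & -\tfrac{338705850511}{6116} & -\tfrac{150907466733}{6116} & -\tfrac{74228837833}{12232} & -\tfrac{10882115811}{12232} & -\tfrac{43223443}{556} & -\tfrac{521157}{139} & -77 \\ \tfrac{347623458975}{3058} & \tfrac{32991350565}{278} & \tfrac{322759355227}{6116} & \tfrac{158457515673}{12232} & \tfrac{23184921987}{12232} & \tfrac{91902509}{556} & \tfrac{1105723}{139} & 163 \\ -\tfrac{368052969807}{3058} & -\tfrac{190572156372}{1529} & -\tfrac{168114763631}{3058} & -\tfrac{163720428321}{12232} & -\tfrac{23758375953}{12232} & -\tfrac{93404429}{556} & -\tfrac{1114663}{139} & -163 \\ \tfrac{177327816597}{3058} & \tfrac{366011927673}{6116} & \tfrac{40230202855}{1529} & \tfrac{78121412337}{12232} & \tfrac{11304865929}{12232} & \tfrac{44328883}{556} & \tfrac{527737}{139} & 77 \\ -\tfrac{29809040325}{3058}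 & -\tfrac{62775138251}{6116} & -\tfrac{28175845633}{6116} & -\tfrac{13970430847}{12232} & -\tfrac{2065443305}{12232} & -\tfrac{8275441}{556} & -\tfrac{100655}{139} & -15 \\ \tfrac{818331696}{1529} & \tfrac{880217988}{1529} & \tfrac{1617383067}{6116} & \tfrac{822460415}{12232} & \tfrac{124982969}{12232} & \tfrac{515919}{556} & \tfrac{6481}{139} & 1\end{bmatrix}.$$ Moreover, up to a constant factor these are the only P-recurrences of the corresponding orders and degrees: if real polynomials $\tilde p_0,\dots,\tilde p_3$ of degree at most $4$ satisfy $\sum_{i=0}^3\tilde p_i(n)a_{n+i}=0$ for all $n\ge0$, then there is $c\in\mathbb R$ with $\tilde p_i=c\,p_i$ for all $i$; likewise for $(v_n)$ with $q_0,\dots,q_3$ (degree at most $4$) and for $(d_n)$ with $r_0,\dots,r_7$ (degree at most $7$). -/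

import Mathlib

open scoped Real

noncomputable section

namespace CliffordTorus

/-- Euclidean three-space. -/
abbrev E3 : Type := EuclideanSpace ℝ (Fin 3)

/-- The special conformal transformation `i ∘ t_a ∘ i`, where `i x = x / ‖x‖ ^ 2` is the inversion
in the unit sphere centred at the origin and `t_a` is the translation by `a`. -/
def sct (a : E3) (x : E3) : E3 :=
  EuclideanGeometry.inversion (0 : E3) 1 (EuclideanGeometry.inversion (0 : E3) 1 x + a)

/-- The toroidal parametrization `x(u, v, r)` around the circle of radius `√2`; `r = 1` gives the
Clifford torus and `0 ≤ r ≤ 1` the solid torus that it bounds. -/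
def torusPoint (u v r : ℝ) : E3 :=
  !₂[(√2 + r * Real.sin v) * Real.cos u, (√2 + r * Real.sin v) * Real.sin u, r * Real.cos v]

/-- The closed solid torus bounded by the Clifford torus. -/
def solidTorus : Set E3 :=
  {x | ∃ u ∈ Set.Icc (0 : ℝ) (2 * π), ∃ v ∈ Set.Icc (0 : ℝ) (2 * π), ∃ r ∈ Set.Icc (0 : ℝ) 1,
    x = torusPoint u v r}

/-- The area of the surface parametrized by `X` on `[0, 2π] × [0, 2π]`: the integral of the square
root of the Gram determinant of the partial derivatives `X_u`, `X_v`, that is, of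
`‖X_u × X_v‖`. -/
def surfaceArea (X : ℝ → ℝ → E3) : ℝ :=
  ∫ u in (0 : ℝ)..(2 * π), ∫ v in (0 : ℝ)..(2 * π),
    √(‖deriv (fun s => X s v) u‖ ^ 2 * ‖deriv (fun s => X u s) v‖ ^ 2
      - (inner ℝ (deriv (fun s => X s v) u) (deriv (fun s => X u s) v)) ^ 2)

/-- The area `A(t)` of the image of the Clifford torus under `SCT_{[t,0,0]}`. -/
def area (t : ℝ) : ℝ :=
  surfaceArea fun u v => sct !₂[t, 0, 0] (torusPoint u v 1)

/-- The volume `V(t)` enclosed by the image of the Clifford torus under `SCT_{[t,0,0]}`: the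
Lebesgue measure of the image of the solid torus. -/
def vol (t : ℝ) : ℝ :=
  (MeasureTheory.volume (sct !₂[t, 0, 0] '' solidTorus)).toReal

/-- `a_n`, the Taylor coefficient of `A` at `0` of order `2 n`. -/
def areaCoeff (n : ℕ) : ℝ :=
  iteratedDeriv (2 * n) area 0 / (Nat.factorial (2 * n) : ℝ)

/-- `v_n`, the Taylor coefficient of `V` at `0` of order `2 n`. -/
def volCoeff (n : ℕ) : ℝ :=
  iteratedDeriv (2 * n) vol 0 / (Nat.factorial (2 * n) : ℝ)

/-- `d_n`, the coefficient of `z ^ n` in `2 V̄' Ā - 3 V̄ Ā'`, where `Ā = ∑ a_n z ^ n` and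
`V̄ = ∑ v_n z ^ n`. -/
def isoCoeff (n : ℕ) : ℝ :=
  2 * ∑ i ∈ Finset.range (n + 1), ((i : ℝ) + 1) * volCoeff (i + 1) * areaCoeff (n - i)
    - 3 * ∑ i ∈ Finset.range (n + 1), ((i : ℝ) + 1) * areaCoeff (i + 1) * volCoeff (n - i)

/-- The sequence `s` satisfies the P-recurrence of order (at most) `r` and degree (at most) `d`
whose coefficient polynomials are `p_i(n) = ∑ k, M i k * n ^ k`. -/
def SatisfiesPRec {r d : ℕ} (M : Matrix (Fin (r + 1)) (Fin (d + 1)) ℝ) (s : ℕ → ℝ) : Prop :=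
  ∀ n : ℕ, ∑ i : Fin (r + 1), (∑ k : Fin (d + 1), M i k * (n : ℝ) ^ (k : ℕ)) * s (n + (i : ℕ)) = 0

/-- The coefficient matrix of the recurrence for `a_n`. -/
def areaRec : Matrix (Fin (3 + 1)) (Fin (4 + 1)) ℝ :=
  !![-84, -136, -81, -21, -2;
     399, 730, 484, 137, 14;
     -474, -835, -529, -143, -14;
     54, 99, 66, 19, 2]

/-- The coefficient matrix of the recurrence for `v_n`. -/
def volRec : Matrix (Fin (3 + 1)) (Fin (4 + 1)) ℝ :=
  !![-252, -303, -136, -27, -2;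
     960, 1384, 730, 167, 14;
     -1008, -1436, -748, -169, -14;
     90, 141, 82, 21, 2]

/-- The coefficient matrix of the recurrence for `d_n`. -/
def isoRec : Matrix (Fin (7 + 1)) (Fin (7 + 1)) ℝ :=
  !![-1630207404/1529, -3176073675/3058, -660587685/1529, -1216898711/12232, -167529251/12232, -626799/556, -7141/139, -1;
     18219511026/1529, 6798395835/556, 16328931207/3058, 15735207287/12232, 2258693435/12232, 8782801/556, 103675/139, 15;
     -80949464718/1529, -338705850511/6116, -150907466733/6116, -74228837833/12232, -10882115811/12232, -43223443/556, -521157/139, -77;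
     347623458975/3058, 32991350565/278, 322759355227/6116, 158457515673/12232, 23184921987/12232, 91902509/556, 1105723/139, 163;
     -368052969807/3058, -190572156372/1529, -168114763631/3058, -163720428321/12232, -23758375953/12232, -93404429/556, -1114663/139, -163;
     177327816597/3058, 366011927673/6116, 40230202855/1529, 78121412337/12232, 11304865929/12232, 44328883/556, 527737/139, 77;
     -29809040325/3058, -62775138251/6116, -28175845633/6116, -13970430847/12232, -2065443305/12232, -8275441/556, -100655/139, -15;
     818331696/1529, 880217988/1529, 1617383067/6116, 822460415/12232, 124982969/12232, 515919/556, 6481/139, 1]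

end CliffordTorus

end

/-! The derivative of `sct a` at x is a linear isometry divided by D = 1 + 2⟨a, x⟩ + |a|²|x|². Hence
A(t) = ∬ (√2 + sin v) / D² and V(t) = ∭ r (√2 + r sin v) / D³ (`area_eq_integral`,
`vol_eq_integral`), and the divergence theorem turns V into a double integral of a flux density with
denominator D³ (`three_mul_sqrt_two_mul_vol`). With τ = √2 t and σ = √2 sin v, the double integrals
have integrands rational over ℚ in τ, σ and cos u. Creative telescoping applies: two explicit
combinations of these integrands and their τ-derivatives are sums of a u-derivative and a
v-derivative of periodic functions (`area_certificate`, `vol_certificate`). They integrate to zero,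
which gives two first-order linear relations between A, V and their derivatives (`area_relation`,
`vol_relation`).

The integrals extend holomorphically to the disc |τ| < 2 - √2 and are even, so A and V are power
series in X = t². The relations become a first-order linear system for these series, with θ = X d/dX
as derivation.

A P-recurrence of order r for the coefficients of f says that ∑ₖ (θ - r)ᵏ (bₖ f) has no terms from
X^r on, the bₖ being the reversed columns of the coefficient matrix. Eliminating θ by means of the
system turns this series, up to a nonzero factor, into a combination of the unknowns with polynomial
coefficients. These coefficients vanish identically, which is a finite integer computation
(`System.nest_eq_zero`). The d_n are quadratic in the unknowns, so for them the symmetric square of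
the system is used.

For uniqueness (`recurrence_unique`), a multiple of the known recurrence is subtracted so that one
entry of the coefficient matrix vanishes. The other m entries satisfy the m linear equations for n <
m. Up to a common factor these have integer coefficients, and Gaussian elimination modulo 103 shows
that their matrix is nonsingular. -/

namespace CliffordTorus

/-! ### Polynomials as coefficient lists, and reduction of differential operators modulo a
first-order system. -/

section PowerSeriesOperators

open PowerSeries

/-- The Euler operator `X d/dX` on power series. -/
noncomputable def euler : Derivation ℝ ℝ⟦X⟧ ℝ⟦X⟧ := (X : ℝ⟦X⟧) • PowerSeries.derivative ℝ

theorem coeff_euler (n : ℕ) (f : ℝ⟦X⟧) : coeff n (euler f) = n * coeff n f := by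
  cases n with
  | zero => simp [euler]
  | succ n => simp [euler, coeff_succ_X_mul, coeff_derivative, mul_comm]

theorem euler_mul (f g : ℝ⟦X⟧) : euler (f * g) = euler f * g + f * euler g := by
  rw [Derivation.leibniz, smul_eq_mul, smul_eq_mul]; ring

theorem euler_X : euler (X : ℝ⟦X⟧) = X := by
  ext n
  rw [coeff_euler, coeff_X]
  split_ifs with h <;> simp [h]

theorem euler_intCast (c : ℤ) : euler (c : ℝ⟦X⟧) = 0 := Derivation.map_intCast _ c

/-- The polynomial with the given list of integer coefficients, as a power series. -/
noncomputable def listSeries : List ℤ → ℝ⟦X⟧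
  | [] => 0
  | c :: l => (c : ℝ⟦X⟧) + X * listSeries l

/-- Sum of coefficient lists. -/
def addList : List ℤ → List ℤ → List ℤ
  | [], m => m
  | c :: l, [] => c :: l
  | c :: l, d :: m => (c + d) :: addList l m

/-- Scalar multiple of a coefficient list. -/
def smulList (a : ℤ) : List ℤ → List ℤ
  | [] => []
  | c :: l => (a * c) :: smulList a l

/-- Product of coefficient lists. -/
def mulList : List ℤ → List ℤ → List ℤ
  | [], _ => []
  | c :: l, m => addList (smulList c m) (0 :: mulList l m)

/-- The coefficient list of `k * p + X * p'`. -/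
def eulerList (k : ℤ) : List ℤ → List ℤ
  | [] => []
  | c :: l => (k * c) :: eulerList (k + 1) l

/-- All entries of the list vanish. -/
def isZeroList : List ℤ → Bool
  | [] => true
  | c :: l => (c == 0) && isZeroList l

/-- The list operations are computable, so polynomial identities between power series become finite
integer checks. -/
theorem listSeries_addList (l m : List ℤ) :
    listSeries (addList l m) = listSeries l + listSeries m := by
  induction l generalizing m with
  | nil => simp [addList, listSeries]
  | cons c l ih =>
    cases m with
    | nil => simp [addList, listSeries]
    | cons d m => simp only [addList, listSeries, ih]; push_cast; ring

theorem listSeries_smulList (a : ℤ) (l : List ℤ) :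
    listSeries (smulList a l) = (a : ℝ⟦X⟧) * listSeries l := by
  induction l with
  | nil => simp [smulList, listSeries]
  | cons c l ih => simp only [smulList, listSeries, ih]; push_cast; ring

theorem listSeries_mulList (l m : List ℤ) :
    listSeries (mulList l m) = listSeries l * listSeries m := by
  induction l with
  | nil => simp [mulList, listSeries]
  | cons c l ih =>
    simp only [mulList, listSeries, listSeries_addList, listSeries_smulList, ih]
    push_cast; ring

theorem listSeries_eulerList (k : ℤ) (l : List ℤ) :
    listSeries (eulerList k l) = k * listSeries l + euler (listSeries l) := by
  induction l generalizing k with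
  | nil => simp [eulerList, listSeries]
  | cons c l ih =>
    simp only [eulerList, listSeries, ih, map_add, euler_mul, euler_X, euler_intCast]
    push_cast; ring

theorem euler_listSeries (l : List ℤ) : euler (listSeries l) = listSeries (eulerList 0 l) := by
  rw [listSeries_eulerList]; simp

theorem listSeries_eq_zero {l : List ℤ} (h : isZeroList l = true) : listSeries l = 0 := by
  induction l with
  | nil => rfl
  | cons c l ih =>
    simp only [isZeroList, Bool.and_eq_true, beq_iff_eq] at h
    simp [listSeries, h.1, ih h.2]

/-- Triples of coefficient lists. -/
structure Triple where
  (fst snd thd : List ℤ)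

/-- A first order system `δ θ y = M y` of three equations with polynomial coefficients; `row i` is
the `i`-th row of `M`. -/
structure System where
  δ : List ℤ
  (row₁ row₂ row₃ : Triple)

namespace Triple

/-- The linear combination of three series with polynomial coefficients. -/
noncomputable def eval (c : Triple) (y₁ y₂ y₃ : ℝ⟦X⟧) : ℝ⟦X⟧ :=
  listSeries c.fst * y₁ + listSeries c.snd * y₂ + listSeries c.thd * y₃

/-- Componentwise sum. -/
def add (c d : Triple) : Triple :=
  ⟨addList c.fst d.fst, addList c.snd d.snd, addList c.thd d.thd⟩

/-- Product with a polynomial. -/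
def mul (p : List ℤ) (c : Triple) : Triple :=
  ⟨mulList p c.fst, mulList p c.snd, mulList p c.thd⟩

/-- Componentwise derivative. -/
def eul (c : Triple) : Triple :=
  ⟨eulerList 0 c.fst, eulerList 0 c.snd, eulerList 0 c.thd⟩

/-- All components vanish. -/
def isZero (c : Triple) : Bool :=
  isZeroList c.fst && isZeroList c.snd && isZeroList c.thd

variable (y₁ y₂ y₃ : ℝ⟦X⟧)

theorem eval_add (c d : Triple) :
    (c.add d).eval y₁ y₂ y₃ = c.eval y₁ y₂ y₃ + d.eval y₁ y₂ y₃ := by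
  simp only [eval, add, listSeries_addList]; ring

theorem eval_mul (p : List ℤ) (c : Triple) :
    (c.mul p).eval y₁ y₂ y₃ = listSeries p * c.eval y₁ y₂ y₃ := by
  simp only [eval, mul, listSeries_mulList]; ring

theorem eval_eq_zero {c : Triple} (h : c.isZero = true) : c.eval y₁ y₂ y₃ = 0 := by
  simp only [isZero, Bool.and_eq_true] at h
  simp [eval, listSeries_eq_zero h.1.1, listSeries_eq_zero h.1.2, listSeries_eq_zero h.2]

end Triple

namespace System

variable (S : System)

/-- `y₁, y₂, y₃` solve the system. -/
def Solves (y₁ y₂ y₃ : ℝ⟦X⟧) : Prop :=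
  listSeries S.δ * euler y₁ = S.row₁.eval y₁ y₂ y₃ ∧
  listSeries S.δ * euler y₂ = S.row₂.eval y₁ y₂ y₃ ∧
  listSeries S.δ * euler y₃ = S.row₃.eval y₁ y₂ y₃

/-- The coefficients of `δ θ (c · y)`. -/
def diff (c : Triple) : Triple :=
  (c.eul.mul S.δ).add (((S.row₁.mul c.fst).add (S.row₂.mul c.snd)).add (S.row₃.mul c.thd))

theorem eval_diff {y₁ y₂ y₃ : ℝ⟦X⟧} (h : S.Solves y₁ y₂ y₃) (c : Triple) :
    (S.diff c).eval y₁ y₂ y₃ = listSeries S.δ * euler (c.eval y₁ y₂ y₃) := by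
  obtain ⟨h₁, h₂, h₃⟩ := h
  simp only [diff, Triple.eval_add, Triple.eval_mul, ← h₁, ← h₂, ← h₃]
  simp only [Triple.eval, Triple.eul, map_add, euler_mul, euler_listSeries]
  ring

/-- With `K f = c · y` and `δ θ K = κ K`, the coefficients with respect to `y` of `K δ ^ n` times
`b₀ f + (θ - r) (b₁ f + (θ - r) (b₂ f + ⋯))`, where `n` is the number of the `bᵢ`. -/
def reduce (κ : List ℤ) (c : Triple) (r : ℤ) : List (List ℤ) → List ℤ × List ℤ × Triple
  | [] => (κ, [1], ⟨[], [], []⟩)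
  | b :: bs =>
    let (κ', P, e) := reduce κ c r bs
    let P' := mulList S.δ P
    (addList κ' (eulerList 0 S.δ), P',
      (c.mul (mulList b P')).add
        ((S.diff e).add (e.mul (addList (smulList (-1) κ') (smulList (-r) S.δ)))))

/-- The series `b₀ f + (θ - r) (b₁ f + (θ - r) (b₂ f + ⋯))`. -/
noncomputable def nest (f : ℝ⟦X⟧) (r : ℤ) : List (List ℤ) → ℝ⟦X⟧
  | [] => 0
  | b :: bs => listSeries b * f + (euler (nest f r bs) - r * nest f r bs)

/-- Let g be the inner nest and K' = K δⁿ, with K' g = e · y and δ θK' = κ' K'. Then K' δ θg = δ θ(e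
· y) - κ' (e · y), so another application of θ costs one factor δ and stays in the span of y.
Passing from K' to K' δ adds θδ to κ'. -/
theorem reduce_spec {y₁ y₂ y₃ : ℝ⟦X⟧} (h : S.Solves y₁ y₂ y₃) {K f : ℝ⟦X⟧} {κ : List ℤ}
    {c : Triple} (hK : listSeries S.δ * euler K = listSeries κ * K)
    (hf : K * f = c.eval y₁ y₂ y₃) (r : ℤ) (bs : List (List ℤ)) :
    let R := S.reduce κ c r bs
    listSeries R.2.1 = listSeries S.δ ^ bs.length ∧
    listSeries S.δ * euler (K * listSeries R.2.1) = listSeries R.1 * (K * listSeries R.2.1) ∧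
    K * listSeries R.2.1 * nest f r bs = R.2.2.eval y₁ y₂ y₃ := by
  induction bs with
  | nil =>
    simp only [reduce, nest, List.length_nil, pow_zero]
    have h1 : listSeries [1] = 1 := by simp [listSeries]
    refine ⟨h1, by rw [h1, mul_one, hK], ?_⟩
    simp [Triple.eval, listSeries]
  | cons b bs ih =>
    obtain ⟨ih₁, ih₂, ih₃⟩ := ih
    simp only [reduce, nest, List.length_cons]
    set R := S.reduce κ c r bs
    refine ⟨by rw [listSeries_mulList, ih₁]; ring, ?_, ?_⟩
    · rw [listSeries_mulList, listSeries_addList, ← euler_listSeries,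
        show K * (listSeries S.δ * listSeries R.2.1) = listSeries S.δ * (K * listSeries R.2.1) by
          ring, euler_mul, mul_add]
      linear_combination listSeries S.δ * ih₂
    · simp only [Triple.eval_add, Triple.eval_mul, listSeries_mulList, listSeries_addList,
        listSeries_smulList, eval_diff S h, ← ih₃, ← hf]
      rw [euler_mul (K * listSeries R.2.1)]
      push_cast
      linear_combination (- nest f r bs) * ih₂

/-- The test is on the reduced coefficients alone and does not depend on the solution y; the factor
K δⁿ cancels because power series form a domain. -/
theorem nest_eq_zero {y₁ y₂ y₃ : ℝ⟦X⟧} (h : S.Solves y₁ y₂ y₃) {K f : ℝ⟦X⟧} {κ : List ℤ}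
    {c : Triple} (hK : listSeries S.δ * euler K = listSeries κ * K)
    (hf : K * f = c.eval y₁ y₂ y₃) (r : ℤ) (bs : List (List ℤ))
    (hK0 : K ≠ 0) (hδ : listSeries S.δ ≠ 0)
    (hz : (S.reduce κ c r bs).2.2.isZero = true) : nest f r bs = 0 := by
  obtain ⟨h₁, -, h₃⟩ := S.reduce_spec h hK hf r bs
  rw [Triple.eval_eq_zero _ _ _ hz, h₁] at h₃
  exact (mul_eq_zero.1 h₃).resolve_left (mul_ne_zero hK0 (pow_ne_zero _ hδ))

end System

/-- `∑ᵢ lᵢ s (m - i)`, with the terms with `i > m` omitted. -/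
noncomputable def convList (s : ℕ → ℝ) : List ℤ → ℕ → ℝ
  | [], _ => 0
  | c :: _, 0 => c * s 0
  | c :: l, m + 1 => c * s (m + 1) + convList s l m

theorem coeff_intCast_mul (c : ℤ) (m : ℕ) (f : ℝ⟦X⟧) :
    coeff m ((c : ℝ⟦X⟧) * f) = c * coeff m f := by
  rw [← map_intCast (C (R := ℝ)) c, coeff_C_mul]

theorem coeff_listSeries_mul (l : List ℤ) (s : ℕ → ℝ) (m : ℕ) :
    coeff m (listSeries l * mk s) = convList s l m := by
  induction l generalizing m with
  | nil => simp [listSeries, convList]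
  | cons c l ih =>
    cases m with
    | zero =>
      rw [listSeries, convList, add_mul, map_add, coeff_intCast_mul, mul_assoc]
      simp
    | succ m =>
      rw [listSeries, convList, add_mul, map_add, coeff_intCast_mul, mul_assoc, coeff_succ_X_mul,
        ih, coeff_mk]

/-- `∑ₖ n ^ k * (bₖ * s) (n + r)`. -/
noncomputable def nestCoeff (s : ℕ → ℝ) (n r : ℕ) : List (List ℤ) → ℝ
  | [] => 0
  | b :: bs => convList s b (n + r) + n * nestCoeff s n r bs

/-- At X^(n + r) the operator θ - r multiplies by n, and convolution with a reversed column [m_r, …,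
m_0] yields ∑ mᵢ s (n + i). So these coefficients of `nest` are the left sides of the recurrence, in
Horner form in n. -/
theorem coeff_nest (s : ℕ → ℝ) (n r : ℕ) (bs : List (List ℤ)) :
    coeff (n + r) (System.nest (mk s) r bs) = nestCoeff s n r bs := by
  induction bs with
  | nil => simp [System.nest, nestCoeff]
  | cons b bs ih =>
    rw [System.nest, nestCoeff, map_add, map_sub, coeff_listSeries_mul, coeff_euler,
      coeff_intCast_mul, ih]
    push_cast; ring

end PowerSeriesOperators

/-! ### The three recurrences, deduced formally from the two linear relations. -/

section FormalRecurrences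

open PowerSeries

/-- The system satisfied by `a, w`, where the area series is `(1 - X ^ 2) a` and the volume series
is `(1 - X) w`. -/
def areaVolSystem : System :=
  ⟨[8, -56, 56, -8], ⟨[-6, 62, -162, 26], [12, -60, -60, 12], []⟩,
    ⟨[-3, 15, 15, -3], [6, 98, -126, 38], []⟩, ⟨[], [], [0, 0]⟩⟩

/-- The system satisfied by `a ^ 2, a w, w ^ 2`. -/
def quadraticSystem : System :=
  ⟨[8, -56, 56, -8], ⟨[-12, 124, -324, 52], [24, -120, -120, 24], []⟩,
    ⟨[-3, 15, 15, -3], [0, 160, -288, 64], [12, -60, -60, 12]⟩,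
    ⟨[], [-6, 30, 30, -6], [12, 196, -252, 76]⟩⟩

/-- The columns of `areaRec`, scaled by `1` and reversed. -/
def areaColumns : List (List ℤ) :=
  [[54, -474, 399, -84],
   [99, -835, 730, -136],
   [66, -529, 484, -81],
   [19, -143, 137, -21],
   [2, -14, 14, -2]]

/-- The columns of `volRec`, scaled by `1` and reversed. -/
def volColumns : List (List ℤ) :=
  [[90, -1008, 960, -252],
   [141, -1436, 1384, -303],
   [82, -748, 730, -136],
   [21, -169, 167, -27],
   [2, -14, 14, -2]]

/-- The columns of `isoRec`, scaled by `12232` and reversed. -/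
def isoColumns : List (List ℤ) :=
  [[6546653568, -119236161300, 709311266388, -1472211879228, 1390493835900, -647595717744, 145756088208, -13041659232],
   [7041743904, -125550276502, 732023855346, -1524577250976, 1451619424860, -677411701022, 149564708370, -12704294700],
   [3234766134, -56351691266, 321841622840, -672459054524, 645518710454, -301814933466, 65315724828, -5284701480],
   [822460415, -13970430847, 78121412337, -163720428321, 158457515673, -74228837833, 15735207287, -1216898711],
   [124982969, -2065443305, 11304865929, -23758375953, 23184921987, -10882115811, 2258693435, -167529251],
   [11350218, -182059702, 975235426, -2054897438, 2021855198, -950915746, 193221622, -13789578],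
   [570328, -8857640, 46440856, -98090344, 97303624, -45861816, 9123400, -628408],
   [12232, -183480, 941864, -1993816, 1993816, -941864, 183480, -12232]]

/-- Here K = 1, whose logarithmic derivative is the empty list, and the triple encodes the area
series as (1 - X²) a. -/
theorem area_check : (areaVolSystem.reduce [] ⟨[1, 0, -1], [], []⟩ 3 areaColumns).2.2.isZero = true := by
  decide +kernel

theorem vol_check : (areaVolSystem.reduce [] ⟨[], [1, -1], []⟩ 3 volColumns).2.2.isZero = true := by
  decide +kernel

/-- Here K = 4 X (1 - 6 X + X²); the first list is δ θK / K, and the triple expresses K times the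
series of the d_n in a², a w, w². -/
theorem iso_check :
    (quadraticSystem.reduce [8, -104, 120, -24] ⟨[-3, 15, 18, -18, -15, 3], [15, -3, 174, -174, 3, -15],
      [-18, 90, 108, -108, -90, 18]⟩ 7 isoColumns).2.2.isZero = true := by
  decide +kernel

theorem euler_one_sub_sq_mul (a : ℝ⟦X⟧) :
    euler ((1 - X ^ 2) * a) = -2 * X ^ 2 * a + (1 - X ^ 2) * euler a := by
  have h1 : euler (1 : ℝ⟦X⟧) = 0 := Derivation.map_one_eq_zero _
  rw [euler_mul, map_sub, pow_two, euler_mul, euler_X, h1]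
  ring

theorem euler_one_sub_mul (w : ℝ⟦X⟧) :
    euler ((1 - X) * w) = - X * w + (1 - X) * euler w := by
  have h1 : euler (1 : ℝ⟦X⟧) = 0 := Derivation.map_one_eq_zero _
  rw [euler_mul, map_sub, euler_X, h1]
  ring

theorem convList_singleton (s : ℕ → ℝ) (c : ℤ) (m : ℕ) : convList s [c] m = c * s m := by
  cases m <;> simp [convList]

/-- Solved for θA, the first relation has denominator 4 (1 - X²). Dividing A by 1 - X² and V by 1 -
X removes the factor 1 + X, and 8 (1 - X) (1 - 6 X + X²) becomes a common denominator. The divisors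
are units among power series. -/
theorem exists_regular_system {A V : ℝ⟦X⟧}
    (h₁ : 6 * (1 + X) ^ 3 * V = (3 - 10 * X - 5 * X ^ 2) * A + 4 * (1 - X ^ 2) * euler A)
    (h₂ : (-3 + 18 * X - 3 * X ^ 2) * A + (6 + 90 * X - 78 * X ^ 2 + 30 * X ^ 3) * V
      = 8 * (1 - X) * (1 - 6 * X + X ^ 2) * euler V) :
    ∃ a w : ℝ⟦X⟧, A = (1 - X ^ 2) * a ∧ V = (1 - X) * w ∧
      4 * (1 - X) * euler a = (-3 + 13 * X) * a + 6 * (1 + X) * w ∧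
      8 * (1 - X) * (1 - 6 * X + X ^ 2) * euler w
        = (-3 + 15 * X + 15 * X ^ 2 - 3 * X ^ 3) * a
          + (6 + 98 * X - 126 * X ^ 2 + 38 * X ^ 3) * w := by
  have u₁ : IsUnit (1 - X ^ 2 : ℝ⟦X⟧) := by
    rw [isUnit_iff_constantCoeff]; simp
  have u₂ : IsUnit (1 - X : ℝ⟦X⟧) := by
    rw [isUnit_iff_constantCoeff]; simp
  obtain ⟨a, rfl⟩ := u₁.dvd (a := A)
  obtain ⟨w, rfl⟩ := u₂.dvd (a := V)
  rw [euler_one_sub_sq_mul] at h₁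
  rw [euler_one_sub_mul] at h₂
  have u₃ : IsUnit ((1 - X) * (1 + X) ^ 2 : ℝ⟦X⟧) := by
    rw [isUnit_iff_constantCoeff]; simp
  refine ⟨a, w, rfl, rfl, u₃.mul_left_cancel ?_, u₂.mul_left_cancel ?_⟩
  · linear_combination -h₁
  · linear_combination -h₂

theorem listSeries_ne_zero {c : ℤ} {l : List ℤ} (hc : c ≠ 0) : listSeries (c :: l) ≠ 0 := by
  intro h
  have := congrArg (constantCoeff (R := ℝ)) h
  simp [listSeries, hc] at this

theorem satisfiesPRec_of_relations {sa sv sd : ℕ → ℝ}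
    (h₁ : 6 * (1 + X) ^ 3 * mk sv
      = (3 - 10 * X - 5 * X ^ 2) * mk sa + 4 * (1 - X ^ 2) * euler (mk sa))
    (h₂ : (-3 + 18 * X - 3 * X ^ 2) * mk sa + (6 + 90 * X - 78 * X ^ 2 + 30 * X ^ 3) * mk sv
      = 8 * (1 - X) * (1 - 6 * X + X ^ 2) * euler (mk sv))
    (h₃ : X * mk sd = 2 * euler (mk sv) * mk sa - 3 * mk sv * euler (mk sa)) :
    SatisfiesPRec areaRec sa ∧ SatisfiesPRec volRec sv ∧ SatisfiesPRec isoRec sd := by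
  obtain ⟨a, w, hA, hV, ha, hw⟩ := exists_regular_system h₁ h₂
  have hS : areaVolSystem.Solves a w 0 := by
    refine ⟨?_, ?_, ?_⟩ <;> simp only [areaVolSystem, Triple.eval, listSeries] <;> push_cast
    · linear_combination 2 * (1 - 6 * X + X ^ 2) * ha
    · linear_combination hw
    · simp
  -- Products of solutions solve the symmetric square of the system, by the product rule.
  have hQ : quadraticSystem.Solves (a ^ 2) (a * w) (w ^ 2) := by
    refine ⟨?_, ?_, ?_⟩ <;>
      simp only [quadraticSystem, Triple.eval, listSeries, pow_two, euler_mul] <;> push_cast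
    · linear_combination 4 * a * (1 - 6 * X + X ^ 2) * ha
    · linear_combination 2 * w * (1 - 6 * X + X ^ 2) * ha + a * hw
    · linear_combination 2 * w * hw
  have hδ : listSeries areaVolSystem.δ ≠ 0 := listSeries_ne_zero (by norm_num)
  have hδ' : listSeries quadraticSystem.δ ≠ 0 := listSeries_ne_zero (by norm_num)
  have h1 : euler (1 : ℝ⟦X⟧) = 0 := Derivation.map_one_eq_zero _
  refine ⟨fun n => ?_, fun n => ?_, fun n => ?_⟩
  · have := System.nest_eq_zero _ hS (K := 1) (f := mk sa) (by simp [listSeries, h1])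
      (by simp only [Triple.eval, listSeries, hA]; push_cast; ring) 3 areaColumns one_ne_zero hδ
      area_check
    have := congrArg (coeff (n + 3)) this
    rw [← Nat.cast_ofNat (R := ℤ) (n := 3), coeff_nest] at this
    simp [nestCoeff, areaColumns, convList, convList_singleton] at this
    simp [Fin.sum_univ_succ, areaRec]
    linear_combination this
  · have := System.nest_eq_zero _ hS (K := 1) (f := mk sv) (by simp [listSeries, h1])
      (by simp only [Triple.eval, listSeries, hV]; push_cast; ring) 3 volColumns one_ne_zero hδ
      vol_check
    have := congrArg (coeff (n + 3)) this
    rw [← Nat.cast_ofNat (R := ℤ) (n := 3), coeff_nest] at this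
    simp [nestCoeff, volColumns, convList, convList_singleton] at this
    simp [Fin.sum_univ_succ, volRec]
    linear_combination this
  -- Written through the system, 2 θV A - 3 V θA has denominator 4 (1 - 6 X + X²); the factor X is
  -- the one in `h₃`.
  · have hK : (X * listSeries [4, -24, 4] : ℝ⟦X⟧) ≠ 0 :=
      mul_ne_zero X_ne_zero (listSeries_ne_zero (by norm_num))
    have := System.nest_eq_zero _ hQ (K := X * listSeries [4, -24, 4]) (f := mk sd)
      (by
        rw [euler_mul, euler_X, euler_listSeries]
        simp only [quadraticSystem, listSeries, eulerList]; push_cast; ring)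
      (by
        rw [hA, hV, euler_one_sub_sq_mul, euler_one_sub_mul] at h₃
        have u : (1 - X : ℝ⟦X⟧) ≠ 0 := IsUnit.ne_zero (by rw [isUnit_iff_constantCoeff]; simp)
        refine mul_left_cancel₀ u ?_
        simp only [Triple.eval, listSeries]
        push_cast
        linear_combination 4 * (1 - X) * (1 - 6 * X + X ^ 2) * h₃
          + (1 - X) * (1 - X ^ 2) * a * hw
          - 3 * (1 - 6 * X + X ^ 2) * (1 - X) * (1 - X ^ 2) * w * ha) 7 isoColumns hK hδ'
      iso_check
    have := congrArg (coeff (n + 7)) this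
    rw [← Nat.cast_ofNat (R := ℤ) (n := 7), coeff_nest] at this
    simp [nestCoeff, isoColumns, convList, convList_singleton] at this
    simp [Fin.sum_univ_succ, isoRec]
    linear_combination (1 / 12232) * this

end FormalRecurrences

/-! ### Elimination modulo a prime as a certificate of nonsingularity over the reals. -/

section ModularElimination

/-- Gaussian elimination of one row against another, `a * s - b * r` modulo `p`. -/
def combRow (p a b : ℕ) : List ℕ → List ℕ → List ℕ
  | [], s => s.map fun y => (a * y) % p
  | x :: r, [] => ((p - 1) * b * x) % p :: combRow p a b r []
  | x :: r, y :: s => (a * y + (p - 1) * b * x) % p :: combRow p a b r s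

/-- Elimination of the first unknown from a row by means of the pivot row `a :: r`. -/
def elimHead (p a : ℕ) (r : List ℕ) : List ℕ → List ℕ
  | [] => []
  | b :: s => combRow p a b r s

/-- `k n`, with `n` evaluated first. -/
def forceNat {α : Type*} (n : ℕ) (k : ℕ → α) : α :=
  match n with
  | 0 => k 0
  | n + 1 => k (n + 1)

/-- `k l`, with the entries of `l` evaluated first. -/
def forceList {α : Type*} : List ℕ → (List ℕ → α) → α
  | [], k => k []
  | x :: l, k => forceNat x fun x' => forceList l fun l' => k (x' :: l')

/-- `k rows`, with the entries of `rows` evaluated first. -/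
def forceRows {α : Type*} : List (List ℕ) → (List (List ℕ) → α) → α
  | [], k => k []
  | l :: rows, k => forceList l fun l' => forceRows rows fun rows' => k (l' :: rows')

/-- The forcing combinators do not change values; they only make the rows numerals before the next
elimination step uses them. -/
theorem forceNat_eq {α : Type*} (n : ℕ) (k : ℕ → α) : forceNat n k = k n := by
  cases n <;> rfl

theorem forceList_eq {α : Type*} (l : List ℕ) (k : List ℕ → α) : forceList l k = k l := by
  induction l generalizing k with
  | nil => rfl
  | cons x l ih => rw [forceList, forceNat_eq, ih]

theorem forceRows_eq {α : Type*} (rows : List (List ℕ)) (k : List (List ℕ) → α) :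
    forceRows rows k = k rows := by
  induction rows generalizing k with
  | nil => rfl
  | cons l rows ih => rw [forceRows, forceList_eq, ih]

/-- Gaussian elimination modulo `p` in `m` unknowns, without pivot search: succeeds if all pivots
are units. -/
def elimination (p : ℕ) : ℕ → List (List ℕ) → Bool
  | 0, _ => true
  | _ + 1, [] => false
  | _ + 1, [] :: _ => false
  | m + 1, (a :: r) :: rows => (a % p != 0) &&
    forceRows (rows.map (elimHead p a r)) (elimination p m)

/-- The list `f j, f (j + 1), …` of length `m`. -/
def buildList {α : Type*} (f : ℕ → α) : ℕ → ℕ → List α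
  | 0, _ => []
  | m + 1, j => f j :: buildList f m (j + 1)

/-- The linear form with the given list of coefficients. -/
def dotList {p : ℕ} : List ℕ → (ℕ → ZMod p) → ZMod p
  | [], _ => 0
  | a :: l, y => a * y 0 + dotList l fun j => y (j + 1)

variable {p : ℕ}

theorem dotList_combRow [NeZero p] (a b : ℕ) (r s : List ℕ) (y : ℕ → ZMod p) :
    dotList (combRow p a b r s) y = a * dotList s y - b * dotList r y := by
  -- The entries are natural numbers, so `combRow` writes -b as (p - 1) * b.
  have hp : ((p - 1 : ℕ) : ZMod p) = -1 := by
    rw [Nat.cast_sub (NeZero.pos p)]; simp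
  induction r generalizing s y with
  | nil =>
    induction s generalizing y with
    | nil => simp [combRow, dotList]
    | cons c s ih => simp [combRow, dotList] at ih ⊢; rw [ih]; ring
  | cons c r ih =>
    cases s with
    | nil => simp only [combRow, dotList, ih, ZMod.natCast_mod]; push_cast; rw [hp]; ring
    | cons d s => simp only [combRow, dotList, ih, ZMod.natCast_mod]; push_cast; rw [hp]; ring

theorem dotList_zero (r : List ℕ) : dotList (p := p) r (fun _ => 0) = 0 := by
  induction r with
  | nil => rfl
  | cons a r ih => simp [dotList, ih]

/-- Eliminated rows no longer involve `y 0`, so by induction all other unknowns vanish; the pivot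
row then kills `y 0`, its pivot being a unit modulo p. -/
theorem eq_zero_of_elimination [Fact p.Prime] {m : ℕ} {rows : List (List ℕ)}
    (h : elimination p m rows = true) {y : ℕ → ZMod p} (hy : ∀ j, m ≤ j → y j = 0)
    (hrows : ∀ r ∈ rows, dotList r y = 0) : ∀ j, y j = 0 := by
  induction m generalizing rows y with
  | zero => exact fun j => hy j (Nat.zero_le j)
  | succ m ih =>
    match rows, h, hrows with
    | (a :: r) :: rows, h, hrows =>
      simp only [elimination, forceRows_eq, Bool.and_eq_true, bne_iff_ne, ne_eq] at h
      have ha : (a : ZMod p) ≠ 0 := by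
        rw [Ne, ZMod.natCast_eq_zero_iff]
        exact fun hd => h.1 (Nat.mod_eq_zero_of_dvd hd)
      have h0 := hrows _ List.mem_cons_self
      have htail : ∀ j, y (j + 1) = 0 := by
        refine ih h.2 (y := fun j => y (j + 1)) (fun j hj => hy _ (by omega)) ?_
        intro s hs
        obtain ⟨t, ht, rfl⟩ := List.mem_map.1 hs
        have h1 := hrows t (List.mem_cons_of_mem _ ht)
        cases t with
        | nil => simp [elimHead, dotList]
        | cons b t =>
          simp only [elimHead, dotList_combRow]
          simp only [dotList] at h0 h1
          linear_combination a * h1 - b * h0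
      have hfun : (fun j => y (j + 1)) = fun _ => (0 : ZMod p) := funext htail
      rw [dotList, hfun, dotList_zero, add_zero] at h0
      intro j
      cases j with
      | zero => exact (mul_eq_zero.1 h0).resolve_left ha
      | succ j => exact htail j

theorem dotList_buildList (f : ℕ → ℕ) (m j : ℕ) (y : ℕ → ZMod p) :
    dotList (buildList f m j) y = ∑ i ∈ Finset.range m, (f (j + i) : ZMod p) * y i := by
  induction m generalizing j y with
  | zero => simp [buildList, dotList]
  | succ m ih =>
    rw [buildList, dotList, ih, Finset.sum_range_succ', add_comm]
    simp only [add_zero]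
    congr 1
    exact Finset.sum_congr rfl fun i _ => by rw [show j + 1 + i = j + (i + 1) by ring]

theorem mem_buildList {α : Type*} {f : ℕ → α} {m j : ℕ} {x : α} (h : x ∈ buildList f m j) :
    ∃ i < m, x = f (j + i) := by
  induction m generalizing j with
  | zero => simp [buildList] at h
  | succ m ih =>
    rcases List.mem_cons.1 h with rfl | h
    · exact ⟨0, by omega, rfl⟩
    · obtain ⟨i, hi, rfl⟩ := ih h
      exact ⟨i + 1, by omega, by rw [show j + 1 + i = j + (i + 1) by ring]⟩

/-- The `m` linear equations modulo `p` that a recurrence of degree `d` for the sequence `σ` imposes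
on its coefficients, enumerated lexicographically. -/
def recurrenceRows (p d m : ℕ) (σ : List ℕ) : List (List ℕ) :=
  buildList (fun n => buildList
    (fun j => n ^ (j % (d + 1)) * σ.getD (n + j / (d + 1)) 0 % p) m 0) m 0

/-- A nonzero real kernel vector makes the integer determinant vanish, hence also its residue modulo
p. This would give a nonzero kernel vector over `ZMod p`, which the elimination excludes. The index
j encodes the matrix entry (j / (d + 1), j % (d + 1)). -/
theorem real_kernel_trivial [Fact p.Prime] {d m : ℕ} {σ : List ℕ} {s : ℕ → ℤ}
    (hσ : ∀ n, n ≤ m + m / (d + 1) → (σ.getD n 0 : ZMod p) = s n)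
    (h : elimination p m (recurrenceRows p d m σ) = true) {x : ℕ → ℝ}
    (hx : ∀ n < m, ∑ j ∈ Finset.range m, (n : ℝ) ^ (j % (d + 1)) * s (n + j / (d + 1)) * x j = 0) :
    ∀ j < m, x j = 0 := by
  classical
  let B : Matrix (Fin m) (Fin m) ℤ := fun n j =>
    ((n : ℕ) : ℤ) ^ ((j : ℕ) % (d + 1)) * s (n + (j : ℕ) / (d + 1))
  by_contra! hne
  obtain ⟨j₀, hj₀, hxj₀⟩ := hne
  have hdetR : (B.map (Int.castRingHom ℝ)).det = 0 := by
    refine Matrix.exists_mulVec_eq_zero_iff.1 ⟨fun j => x j, fun h0 => hxj₀ ?_, ?_⟩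
    · exact congrFun h0 ⟨j₀, hj₀⟩
    · ext n
      rw [Pi.zero_apply, ← hx n n.2, Finset.sum_range]
      simp only [Matrix.mulVec, dotProduct]
      refine Finset.sum_congr rfl fun j _ => ?_
      rw [Matrix.map_apply]
      simp only [B, Int.coe_castRingHom]
      push_cast
      rfl
  have hdet : B.det = 0 := by
    have : ((B.det : ℤ) : ℝ) = 0 := (RingHom.map_det (Int.castRingHom ℝ) B).trans hdetR
    exact_mod_cast this
  have hdetp : (B.map (Int.castRingHom (ZMod p))).det = 0 := by
    have := RingHom.map_det (Int.castRingHom (ZMod p)) B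
    rw [hdet, map_zero] at this
    exact this.symm
  obtain ⟨y, hy0, hy⟩ := Matrix.exists_mulVec_eq_zero_iff.2 hdetp
  let Y : ℕ → ZMod p := fun j => if hj : j < m then y ⟨j, hj⟩ else 0
  have hY := eq_zero_of_elimination h (y := Y) (fun j hj => by simp [Y, not_lt.2 hj]) (by
    intro r hr
    obtain ⟨n, hn, rfl⟩ := mem_buildList hr
    rw [dotList_buildList, Finset.sum_range]
    have := congrFun hy ⟨n, hn⟩
    rw [Pi.zero_apply] at this
    rw [← this]
    simp only [Matrix.mulVec, dotProduct]
    refine Finset.sum_congr rfl fun j _ => ?_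
    have hle : n + (j : ℕ) / (d + 1) ≤ m + m / (d + 1) :=
      add_le_add hn.le (Nat.div_le_div_right j.2.le)
    rw [Matrix.map_apply, ZMod.natCast_mod]
    simp only [Y, B, dif_pos j.2, Fin.eta, zero_add]
    push_cast
    rw [hσ _ hle]
    simp)
  exact hy0 (funext fun j => by simpa [Y] using hY j)

/-- Subtracting the multiple of `M₀` that clears the corner entry leaves m unknowns, and the
equations for n < m form a square system. Recurrences are insensitive to scaling the sequence, so
the integers `S` may replace `s`. -/
theorem recurrence_unique [Fact p.Prime] {r d : ℕ} {M₀ : Matrix (Fin (r + 1)) (Fin (d + 1)) ℝ}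
    {s : ℕ → ℝ} (hM₀ : SatisfiesPRec M₀ s) (hlast : M₀ (Fin.last r) (Fin.last d) ≠ 0)
    {κ : ℝ} {σ : List ℕ} {S : ℕ → ℤ} (hκ : κ ≠ 0) {m : ℕ} (hm : m + 1 = (r + 1) * (d + 1))
    (hs : ∀ n ≤ m + m / (d + 1), s n = κ * S n)
    (hσ : ∀ n ≤ m + m / (d + 1), (σ.getD n 0 : ZMod p) = S n)
    (h : elimination p m (recurrenceRows p d m σ) = true)
    {M : Matrix (Fin (r + 1)) (Fin (d + 1)) ℝ} (hM : SatisfiesPRec M s) :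
    ∃ c : ℝ, M = c • M₀ := by
  set c := M (Fin.last r) (Fin.last d) / M₀ (Fin.last r) (Fin.last d) with hc
  refine ⟨c, ?_⟩
  let N : Matrix (Fin (r + 1)) (Fin (d + 1)) ℝ := M - c • M₀
  have hN : SatisfiesPRec N s := fun n => by
    have h1 := hM n
    have h2 := hM₀ n
    have : ∑ i : Fin (r + 1), (∑ k : Fin (d + 1), N i k * (n : ℝ) ^ (k : ℕ)) * s (n + (i : ℕ))
        = ∑ i : Fin (r + 1), (∑ k : Fin (d + 1), M i k * (n : ℝ) ^ (k : ℕ)) * s (n + (i : ℕ))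
          - c * ∑ i : Fin (r + 1), (∑ k : Fin (d + 1), M₀ i k * (n : ℝ) ^ (k : ℕ)) *
            s (n + (i : ℕ)) := by
      rw [Finset.mul_sum, ← Finset.sum_sub_distrib]
      refine Finset.sum_congr rfl fun i _ => ?_
      rw [← mul_assoc, ← sub_mul, Finset.mul_sum, ← Finset.sum_sub_distrib]
      congr 1
      exact Finset.sum_congr rfl fun k _ => by simp [N]; ring
    rw [this, h1, h2]; ring
  have hNlast : N (Fin.last r) (Fin.last d) = 0 := by
    simp [N, hc, hlast]
  let x : ℕ → ℝ := fun j => if hj : j < (r + 1) * (d + 1) then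
    N (finProdFinEquiv.symm ⟨j, hj⟩).1 (finProdFinEquiv.symm ⟨j, hj⟩).2 else 0
  have hxz : ∀ j < m, x j = 0 := by
    refine real_kernel_trivial hσ h fun n hn => ?_
    -- The last index m encodes the corner entry, which was normalised to zero.
    have hxm : x m = 0 := by
      have hmlt : m < (r + 1) * (d + 1) := by omega
      have : finProdFinEquiv.symm ⟨m, hmlt⟩ = (Fin.last r, Fin.last d) := by
        rw [Equiv.symm_apply_eq]
        ext
        simp only [finProdFinEquiv_apply_val, Fin.val_last]
        have : (r + 1) * (d + 1) = d + (d + 1) * r + 1 := by ring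
        omega
      simp only [x, dif_pos hmlt, this, hNlast]
    have hkey : ∑ j ∈ Finset.range ((r + 1) * (d + 1)),
        (n : ℝ) ^ (j % (d + 1)) * s (n + j / (d + 1)) * x j = 0 := by
      rw [Finset.sum_range, ← hN n, ← finProdFinEquiv.sum_comp, Fintype.sum_prod_type]
      refine Finset.sum_congr rfl fun i _ => ?_
      rw [Finset.sum_mul]
      refine Finset.sum_congr rfl fun k _ => ?_
      have h1 : ((finProdFinEquiv (i, k) : Fin _) : ℕ) % (d + 1) = k := by
        simp [finProdFinEquiv_apply_val, Nat.mod_eq_of_lt k.2]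
      have h2 : ((finProdFinEquiv (i, k) : Fin _) : ℕ) / (d + 1) = i := by
        rw [finProdFinEquiv_apply_val, Nat.add_mul_div_left _ _ (Nat.succ_pos d),
          Nat.div_eq_of_lt k.2, zero_add]
      have h3 : x (finProdFinEquiv (i, k) : Fin _) = N i k := by
        simp only [x, Fin.is_lt, dif_pos, Fin.eta, Equiv.symm_apply_apply]
      rw [h1, h2, h3]; ring
    rw [← hm, Finset.sum_range_succ, hxm, mul_zero, add_zero] at hkey
    have : κ * ∑ j ∈ Finset.range m, (n : ℝ) ^ (j % (d + 1)) * S (n + j / (d + 1)) * x j = 0 := by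
      rw [← hkey, Finset.mul_sum]
      refine Finset.sum_congr rfl fun j hj => ?_
      rw [hs _ (add_le_add hn.le (Nat.div_le_div_right (Finset.mem_range.1 hj).le))]
      ring
    exact (mul_eq_zero.1 this).resolve_left hκ
  have hN0 : N = 0 := by
    ext i k
    by_cases hik : i = Fin.last r ∧ k = Fin.last d
    · rw [hik.1, hik.2, hNlast]; rfl
    · have hlt : ((finProdFinEquiv (i, k) : Fin _) : ℕ) < m := by
        have h1 := (finProdFinEquiv (i, k)).2
        have h2 : ((finProdFinEquiv (i, k) : Fin _) : ℕ) ≠ m := by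
          intro he
          apply hik
          rw [finProdFinEquiv_apply_val] at he
          dsimp only at he
          have hi := i.2
          have hk := k.2
          have e : (r + 1) * (d + 1) = d + (d + 1) * r + 1 := by ring
          have hmm : (k : ℕ) + (d + 1) * i = d + (d + 1) * r := by omega
          have hir : (i : ℕ) = r := by
            by_contra hne
            have : (i : ℕ) + 1 ≤ r := by omega
            have := Nat.mul_le_mul_left (d + 1) this
            rw [mul_add] at this
            omega
          rw [hir] at hmm
          exact ⟨Fin.ext hir, Fin.ext (by rw [Fin.val_last]; omega)⟩
        omega
      have := hxz _ hlt
      simp only [x, Fin.is_lt, dif_pos, Fin.eta, Equiv.symm_apply_apply] at this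
      exact this
  exact sub_eq_zero.1 hN0

end ModularElimination

/-! ### Exact initial terms of the sequences and their residues modulo 103. -/

section ExplicitTerms

/-- The value at `x` of the polynomial with coefficient list `l`. -/
def hornerList (l : List ℤ) (x : ℤ) : ℤ :=
  match l with
  | [] => 0
  | c :: l => c + x * hornerList l x

/-- The next term of a sequence satisfying a recurrence of order three. -/
def nextTerm (p₀ p₁ p₂ p₃ : List ℤ) (n x y z : ℤ) : ℤ :=
  -(hornerList p₀ n * x + hornerList p₁ n * y + hornerList p₂ n * z) / hornerList p₃ n

/-- The terms of a sequence satisfying a recurrence of order three, starting at index `n`. -/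
def termList (p₀ p₁ p₂ p₃ : List ℤ) : ℕ → ℤ → ℤ → ℤ → ℤ → List ℤ
  | 0, _, _, _, _ => []
  | k + 1, n, x, y, z =>
    x :: termList p₀ p₁ p₂ p₃ k (n + 1) y z (nextTerm p₀ p₁ p₂ p₃ n x y z)

/-- All divisions in `termList` are exact. -/
def termCheck (p₀ p₁ p₂ p₃ : List ℤ) : ℕ → ℤ → ℤ → ℤ → ℤ → Bool
  | 0, _, _, _, _ => true
  | k + 1, n, x, y, z =>
    (hornerList p₀ n * x + hornerList p₁ n * y + hornerList p₂ n * z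
      + hornerList p₃ n * nextTerm p₀ p₁ p₂ p₃ n x y z == 0) && (hornerList p₃ n != 0) &&
    termCheck p₀ p₁ p₂ p₃ k (n + 1) y z (nextTerm p₀ p₁ p₂ p₃ n x y z)

/-- The check guarantees a nonzero leading coefficient and exact integer division at each step, so
the recurrence forces each new real term to be κ times the computed integer. -/
theorem eq_termList {p₀ p₁ p₂ p₃ : List ℤ} {s : ℕ → ℝ} {κ : ℝ}
    (hs : ∀ n : ℕ, (hornerList p₀ n : ℝ) * s n + hornerList p₁ n * s (n + 1)
      + hornerList p₂ n * s (n + 2) + hornerList p₃ n * s (n + 3) = 0)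
    {k n : ℕ} {x y z : ℤ} (h : termCheck p₀ p₁ p₂ p₃ k n x y z = true)
    (hx : s n = κ * x) (hy : s (n + 1) = κ * y) (hz : s (n + 2) = κ * z) :
    ∀ i < k, s (n + i) = κ * ((termList p₀ p₁ p₂ p₃ k n x y z).getD i 0 : ℤ) := by
  induction k generalizing n x y z with
  | zero => exact fun i hi => absurd hi (Nat.not_lt_zero i)
  | succ k ih =>
    simp only [termCheck, Bool.and_eq_true, beq_iff_eq, bne_iff_ne, ne_eq] at h
    obtain ⟨⟨h1, h2⟩, h3⟩ := h
    intro i hi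
    cases i with
    | zero => simpa [termList] using hx
    | succ i =>
      have hw : s (n + 1 + 2) = κ * (nextTerm p₀ p₁ p₂ p₃ n x y z : ℤ) := by
        have e1 := congrArg (Int.cast (R := ℝ)) h1
        push_cast at e1
        have e2 := hs n
        rw [hx, hy, hz] at e2
        have h2' : (hornerList p₃ n : ℝ) ≠ 0 := by exact_mod_cast h2
        apply mul_left_cancel₀ h2'
        rw [show n + 1 + 2 = n + 3 by ring]
        linear_combination e2 - κ * e1
      have := ih (n := n + 1) (by exact_mod_cast h3) hy hz hw i (by omega)
      rw [show n + (i + 1) = n + 1 + i by ring, this, termList, List.getD_cons_succ]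
      push_cast
      rfl

/-- Multiples by `4 ^ 80` of the first rational numbers proportional to the `a_n`. -/
def areaList : List ℤ :=
  termList [-84, -136, -81, -21, -2] [399, 730, 484, 137, 14] [-474, -835, -529, -143, -14]
    [54, 99, 66, 19, 2] 72 0 (4 * 4 ^ 80) (52 * 4 ^ 80) (477 * 4 ^ 80)

/-- Multiples by `4 ^ 80` of the first rational numbers proportional to the `v_n`. -/
def volList : List ℤ :=
  termList [-252, -303, -136, -27, -2] [960, 1384, 730, 167, 14] [-1008, -1436, -748, -169, -14]
    [90, 141, 82, 21, 2] 72 0 (2 * 4 ^ 80) (48 * 4 ^ 80) (2538 * 4 ^ 79)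

/-- Iterated sum, `f 0 + ⋯ + f (n - 1)`. -/
def sumBelow (f : ℕ → ℤ) : ℕ → ℤ
  | 0 => 0
  | n + 1 => sumBelow f n + f n

theorem sumBelow_eq (f : ℕ → ℤ) (n : ℕ) : sumBelow f n = ∑ i ∈ Finset.range n, f i := by
  induction n with
  | zero => rfl
  | succ n ih => rw [sumBelow, ih, Finset.sum_range_succ]

/-- Conjunction of the `f i` for `i < n`. -/
def allBelow (f : ℕ → Bool) : ℕ → Bool
  | 0 => true
  | n + 1 => allBelow f n && f n

theorem allBelow_spec {f : ℕ → Bool} {n : ℕ} (h : allBelow f n = true) : ∀ i < n, f i = true := by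
  induction n with
  | zero => exact fun i hi => absurd hi (Nat.not_lt_zero i)
  | succ n ih =>
    simp only [allBelow, Bool.and_eq_true] at h
    intro i hi
    rcases Nat.lt_succ_iff_lt_or_eq.1 hi with hi | rfl
    · exact ih h.1 i hi
    · exact h.2

/-- The combination defining `isoCoeff`, for integer lists. -/
def isoTerm (a v : List ℤ) (n : ℕ) : ℤ :=
  2 * sumBelow (fun i => (i + 1) * v.getD (i + 1) 0 * a.getD (n - i) 0) (n + 1)
    - 3 * sumBelow (fun i => (i + 1) * a.getD (i + 1) 0 * v.getD (n - i) 0) (n + 1)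

/-- Residues of `areaList` modulo `103`. -/
def areaResidues : List ℕ :=
  [100, 64, 80, 53, 69, 21, 12, 24, 43, 49, 51, 56, 23, 86, 88, 53, 23, 23, 69, 24, 18, 99,
   29]

/-- Residues of `volList` modulo `103`. -/
def volResidues : List ℕ :=
  [50, 67, 52, 97, 78, 28, 32, 16, 101, 58, 75, 51, 39, 85, 10, 7, 82, 35, 30, 39, 60, 85, 78]

/-- Residues modulo `103` of the terms `isoTerm areaList volList n`. -/
def isoResidues : List ℕ :=
  [92, 31, 67, 61, 66, 94, 23, 43, 24, 35, 58, 54, 91, 87, 57, 7, 70, 67, 51, 102, 48, 8, 13,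
   83, 7, 86, 95, 24, 81, 46, 74, 26, 85, 0, 81, 50, 10, 6, 90, 39, 68, 68, 38, 53, 13, 71,
   64, 34, 29, 62, 26, 64, 43, 51, 46, 78, 92, 17, 20, 60, 83, 11, 32, 90, 61, 31, 84, 26,
   102, 20, 18]

/-- The list `σ` agrees with `f` modulo `p` on the first `n` terms. -/
def residueCheck (p : ℕ) (σ : List ℕ) (f : ℕ → ℤ) (n : ℕ) : Bool :=
  allBelow (fun i => (f i - (σ.getD i 0 : ℕ)) % (p : ℤ) == 0) n

theorem residueCheck_spec {p : ℕ} {σ : List ℕ} {f : ℕ → ℤ} {n : ℕ}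
    (h : residueCheck p σ f n = true) : ∀ i < n, (σ.getD i 0 : ZMod p) = f i := by
  intro i hi
  have h1 := allBelow_spec h i hi
  rw [beq_iff_eq] at h1
  have := (ZMod.intCast_zmod_eq_zero_iff_dvd _ p).2 (Int.dvd_of_emod_eq_zero h1)
  push_cast at this
  exact (sub_eq_zero.1 this).symm

/-- The factor 4 ^ 80 absorbs the denominators of the 72 terms needed: `isoTerm` at index 70 uses
the terms of index 71. -/
theorem area_termCheck : termCheck [-84, -136, -81, -21, -2] [399, 730, 484, 137, 14]
    [-474, -835, -529, -143, -14] [54, 99, 66, 19, 2] 72 0 (4 * 4 ^ 80) (52 * 4 ^ 80)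
    (477 * 4 ^ 80) = true := by
  decide +kernel

theorem vol_termCheck : termCheck [-252, -303, -136, -27, -2] [960, 1384, 730, 167, 14]
    [-1008, -1436, -748, -169, -14] [90, 141, 82, 21, 2] 72 0 (2 * 4 ^ 80) (48 * 4 ^ 80)
    (2538 * 4 ^ 79) = true := by
  decide +kernel

/-- The length comes from the bound m + m / (d + 1) in `recurrence_unique`: it is 22 for m = 19, d =
4, and 70 for m = 63, d = 7. -/
theorem area_residueCheck :
    residueCheck 103 areaResidues (fun n => areaList.getD n 0) 23 = true := by
  decide +kernel

theorem vol_residueCheck :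
    residueCheck 103 volResidues (fun n => volList.getD n 0) 23 = true := by
  decide +kernel

theorem iso_residueCheck :
    residueCheck 103 isoResidues (isoTerm areaList volList) 71 = true := by
  decide +kernel

theorem area_elimination :
    elimination 103 19 (recurrenceRows 103 4 19 areaResidues) = true := by
  decide +kernel

theorem vol_elimination :
    elimination 103 19 (recurrenceRows 103 4 19 volResidues) = true := by
  decide +kernel

set_option maxRecDepth 100000 in
theorem iso_elimination :
    elimination 103 63 (recurrenceRows 103 7 63 isoResidues) = true := by
  decide +kernel

end ExplicitTerms

/-! ### Uniqueness of the recurrences, deduced from the two linear relations. -/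

section Uniqueness

open PowerSeries

/-- Since θ = X d/dX, a factor X splits off on the right, and what remains is the Cauchy product for
2 V' A - 3 V A'. -/
theorem X_mul_mk_eq {sa sv sd : ℕ → ℝ}
    (hd : ∀ n, sd n = 2 * ∑ i ∈ Finset.range (n + 1), ((i : ℝ) + 1) * sv (i + 1) * sa (n - i)
      - 3 * ∑ i ∈ Finset.range (n + 1), ((i : ℝ) + 1) * sa (i + 1) * sv (n - i)) :
    X * mk sd = 2 * euler (mk sv) * mk sa - 3 * mk sv * euler (mk sa) := by
  have key : ∀ s t : ℕ → ℝ, derivative ℝ (mk s) * mk t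
      = mk fun n => ∑ i ∈ Finset.range (n + 1), ((i : ℝ) + 1) * s (i + 1) * t (n - i) := by
    intro s t
    ext n
    rw [coeff_mul, coeff_mk, Finset.Nat.sum_antidiagonal_eq_sum_range_succ_mk]
    refine Finset.sum_congr rfl fun i _ => ?_
    rw [coeff_derivative, coeff_mk, coeff_mk]; ring
  have hD : mk sd = 2 * (derivative ℝ (mk sv) * mk sa) - 3 * (derivative ℝ (mk sa) * mk sv) := by
    rw [key, key]
    ext n
    have c2 : (2 : ℝ⟦X⟧) = C (2 : ℝ) := (map_ofNat C 2).symm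
    have c3 : (3 : ℝ⟦X⟧) = C (3 : ℝ) := (map_ofNat C 3).symm
    rw [map_sub, c2, c3, coeff_C_mul, coeff_C_mul, coeff_mk, coeff_mk, coeff_mk, hd]
  have he : ∀ f : ℝ⟦X⟧, euler f = X * derivative ℝ f := fun f => rfl
  rw [hD, he, he]; ring

theorem euler_mk (s : ℕ → ℝ) : euler (mk s) = mk fun n => n * s n := by
  ext n; rw [coeff_euler, coeff_mk, coeff_mk]

theorem initial_terms {sa sv : ℕ → ℝ}
    (h₁ : 6 * (1 + X) ^ 3 * mk sv
      = (3 - 10 * X - 5 * X ^ 2) * mk sa + 4 * (1 - X ^ 2) * euler (mk sa))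
    (h₂ : (-3 + 18 * X - 3 * X ^ 2) * mk sa + (6 + 90 * X - 78 * X ^ 2 + 30 * X ^ 3) * mk sv
      = 8 * (1 - X) * (1 - 6 * X + X ^ 2) * euler (mk sv)) :
    sv 0 = sa 0 / 2 ∧ sa 1 = 13 * sa 0 ∧ sv 1 = 12 * sa 0 ∧ sa 2 = 477 / 4 * sa 0 ∧
      sv 2 = 1269 / 8 * sa 0 := by
  have e₁ : ∀ n, convList sv [6, 18, 18, 6] n
      = convList sa [3, -10, -5] n + convList (fun n => n * sa n) [4, 0, -4] n := by
    intro n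
    rw [← coeff_listSeries_mul, ← coeff_listSeries_mul, ← coeff_listSeries_mul, ← map_add,
      ← euler_mk]
    congr 1
    simp only [listSeries]
    push_cast
    linear_combination h₁
  have e₂ : ∀ n, convList sa [-3, 18, -3] n + convList sv [6, 90, -78, 30] n
      = convList (fun n => n * sv n) [8, -56, 56, -8] n := by
    intro n
    rw [← coeff_listSeries_mul, ← coeff_listSeries_mul, ← coeff_listSeries_mul, ← map_add,
      ← euler_mk]
    congr 1
    simp only [listSeries]
    push_cast
    linear_combination h₂
  -- At index 0 both relations say `sv 0 = sa 0 / 2`, so one suffices. At indices 1 and 2 they are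
  -- two linear equations for the two new terms.
  have a0 := e₁ 0
  have a1 := e₁ 1
  have a2 := e₁ 2
  have b1 := e₂ 1
  have b2 := e₂ 2
  norm_num [convList] at a0 a1 a2 b1 b2
  have i0 : sv 0 = sa 0 / 2 := by linarith
  have i1 : sa 1 = 13 * sa 0 := by linarith
  have i2 : sv 1 = 12 * sa 0 := by linarith
  exact ⟨i0, i1, i2, by linarith, by linarith⟩

theorem uniqueness_of_relations {sa sv sd : ℕ → ℝ}
    (h₁ : 6 * (1 + X) ^ 3 * mk sv
      = (3 - 10 * X - 5 * X ^ 2) * mk sa + 4 * (1 - X ^ 2) * euler (mk sa))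
    (h₂ : (-3 + 18 * X - 3 * X ^ 2) * mk sa + (6 + 90 * X - 78 * X ^ 2 + 30 * X ^ 3) * mk sv
      = 8 * (1 - X) * (1 - 6 * X + X ^ 2) * euler (mk sv))
    (hd : ∀ n, sd n = 2 * ∑ i ∈ Finset.range (n + 1), ((i : ℝ) + 1) * sv (i + 1) * sa (n - i)
      - 3 * ∑ i ∈ Finset.range (n + 1), ((i : ℝ) + 1) * sa (i + 1) * sv (n - i))
    (h0 : sa 0 ≠ 0) :
    (∀ M : Matrix (Fin (3 + 1)) (Fin (4 + 1)) ℝ, SatisfiesPRec M sa → ∃ c : ℝ, M = c • areaRec) ∧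
    (∀ M : Matrix (Fin (3 + 1)) (Fin (4 + 1)) ℝ, SatisfiesPRec M sv → ∃ c : ℝ, M = c • volRec) ∧
    (∀ M : Matrix (Fin (7 + 1)) (Fin (7 + 1)) ℝ, SatisfiesPRec M sd → ∃ c : ℝ, M = c • isoRec) := by
  obtain ⟨ra, rv, rd⟩ := satisfiesPRec_of_relations h₁ h₂ (X_mul_mk_eq hd)
  obtain ⟨v0, a1, v1, a2, v2⟩ := initial_terms h₁ h₂
  have : Fact (Nat.Prime 103) := ⟨by norm_num⟩
  -- Chosen so that `sa 0` is κ times the first entry 4 * 4 ^ 80 of `areaList`.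
  set κ : ℝ := sa 0 / 4 / 4 ^ 80 with hκ
  have hκ0 : κ ≠ 0 := div_ne_zero (div_ne_zero h0 (by norm_num)) (by positivity)
  have hsa : ∀ i < 72, sa i = κ * (areaList.getD i 0 : ℤ) := by
    have := eq_termList (s := sa) (κ := κ) (n := 0) (fun n => ?_) area_termCheck
      (by rw [hκ]; push_cast; field_simp; norm_num)
      (by rw [zero_add, a1, hκ]; push_cast; field_simp; norm_num)
      (by rw [zero_add, a2, hκ]; push_cast; field_simp; norm_num)
    · simpa only [zero_add, Nat.cast_zero, areaList] using this
    · have := ra n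
      simp [Fin.sum_univ_succ, areaRec] at this
      simp only [hornerList]
      push_cast
      linear_combination this
  have hsv : ∀ i < 72, sv i = κ * (volList.getD i 0 : ℤ) := by
    have := eq_termList (s := sv) (κ := κ) (n := 0) (fun n => ?_) vol_termCheck
      (by rw [v0, hκ]; push_cast; field_simp; norm_num)
      (by rw [zero_add, v1, hκ]; push_cast; field_simp; norm_num)
      (by rw [zero_add, v2, hκ]; push_cast; field_simp; norm_num)
    · simpa only [zero_add, Nat.cast_zero, volList] using this
    · have := rv n
      simp [Fin.sum_univ_succ, volRec] at this
      simp only [hornerList]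
      push_cast
      linear_combination this
  have hsd : ∀ i < 71, sd i = (κ * κ) * (isoTerm areaList volList i : ℤ) := by
    intro n hn
    rw [hd, isoTerm, sumBelow_eq, sumBelow_eq]
    push_cast
    rw [mul_sub, Finset.mul_sum, Finset.mul_sum, Finset.mul_sum, Finset.mul_sum, Finset.mul_sum,
      Finset.mul_sum]
    congr 1 <;> refine Finset.sum_congr rfl fun i hi => ?_ <;>
      rw [hsa _ (by have := Finset.mem_range.1 hi; omega),
        hsv _ (by have := Finset.mem_range.1 hi; omega)] <;> ring
  refine ⟨fun M hM => ?_, fun M hM => ?_, fun M hM => ?_⟩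
  · refine recurrence_unique (p := 103) (m := 19) (σ := areaResidues)
      (S := fun n => areaList.getD n 0) ra ?_ hκ0 (by norm_num) (fun n hn => ?_) (fun n hn => ?_)
      area_elimination hM
    · norm_num [areaRec, Fin.last]
    · exact hsa n (by omega)
    · exact residueCheck_spec area_residueCheck n (by omega)
  · refine recurrence_unique (p := 103) (m := 19) (σ := volResidues)
      (S := fun n => volList.getD n 0) rv ?_ hκ0 (by norm_num) (fun n hn => ?_) (fun n hn => ?_)
      vol_elimination hM
    · norm_num [volRec, Fin.last]
    · exact hsv n (by omega)
    · exact residueCheck_spec vol_residueCheck n (by omega)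
  · refine recurrence_unique (p := 103) (m := 63) (σ := isoResidues)
      (S := isoTerm areaList volList) rd ?_ (mul_ne_zero hκ0 hκ0) (by norm_num)
      (fun n hn => ?_) (fun n hn => ?_) iso_elimination hM
    · norm_num [isoRec, Fin.last]
    · exact hsd n (by omega)
    · exact residueCheck_spec iso_residueCheck n (by omega)

end Uniqueness

/-! ### The conformal factor and its positivity on the solid torus. -/

section Conformal

/-- The conformal factor of `sct a` is the inverse of this quantity. -/
noncomputable def sctDenom (a x : E3) : ℝ := 1 + 2 * inner ℝ a x + ‖a‖ ^ 2 * ‖x‖ ^ 2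

theorem norm_inversion_add_sq (a : E3) {x : E3} (hx : x ≠ 0) :
    ‖x‖ ^ 2 * ‖EuclideanGeometry.inversion (0 : E3) 1 x + a‖ ^ 2 = sctDenom a x := by
  have hn : ‖x‖ ≠ 0 := norm_ne_zero_iff.2 hx
  rw [norm_add_sq_real, EuclideanGeometry.inversion_def]
  simp only [dist_zero_right, vsub_eq_sub, sub_zero, vadd_eq_add, add_zero, norm_smul,
    inner_smul_left, Real.norm_eq_abs, sctDenom, real_inner_comm]
  rw [mul_pow, sq_abs]
  simp only [conj_trivial]
  field_simp

/-- The derivative of the inversion at x is the reflection in the hyperplane orthogonal to x,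
divided by |x|². The chain rule gives a product of two reflections divided by |x|²|x'|², which is
`sctDenom a x`. -/
theorem hasFDerivAt_sct {a x : E3} (hx : x ≠ 0) (hD : sctDenom a x ≠ 0) :
    ∃ L : E3 →L[ℝ] E3, HasFDerivAt (sct a) ((sctDenom a x)⁻¹ • L) x ∧
      (∀ y z, inner ℝ (L y) (L z) = inner ℝ y z) ∧ |L.det| = 1 := by
  set x' := EuclideanGeometry.inversion (0 : E3) 1 x + a with hx'
  have hkey : ‖x‖ ^ 2 * ‖x'‖ ^ 2 = sctDenom a x := norm_inversion_add_sq a hx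
  have hx'0 : x' ≠ 0 := by
    intro h
    rw [h, norm_zero] at hkey
    exact hD (by rw [← hkey]; ring)
  set R₁ : E3 ≃ₗᵢ[ℝ] E3 := (ℝ ∙ (x - 0))ᗮ.reflection
  set R₂ : E3 ≃ₗᵢ[ℝ] E3 := (ℝ ∙ (x' - 0))ᗮ.reflection
  have h₁ : HasFDerivAt (fun y => EuclideanGeometry.inversion (0 : E3) 1 y + a)
      ((1 / dist x 0) ^ 2 • (R₁ : E3 →L[ℝ] E3)) x :=
    (EuclideanGeometry.hasFDerivAt_inversion hx).add_const a
  have h₂ : HasFDerivAt (EuclideanGeometry.inversion (0 : E3) 1)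
      ((1 / dist x' 0) ^ 2 • (R₂ : E3 →L[ℝ] E3)) x' :=
    EuclideanGeometry.hasFDerivAt_inversion hx'0
  refine ⟨(R₂ : E3 →L[ℝ] E3) ∘L (R₁ : E3 →L[ℝ] E3), ?_, fun y z => ?_, ?_⟩
  · refine (HasFDerivAt.comp x h₂ h₁).congr_fderiv ?_
    rw [← hkey, dist_zero_right, dist_zero_right]
    ext1 y
    simp only [ContinuousLinearMap.comp_apply, _root_.smul_apply, map_smul, smul_smul]
    congr 1
    rw [mul_inv]; ring
  · change inner ℝ (R₂ (R₁ y)) (R₂ (R₁ z)) = inner ℝ y z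
    rw [LinearIsometryEquiv.inner_map_map, LinearIsometryEquiv.inner_map_map]
  · have h : ∀ K : Submodule ℝ E3, |LinearMap.det K.reflection.toLinearMap| = 1 := fun K => by
      rw [Submodule.det_reflection, abs_pow]; simp
    change |LinearMap.det (R₂.toLinearMap ∘ₗ R₁.toLinearMap)| = 1
    rw [LinearMap.det_comp, abs_mul, h, h, one_mul]

/-- `sctDenom` at the point `torusPoint u v r`, for the translation vector `(t, 0, 0)`. -/
noncomputable def denom (t u v r : ℝ) : ℝ :=
  1 + 2 * t * (√2 + r * Real.sin v) * Real.cos u + t ^ 2 * (2 + 2 * √2 * r * Real.sin v + r ^ 2)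

theorem norm_torusPoint_sq (u v r : ℝ) :
    ‖torusPoint u v r‖ ^ 2 = 2 + 2 * √2 * r * Real.sin v + r ^ 2 := by
  have h2 : √2 ^ 2 = 2 := Real.sq_sqrt (by norm_num)
  rw [EuclideanSpace.norm_sq_eq]
  simp only [torusPoint, Fin.sum_univ_three, Real.norm_eq_abs, sq_abs]
  simp
  linear_combination ((√2 + r * Real.sin v) ^ 2) * Real.sin_sq_add_cos_sq u
    + r ^ 2 * Real.sin_sq_add_cos_sq v + h2

theorem sctDenom_torusPoint (t u v r : ℝ) :
    sctDenom !₂[t, 0, 0] (torusPoint u v r) = denom t u v r := by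
  have h1 : inner ℝ (!₂[t, 0, 0] : E3) (torusPoint u v r)
      = t * ((√2 + r * Real.sin v) * Real.cos u) := by
    simp [torusPoint, PiLp.inner_apply, Fin.sum_univ_three]; ring
  have h2 : ‖(!₂[t, 0, 0] : E3)‖ ^ 2 = t ^ 2 := by
    rw [EuclideanSpace.norm_sq_eq]
    simp [Fin.sum_univ_three]
  rw [sctDenom, h1, h2, norm_torusPoint_sq, denom]
  ring

theorem radius_pos (v : ℝ) {r : ℝ} (hr : r ∈ Set.Icc (0 : ℝ) 1) : 0 < √2 + r * Real.sin v := by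
  have h2 : 1 < √2 := Real.lt_sqrt_of_sq_lt (by norm_num)
  have := Real.neg_one_le_sin v
  nlinarith [hr.1, hr.2]

theorem torusPoint_ne_zero (u v : ℝ) {r : ℝ} (hr : r ∈ Set.Icc (0 : ℝ) 1) :
    torusPoint u v r ≠ 0 := by
  intro h
  have h1 := norm_torusPoint_sq u v r
  rw [h, norm_zero] at h1
  have h2 : √2 ^ 2 = 2 := Real.sq_sqrt (by norm_num)
  have h3 := radius_pos v hr
  nlinarith [Real.sin_sq_le_one v, sq_nonneg r, mul_nonneg (sq_nonneg r) (sub_nonneg.2 (Real.sin_sq_le_one v))]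

/-- On the solid torus |x| ≤ √2 + 1 = 1 / (√2 - 1), so t²|x|² < 1. Then 2|t x₁| ≤ 2|t||x| < 1 +
t²|x|², strictly because (1 - t²|x|²)² > 0. -/
theorem denom_pos {t : ℝ} (ht : |t| < √2 - 1) (u v : ℝ) {r : ℝ} (hr : r ∈ Set.Icc (0 : ℝ) 1) :
    0 < denom t u v r := by
  have h2 : √2 ^ 2 = 2 := Real.sq_sqrt (by norm_num)
  have h1 : 1 < √2 := Real.lt_sqrt_of_sq_lt (by norm_num)
  have hs := Real.sin_le_one v
  have hs' := Real.sin_sq_le_one v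
  set s := Real.sin v
  set c := Real.cos u
  have hP : 2 + 2 * √2 * r * s + r ^ 2 ≤ (√2 + 1) ^ 2 := by
    have : r * s ≤ 1 := by nlinarith [hr.1, hr.2]
    nlinarith [hr.1, hr.2]
  have hx : (√2 + r * s) ^ 2 ≤ 2 + 2 * √2 * r * s + r ^ 2 := by
    nlinarith [mul_nonneg (sq_nonneg r) (sub_nonneg.2 hs')]
  have hx' : ((√2 + r * s) * c) ^ 2 ≤ 2 + 2 * √2 * r * s + r ^ 2 := by
    have : c ^ 2 ≤ 1 := Real.cos_sq_le_one u
    rw [mul_pow]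
    nlinarith [mul_nonneg (sq_nonneg (√2 + r * s)) (sub_nonneg.2 this)]
  set P := 2 + 2 * √2 * r * s + r ^ 2
  have ht2 : t ^ 2 < (√2 - 1) ^ 2 := by
    rw [← sq_abs]; gcongr
  have hP0 : 0 ≤ P := le_trans (sq_nonneg _) hx
  have htP : t ^ 2 * P < 1 := by
    calc t ^ 2 * P ≤ t ^ 2 * (√2 + 1) ^ 2 := by gcongr
      _ < (√2 - 1) ^ 2 * (√2 + 1) ^ 2 := by gcongr
      _ = 1 := by rw [← mul_pow]; nlinarith
  have habs : |2 * t * ((√2 + r * s) * c)| < 1 + t ^ 2 * P := by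
    refine abs_lt_of_sq_lt_sq ?_ (by positivity)
    have : (2 * t * ((√2 + r * s) * c)) ^ 2 ≤ 4 * (t ^ 2 * P) := by
      nlinarith [mul_le_mul_of_nonneg_left hx' (sq_nonneg t)]
    nlinarith [sq_pos_of_pos (sub_pos.2 htP)]
  have := (abs_lt.1 habs).1
  rw [denom]
  change 0 < 1 + 2 * t * (√2 + r * s) * c + t ^ 2 * P
  linarith

end Conformal

/-! ### The area integral, and toroidal coordinates on the solid torus. -/

section IntegralFormulas

open MeasureTheory Set

theorem hasDerivAt_E3 {f : ℝ → E3} {f' : E3} {x : ℝ}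
    (h : ∀ i, HasDerivAt (fun s => f s i) (f' i) x) : HasDerivAt f f' x := by
  rw [hasDerivAt_iff_hasFDerivAt, ← hasFDerivWithinAt_univ, hasFDerivWithinAt_euclidean]
  intro i
  rw [hasFDerivWithinAt_univ]
  refine (h i).hasFDerivAt.congr_fderiv ?_
  ext
  simp

theorem hasDerivAt_torusPoint_fst (u v r : ℝ) :
    HasDerivAt (fun s => torusPoint s v r)
      !₂[-((√2 + r * Real.sin v) * Real.sin u), (√2 + r * Real.sin v) * Real.cos u, 0] u := by
  refine hasDerivAt_E3 fun i => ?_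
  fin_cases i
  · exact ((Real.hasDerivAt_cos u).const_mul (√2 + r * Real.sin v)).congr_deriv (mul_neg _ _)
  · simpa [torusPoint] using (Real.hasDerivAt_sin u).const_mul (√2 + r * Real.sin v)
  · simpa [torusPoint] using hasDerivAt_const u (r * Real.cos v)

theorem hasDerivAt_torusPoint_snd (u v r : ℝ) :
    HasDerivAt (fun s => torusPoint u s r)
      !₂[r * Real.cos v * Real.cos u, r * Real.cos v * Real.sin u, -(r * Real.sin v)] v := by
  have h := ((Real.hasDerivAt_sin v).const_mul r).const_add √2
  refine hasDerivAt_E3 fun i => ?_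
  fin_cases i
  · simpa [torusPoint] using h.mul_const (Real.cos u)
  · simpa [torusPoint] using h.mul_const (Real.sin u)
  · simpa [torusPoint] using (Real.hasDerivAt_cos v).const_mul r

theorem inner_vec3 (a b c a' b' c' : ℝ) :
    inner ℝ (!₂[a, b, c] : E3) !₂[a', b', c'] = a * a' + b * b' + c * c' := by
  rw [PiLp.inner_apply, Fin.sum_univ_three]
  simp [mul_comm]

/-- The coordinate vectors of the torus are orthogonal, of lengths √2 + sin v and 1, and
conformality divides each by `denom`. -/
theorem area_eq_integral {t : ℝ} (ht : |t| < √2 - 1) :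
    area t = ∫ u in (0 : ℝ)..(2 * π), ∫ v in (0 : ℝ)..(2 * π),
      (√2 + Real.sin v) / denom t u v 1 ^ 2 := by
  have h1 : (1 : ℝ) ∈ Icc (0 : ℝ) 1 := ⟨zero_le_one, le_rfl⟩
  rw [area, surfaceArea]
  refine intervalIntegral.integral_congr fun u _ => intervalIntegral.integral_congr fun v _ => ?_
  have hD := denom_pos ht u v h1
  have hρ := radius_pos v h1
  rw [one_mul] at hρ
  have hD' := sctDenom_torusPoint t u v 1
  obtain ⟨L, hL, hinner, -⟩ := hasFDerivAt_sct (a := !₂[t, 0, 0]) (torusPoint_ne_zero u v h1)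
    (by rw [hD']; exact hD.ne')
  rw [hD'] at hL
  have d₁ := (HasFDerivAt.comp_hasDerivAt u (f := fun s => torusPoint s v 1) hL
    (hasDerivAt_torusPoint_fst u v 1)).deriv
  have d₂ := (HasFDerivAt.comp_hasDerivAt v (f := fun s => torusPoint u s 1) hL
    (hasDerivAt_torusPoint_snd u v 1)).deriv
  simp only [Function.comp_def] at d₁ d₂
  beta_reduce
  rw [d₁, d₂]
  simp only [← real_inner_self_eq_norm_sq, _root_.smul_apply, inner_smul_left, inner_smul_right,
    hinner, conj_trivial]
  have i₁ : inner ℝ (!₂[-((√2 + 1 * Real.sin v) * Real.sin u), (√2 + 1 * Real.sin v) * Real.cos u, 0]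
      : E3) !₂[-((√2 + 1 * Real.sin v) * Real.sin u), (√2 + 1 * Real.sin v) * Real.cos u, 0]
      = (√2 + Real.sin v) ^ 2 := by
    rw [inner_vec3]
    linear_combination (√2 + Real.sin v) ^ 2 * Real.sin_sq_add_cos_sq u
  have i₂ : inner ℝ (!₂[1 * Real.cos v * Real.cos u, 1 * Real.cos v * Real.sin u,
      -(1 * Real.sin v)] : E3) !₂[1 * Real.cos v * Real.cos u, 1 * Real.cos v * Real.sin u,
      -(1 * Real.sin v)] = 1 := by
    rw [inner_vec3]
    linear_combination Real.cos v ^ 2 * Real.sin_sq_add_cos_sq u + Real.sin_sq_add_cos_sq v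
  have i₃ : inner ℝ (!₂[-((√2 + 1 * Real.sin v) * Real.sin u), (√2 + 1 * Real.sin v) * Real.cos u, 0]
      : E3) !₂[1 * Real.cos v * Real.cos u, 1 * Real.cos v * Real.sin u,
      -(1 * Real.sin v)] = 0 := by
    rw [inner_vec3]
    ring
  rw [i₁, i₂, i₃, ← Real.sqrt_sq (show 0 ≤ (√2 + Real.sin v) / denom t u v 1 ^ 2 by positivity)]
  congr 1
  field_simp
  ring

/-- The parametrization of the solid torus, as a self-map of three-space. -/
noncomputable def torusMap (y : E3) : E3 := torusPoint (y 0) (y 1) (y 2)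

/-- The Jacobian matrix of `torusMap`. -/
noncomputable def torusJacobian (y : E3) : Matrix (Fin 3) (Fin 3) ℝ :=
  !![-(√2 + y 2 * Real.sin (y 1)) * Real.sin (y 0), y 2 * Real.cos (y 1) * Real.cos (y 0),
      Real.sin (y 1) * Real.cos (y 0);
    (√2 + y 2 * Real.sin (y 1)) * Real.cos (y 0), y 2 * Real.cos (y 1) * Real.sin (y 0),
      Real.sin (y 1) * Real.sin (y 0);
    0, -(y 2 * Real.sin (y 1)), Real.cos (y 1)]

theorem det_torusJacobian (y : E3) :
    (torusJacobian y).det = -(y 2 * (√2 + y 2 * Real.sin (y 1))) := by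
  rw [Matrix.det_fin_three]
  simp [torusJacobian]
  have h0 := Real.sin_sq_add_cos_sq (y 0)
  have h1 := Real.sin_sq_add_cos_sq (y 1)
  linear_combination (-(y 2 * (√2 + y 2 * Real.sin (y 1))))
      * ((Real.sin (y 1) ^ 2 + Real.cos (y 1) ^ 2) * h0 + h1)

theorem hasFDerivAt_torusMap (y : E3) :
    HasFDerivAt torusMap (Matrix.toLpLin 2 2 (torusJacobian y)).toContinuousLinearMap y := by
  have hp : ∀ i : Fin 3, HasFDerivAt (fun z : E3 => z i) (EuclideanSpace.proj i : E3 →L[ℝ] ℝ) y :=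
    fun i => (EuclideanSpace.proj i : E3 →L[ℝ] ℝ).hasFDerivAt
  have hρ := ((hp 2).mul (hp 1).sin).const_add √2
  rw [← hasFDerivWithinAt_univ, hasFDerivWithinAt_euclidean]
  intro i
  rw [hasFDerivWithinAt_univ]
  fin_cases i
  · refine (hρ.mul (hp 0).cos).congr_fderiv ?_
    ext z
    simp [torusJacobian, Matrix.toLpLin_apply, dotProduct, Fin.sum_univ_three]
    ring
  · refine (hρ.mul (hp 0).sin).congr_fderiv ?_
    ext z
    simp [torusJacobian, Matrix.toLpLin_apply, dotProduct, Fin.sum_univ_three]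
    ring
  · refine ((hp 2).mul (hp 1).cos).congr_fderiv ?_
    ext z
    simp [torusJacobian, Matrix.toLpLin_apply, dotProduct, Fin.sum_univ_three]
    ring

theorem eq_of_cos_eq_of_sin_eq {a b : ℝ} (ha : a ∈ Ioo 0 (2 * π)) (hb : b ∈ Ioo 0 (2 * π))
    (hc : Real.cos a = Real.cos b) (hs : Real.sin a = Real.sin b) : a = b := by
  have : Real.cos (a - b) = 1 := by
    rw [Real.cos_sub, hc, hs]
    linear_combination Real.sin_sq_add_cos_sq b
  rw [Real.cos_eq_one_iff_of_lt_of_lt (by linarith [ha.1, hb.2]) (by linarith [ha.2, hb.1])] at this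
  linarith

/-- The open parameter box. -/
def openBox : Set E3 := {y | y 0 ∈ Ioo 0 (2 * π) ∧ y 1 ∈ Ioo 0 (2 * π) ∧ y 2 ∈ Ioo (0 : ℝ) 1}

/-- The closed parameter box. -/
def closedBox : Set E3 := {y | y 0 ∈ Icc 0 (2 * π) ∧ y 1 ∈ Icc 0 (2 * π) ∧ y 2 ∈ Icc (0 : ℝ) 1}

theorem solidTorus_eq_image : solidTorus = torusMap '' closedBox := by
  ext x
  constructor
  · rintro ⟨u, hu, v, hv, r, hr, rfl⟩
    exact ⟨!₂[u, v, r], ⟨hu, hv, hr⟩, rfl⟩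
  · rintro ⟨y, ⟨hu, hv, hr⟩, rfl⟩
    exact ⟨_, hu, _, hv, _, hr, rfl⟩

/-- The first two coordinates determine the distance √2 + r sin v from the axis, because it is
positive; r sin v and r cos v then determine r > 0. The open angle intervals make sine and cosine
determine u and v. -/
theorem injOn_torusMap : InjOn torusMap openBox := by
  rintro y ⟨hu, hv, hr⟩ z ⟨hu', hv', hr'⟩ h
  have e0 := congrArg (fun x : E3 => x 0) h
  have e1 := congrArg (fun x : E3 => x 1) h
  have e2 := congrArg (fun x : E3 => x 2) h
  simp [torusMap, torusPoint] at e0 e1 e2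
  have p := radius_pos (y 1) (Ioo_subset_Icc_self hr)
  have p' := radius_pos (z 1) (Ioo_subset_Icc_self hr')
  have hρ : √2 + y 2 * Real.sin (y 1) = √2 + z 2 * Real.sin (z 1) := by
    rw [← abs_of_pos p, ← abs_of_pos p', ← sq_eq_sq_iff_abs_eq_abs]
    have a0 := congrArg (· ^ 2) e0
    have a1 := congrArg (· ^ 2) e1
    simp only [mul_pow] at a0 a1
    linear_combination a0 + a1
      - (√2 + y 2 * Real.sin (y 1)) ^ 2 * Real.sin_sq_add_cos_sq (y 0)
      + (√2 + z 2 * Real.sin (z 1)) ^ 2 * Real.sin_sq_add_cos_sq (z 0)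
  have hs : y 2 * Real.sin (y 1) = z 2 * Real.sin (z 1) := by linarith
  have hr2 : y 2 = z 2 := by
    rw [← abs_of_pos hr.1, ← abs_of_pos hr'.1, ← sq_eq_sq_iff_abs_eq_abs]
    have a0 := congrArg (· ^ 2) hs
    have a1 := congrArg (· ^ 2) e2
    simp only [mul_pow] at a0 a1
    linear_combination a0 + a1 - y 2 ^ 2 * Real.sin_sq_add_cos_sq (y 1)
      + z 2 ^ 2 * Real.sin_sq_add_cos_sq (z 1)
  rw [hρ] at e0 e1
  rw [hr2] at hs e2
  have q0 := eq_of_cos_eq_of_sin_eq hu hu' (mul_left_cancel₀ p'.ne' e0) (mul_left_cancel₀ p'.ne' e1)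
  have q1 := eq_of_cos_eq_of_sin_eq hv hv' (mul_left_cancel₀ hr'.1.ne' e2)
    (mul_left_cancel₀ hr'.1.ne' hs)
  ext i
  fin_cases i
  · exact q0
  · exact q1
  · exact hr2

end IntegralFormulas

/-! ### The volume as a triple integral over the parameter box. -/

section VolumeFormula

open MeasureTheory Set

/-- In dimension three the conformal factor enters the Jacobian cubed; the remaining factor is the
Jacobian of toroidal coordinates. -/
theorem exists_hasFDerivAt_sct_torusMap {t : ℝ} (ht : |t| < √2 - 1) {y : E3}
    (hy : y 2 ∈ Icc (0 : ℝ) 1) :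
    ∃ T : E3 →L[ℝ] E3, HasFDerivAt (fun z => sct !₂[t, 0, 0] (torusMap z)) T y ∧
      |T.det| = y 2 * (√2 + y 2 * Real.sin (y 1)) / denom t (y 0) (y 1) (y 2) ^ 3 := by
  have hD := denom_pos ht (y 0) (y 1) hy
  have hρ := radius_pos (y 1) hy
  have hD' := sctDenom_torusPoint t (y 0) (y 1) (y 2)
  obtain ⟨L, hL, -, hdet⟩ := hasFDerivAt_sct (a := !₂[t, 0, 0])
    (torusPoint_ne_zero (y 0) (y 1) hy) (by rw [hD']; exact hD.ne')
  rw [hD'] at hL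
  refine ⟨_, HasFDerivAt.comp y (f := torusMap) hL (hasFDerivAt_torusMap y), ?_⟩
  have h1 : LinearMap.det (Matrix.toLpLin 2 2 (torusJacobian y)) = (torusJacobian y).det :=
    LinearMap.det_toLpLin _ _
  have h2 : ((denom t (y 0) (y 1) (y 2))⁻¹ • L).det
      = (denom t (y 0) (y 1) (y 2))⁻¹ ^ 3 * L.det := by
    change LinearMap.det ((denom t (y 0) (y 1) (y 2))⁻¹ • (L : E3 →ₗ[ℝ] E3)) = _
    rw [LinearMap.det_smul, finrank_euclideanSpace_fin]
  change |LinearMap.det ((((denom t (y 0) (y 1) (y 2))⁻¹ • L : E3 →L[ℝ] E3) : E3 →ₗ[ℝ] E3) ∘ₗ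
    (Matrix.toLpLin 2 2 (torusJacobian y)))| = _
  rw [LinearMap.det_comp, h1, det_torusJacobian]
  change |((denom t (y 0) (y 1) (y 2))⁻¹ • L).det * _| = _
  rw [h2, abs_mul, abs_mul, hdet, abs_neg, abs_of_nonneg (mul_nonneg hy.1 hρ.le),
    abs_of_pos (by positivity)]
  field_simp

theorem volume_closedBox_diff_openBox : volume (closedBox \ openBox) = 0 := by
  let b : Fin 3 → ℝ := ![2 * π, 2 * π, 1]
  have h : (Set.pi univ fun i => Ioo ((0 : Fin 3 → ℝ) i) (b i)) =ᵐ[volume] Icc 0 b :=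
    Measure.univ_pi_Ioo_ae_eq_Icc
  have h' := (PiLp.volume_preserving_ofLp (Fin 3)).quasiMeasurePreserving.preimage_ae_eq h
  have e₁ : (WithLp.ofLp (p := 2) (V := Fin 3 → ℝ)) ⁻¹'
      (Set.pi univ fun i => Ioo ((0 : Fin 3 → ℝ) i) (b i)) = openBox := by
    ext y
    simp [openBox, b, Fin.forall_fin_succ]
  have e₂ : (WithLp.ofLp (p := 2) (V := Fin 3 → ℝ)) ⁻¹' (Icc 0 b) = closedBox := by
    ext y
    simp [closedBox, b, Fin.forall_fin_succ, Pi.le_def]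
    tauto
  rw [e₁, e₂] at h'
  exact (ae_le_set.1 h'.symm.le)

theorem measurableSet_openBox : MeasurableSet openBox := by
  have h : ∀ i : Fin 3, Measurable fun y : E3 => y i := fun i =>
    (EuclideanSpace.proj i : E3 →L[ℝ] ℝ).continuous.measurable
  exact ((h 0) measurableSet_Ioo).inter (((h 1) measurableSet_Ioo).inter ((h 2) measurableSet_Ioo))

theorem integrableOn_prod_of_continuousOn_box {g : ℝ → ℝ → ℝ → ℝ}
    (hg : ContinuousOn (fun p : ℝ × ℝ × ℝ => g p.1 p.2.1 p.2.2)
      (Icc 0 (2 * π) ×ˢ Icc 0 (2 * π) ×ˢ Icc 0 1)) :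
    IntegrableOn (fun p : ℝ × ℝ × ℝ => g p.1 p.2.1 p.2.2)
      (Ioo 0 (2 * π) ×ˢ Ioo 0 (2 * π) ×ˢ Ioo 0 1) :=
  (hg.integrableOn_compact (isCompact_Icc.prod (isCompact_Icc.prod isCompact_Icc))).mono_set
    (prod_mono Ioo_subset_Icc_self (prod_mono Ioo_subset_Icc_self Ioo_subset_Icc_self))

theorem setIntegral_openBox_eq_prod {g : ℝ → ℝ → ℝ → ℝ}
    (hg : ContinuousOn (fun p : ℝ × ℝ × ℝ => g p.1 p.2.1 p.2.2)
      (Icc 0 (2 * π) ×ˢ Icc 0 (2 * π) ×ˢ Icc 0 1)) :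
    IntegrableOn (fun y : E3 => g (y 0) (y 1) (y 2)) openBox ∧
    ∫ y in openBox, g (y 0) (y 1) (y 2)
      = ∫ p in Ioo 0 (2 * π) ×ˢ Ioo 0 (2 * π) ×ˢ Ioo 0 1, g p.1 p.2.1 p.2.2 := by
  let e : E3 ≃ᵐ ℝ × ℝ × ℝ :=
    (MeasurableEquiv.toLp 2 (Fin 3 → ℝ)).symm.trans
      ((MeasurableEquiv.piFinSuccAbove (fun _ : Fin 3 => ℝ) 0).trans
        ((MeasurableEquiv.refl ℝ).prodCongr MeasurableEquiv.finTwoArrow))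
  have he : MeasurePreserving e := by
    refine (EuclideanSpace.volume_preserving_symm_measurableEquiv_toLp (Fin 3)).trans
      ((volume_preserving_piFinSuccAbove (fun _ : Fin 3 => ℝ) 0).trans ?_)
    exact (MeasurePreserving.id volume).prod (volume_preserving_finTwoArrow ℝ)
  have hpre : e ⁻¹' (Ioo 0 (2 * π) ×ˢ Ioo 0 (2 * π) ×ˢ Ioo 0 1) = openBox := by
    ext y
    rfl
  rw [← hpre]
  exact ⟨(he.integrableOn_comp_preimage e.measurableEmbedding).2
      (integrableOn_prod_of_continuousOn_box hg),
    he.setIntegral_preimage_emb e.measurableEmbedding (fun p => g p.1 p.2.1 p.2.2) _⟩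

theorem integrableOn_slice_of_continuousOn_box {g : ℝ → ℝ → ℝ → ℝ}
    (hg : ContinuousOn (fun p : ℝ × ℝ × ℝ => g p.1 p.2.1 p.2.2)
      (Icc 0 (2 * π) ×ˢ Icc 0 (2 * π) ×ˢ Icc 0 1)) {u : ℝ} (hu : u ∈ Ioo 0 (2 * π)) :
    IntegrableOn (fun p : ℝ × ℝ => g u p.1 p.2) (Ioo 0 (2 * π) ×ˢ Ioo 0 1) := by
  have : ContinuousOn (fun p : ℝ × ℝ => g u p.1 p.2) (Icc 0 (2 * π) ×ˢ Icc 0 1) :=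
    hg.comp (f := fun p : ℝ × ℝ => (u, p)) (by fun_prop)
      fun p hp => ⟨Ioo_subset_Icc_self hu, hp⟩
  exact (this.integrableOn_compact (isCompact_Icc.prod isCompact_Icc)).mono_set
    (prod_mono Ioo_subset_Icc_self Ioo_subset_Icc_self)

theorem setIntegral_openBox {g : ℝ → ℝ → ℝ → ℝ}
    (hg : ContinuousOn (fun p : ℝ × ℝ × ℝ => g p.1 p.2.1 p.2.2)
      (Icc 0 (2 * π) ×ˢ Icc 0 (2 * π) ×ˢ Icc 0 1)) :
    ∫ y in openBox, g (y 0) (y 1) (y 2) = ∫ u in (0 : ℝ)..(2 * π), ∫ v in (0 : ℝ)..(2 * π),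
      ∫ r in (0 : ℝ)..1, g u v r := by
  rw [(setIntegral_openBox_eq_prod hg).2, Measure.volume_eq_prod,
    setIntegral_prod _ (integrableOn_prod_of_continuousOn_box hg),
    intervalIntegral.integral_of_le Real.two_pi_pos.le, integral_Ioc_eq_integral_Ioo]
  refine setIntegral_congr_fun measurableSet_Ioo fun u hu => ?_
  rw [Measure.volume_eq_prod, setIntegral_prod _ (integrableOn_slice_of_continuousOn_box hg hu),
    intervalIntegral.integral_of_le Real.two_pi_pos.le, integral_Ioc_eq_integral_Ioo]
  refine setIntegral_congr_fun measurableSet_Ioo fun v _ => ?_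
  rw [intervalIntegral.integral_of_le zero_le_one, integral_Ioc_eq_integral_Ioo]

/-- Fubini with the u-integral innermost, so that u-derivatives of periodic functions drop out; the
next lemma does the same for v. -/
theorem setIntegral_openBox_eq_zero_of_fst {g : ℝ → ℝ → ℝ → ℝ}
    (hg : ContinuousOn (fun p : ℝ × ℝ × ℝ => g p.1 p.2.1 p.2.2)
      (Icc 0 (2 * π) ×ˢ Icc 0 (2 * π) ×ˢ Icc 0 1))
    (h : ∀ v, ∀ r ∈ Icc (0 : ℝ) 1, ∫ u in (0 : ℝ)..(2 * π), g u v r = 0) :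
    ∫ y in openBox, g (y 0) (y 1) (y 2) = 0 := by
  have hint := integrableOn_prod_of_continuousOn_box hg
  rw [IntegrableOn, Measure.volume_eq_prod, ← Measure.prod_restrict] at hint
  rw [(setIntegral_openBox_eq_prod hg).2, Measure.volume_eq_prod, ← Measure.prod_restrict,
    integral_prod_symm _ hint]
  refine setIntegral_eq_zero_of_forall_eq_zero fun q hq => ?_
  have := h q.1 q.2 (Ioo_subset_Icc_self hq.2)
  rwa [intervalIntegral.integral_of_le Real.two_pi_pos.le, integral_Ioc_eq_integral_Ioo] at this

theorem setIntegral_openBox_eq_zero_of_snd {g : ℝ → ℝ → ℝ → ℝ}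
    (hg : ContinuousOn (fun p : ℝ × ℝ × ℝ => g p.1 p.2.1 p.2.2)
      (Icc 0 (2 * π) ×ˢ Icc 0 (2 * π) ×ˢ Icc 0 1))
    (h : ∀ u, ∀ r ∈ Icc (0 : ℝ) 1, ∫ v in (0 : ℝ)..(2 * π), g u v r = 0) :
    ∫ y in openBox, g (y 0) (y 1) (y 2) = 0 := by
  rw [(setIntegral_openBox_eq_prod hg).2, Measure.volume_eq_prod,
    setIntegral_prod _ (integrableOn_prod_of_continuousOn_box hg)]
  refine setIntegral_eq_zero_of_forall_eq_zero fun u hu => ?_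
  have hint := integrableOn_slice_of_continuousOn_box hg hu
  rw [IntegrableOn, Measure.volume_eq_prod, ← Measure.prod_restrict] at hint
  rw [Measure.volume_eq_prod, ← Measure.prod_restrict, integral_prod_symm _ hint]
  refine setIntegral_eq_zero_of_forall_eq_zero fun r hr => ?_
  have := h u r (Ioo_subset_Icc_self hr)
  rwa [intervalIntegral.integral_of_le Real.two_pi_pos.le, integral_Ioc_eq_integral_Ioo] at this

theorem continuous_denom : Continuous fun p : ℝ × ℝ × ℝ × ℝ => denom p.1 p.2.1 p.2.2.1 p.2.2.2 := by
  unfold denom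
  fun_prop

/-- The parametrization is injective only on the open box. The faces of the box are null, and so is
their image under a differentiable map, so the change of variables can be made on the open box. -/
theorem vol_eq_integral {t : ℝ} (ht : |t| < √2 - 1) :
    vol t = ∫ u in (0 : ℝ)..(2 * π), ∫ v in (0 : ℝ)..(2 * π), ∫ r in (0 : ℝ)..1,
      r * (√2 + r * Real.sin v) / denom t u v r ^ 3 := by
  set Φ : E3 → E3 := fun z => sct !₂[t, 0, 0] (torusMap z) with hΦ
  have hsub : openBox ⊆ closedBox := fun y hy =>
    ⟨Ioo_subset_Icc_self hy.1, Ioo_subset_Icc_self hy.2.1, Ioo_subset_Icc_self hy.2.2⟩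
  have himg : sct !₂[t, 0, 0] '' solidTorus = Φ '' closedBox := by
    rw [solidTorus_eq_image, image_image]
  have hnull : volume (Φ '' (closedBox \ openBox)) = 0 := by
    refine addHaar_image_eq_zero_of_differentiableOn_of_addHaar_eq_zero volume (fun y hy => ?_)
      volume_closedBox_diff_openBox
    obtain ⟨T, hT, -⟩ := exists_hasFDerivAt_sct_torusMap ht hy.1.2.2
    exact hT.differentiableAt.differentiableWithinAt
  have hvol : volume (Φ '' closedBox) = volume (Φ '' openBox) := by
    refine le_antisymm ?_ (measure_mono (image_mono hsub))
    calc volume (Φ '' closedBox) = volume (Φ '' openBox ∪ Φ '' (closedBox \ openBox)) := by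
          rw [← image_union, union_sdiff_cancel hsub]
      _ ≤ volume (Φ '' openBox) + volume (Φ '' (closedBox \ openBox)) := measure_union_le _ _
      _ = volume (Φ '' openBox) := by rw [hnull, add_zero]
  have hsct : Function.Injective (sct !₂[t, 0, 0]) := fun x y h => by
    have := EuclideanGeometry.inversion_injective (0 : E3) one_ne_zero h
    exact EuclideanGeometry.inversion_injective (0 : E3) one_ne_zero (add_right_cancel this)
  have hinj : InjOn Φ openBox := fun y hy z hz h => injOn_torusMap hy hz (hsct h)
  have hd : ∀ y ∈ openBox, HasFDerivWithinAt Φ (fderiv ℝ Φ y) openBox y := fun y hy => by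
    obtain ⟨T, hT, -⟩ := exists_hasFDerivAt_sct_torusMap ht (Ioo_subset_Icc_self hy.2.2)
    exact hT.differentiableAt.hasFDerivAt.hasFDerivWithinAt
  have hcont : ContinuousOn (fun p : ℝ × ℝ × ℝ =>
      p.2.2 * (√2 + p.2.2 * Real.sin p.2.1) / denom t p.1 p.2.1 p.2.2 ^ 3)
      (Icc 0 (2 * π) ×ˢ Icc 0 (2 * π) ×ˢ Icc 0 1) := by
    have hc : Continuous fun p : ℝ × ℝ × ℝ => denom t p.1 p.2.1 p.2.2 :=
      continuous_denom.comp (by fun_prop : Continuous fun p : ℝ × ℝ × ℝ => (t, p))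
    refine ContinuousOn.div (by fun_prop) (hc.pow 3).continuousOn fun p hp => ?_
    exact (pow_pos (denom_pos ht _ _ hp.2.2) 3).ne'
  have heq := setIntegral_openBox
    (g := fun u v r => r * (√2 + r * Real.sin v) / denom t u v r ^ 3) hcont
  have hint := (setIntegral_openBox_eq_prod
    (g := fun u v r => r * (√2 + r * Real.sin v) / denom t u v r ^ 3) hcont).1
  rw [vol, himg, hvol, ← lintegral_abs_det_fderiv_eq_addHaar_image volume measurableSet_openBox hd
    hinj, ← heq]
  have hnn : ∀ y ∈ openBox, 0 ≤ y 2 * (√2 + y 2 * Real.sin (y 1))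
      / denom t (y 0) (y 1) (y 2) ^ 3 := fun y hy => by
    have h2 := Ioo_subset_Icc_self hy.2.2
    have := denom_pos ht (y 0) (y 1) h2
    have := radius_pos (y 1) h2
    have := h2.1
    positivity
  rw [integral_eq_lintegral_of_nonneg_ae
    (by filter_upwards [ae_restrict_mem measurableSet_openBox] with y hy using hnn y hy)
    hint.aestronglyMeasurable]
  congr 1
  refine setLIntegral_congr_fun measurableSet_openBox fun y hy => ?_
  obtain ⟨T, hT, hdet⟩ := exists_hasFDerivAt_sct_torusMap ht (Ioo_subset_Icc_self hy.2.2)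
  beta_reduce
  rw [hT.fderiv, hdet]

end VolumeFormula

/-! ### Exact integrands over the period square, and differentiation under the integral. -/

section Certificates

open MeasureTheory Set

/-- The integral of a function of two angles over a full period. -/
noncomputable def torusIntegral (f : ℝ → ℝ → ℝ) : ℝ :=
  ∫ p in Ioc 0 (2 * π) ×ˢ Ioc 0 (2 * π), f p.1 p.2

theorem integrableOn_period {f : ℝ → ℝ → ℝ} (hf : Continuous fun p : ℝ × ℝ => f p.1 p.2) :
    IntegrableOn (fun p : ℝ × ℝ => f p.1 p.2) (Ioc 0 (2 * π) ×ˢ Ioc 0 (2 * π)) :=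
  (hf.continuousOn.integrableOn_compact (isCompact_Icc.prod isCompact_Icc)).mono_set
    (prod_mono Ioc_subset_Icc_self Ioc_subset_Icc_self)

theorem torusIntegral_eq {f : ℝ → ℝ → ℝ} (hf : Continuous fun p : ℝ × ℝ => f p.1 p.2) :
    torusIntegral f = ∫ u in (0 : ℝ)..(2 * π), ∫ v in (0 : ℝ)..(2 * π), f u v := by
  rw [torusIntegral, Measure.volume_eq_prod, setIntegral_prod _ (integrableOn_period hf),
    intervalIntegral.integral_of_le Real.two_pi_pos.le]
  simp_rw [intervalIntegral.integral_of_le Real.two_pi_pos.le]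

theorem torusIntegral_eq_symm {f : ℝ → ℝ → ℝ} (hf : Continuous fun p : ℝ × ℝ => f p.1 p.2) :
    torusIntegral f = ∫ v in (0 : ℝ)..(2 * π), ∫ u in (0 : ℝ)..(2 * π), f u v := by
  have h := integrableOn_period hf
  rw [IntegrableOn, Measure.volume_eq_prod, ← Measure.prod_restrict] at h
  rw [torusIntegral, Measure.volume_eq_prod, ← Measure.prod_restrict, integral_prod_symm _ h,
    intervalIntegral.integral_of_le Real.two_pi_pos.le]
  simp_rw [intervalIntegral.integral_of_le Real.two_pi_pos.le]

theorem torusIntegral_add {f g : ℝ → ℝ → ℝ} (hf : Continuous fun p : ℝ × ℝ => f p.1 p.2)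
    (hg : Continuous fun p : ℝ × ℝ => g p.1 p.2) :
    torusIntegral (fun u v => f u v + g u v) = torusIntegral f + torusIntegral g :=
  integral_add (integrableOn_period hf) (integrableOn_period hg)

theorem torusIntegral_const_mul (c : ℝ) (f : ℝ → ℝ → ℝ) :
    torusIntegral (fun u v => c * f u v) = c * torusIntegral f :=
  integral_const_mul c _

theorem hasDerivAt_div_pow {𝕜 : Type*} [NontriviallyNormedField 𝕜] {n d : 𝕜 → 𝕜} {n' d' x : 𝕜}
    (hn : HasDerivAt n n' x)
    (hd : HasDerivAt d d' x) (h : d x ≠ 0) (k : ℕ) :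
    HasDerivAt (fun y => n y / d y ^ (k + 1))
      ((n' * d x - (k + 1) * n x * d') / d x ^ (k + 2)) x := by
  refine (hn.div (hd.pow (k + 1)) (pow_ne_zero _ h)).congr_deriv ?_
  simp only [Nat.add_sub_cancel, Pi.pow_apply]
  push_cast
  field_simp
  ring

/-- The derivative of `sin u (b₀ + b₁ cos u + b₂ cos² u) / (d₀ + d₁ cos u) ^ (k + 1)`. -/
noncomputable def derivSin (k : ℕ) (b₀ b₁ b₂ d₀ d₁ u : ℝ) : ℝ :=
  ((Real.cos u * (b₀ + b₁ * Real.cos u + b₂ * Real.cos u ^ 2)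
      - Real.sin u ^ 2 * (b₁ + 2 * b₂ * Real.cos u)) * (d₀ + d₁ * Real.cos u)
    + (k + 1) * d₁ * Real.sin u ^ 2 * (b₀ + b₁ * Real.cos u + b₂ * Real.cos u ^ 2))
    / (d₀ + d₁ * Real.cos u) ^ (k + 2)

/-- The derivative of `κ (a₀ + a₁ σ + a₂ σ²) / (e₀ + e₁ σ) ^ (k + 1)`, where `σ = √2 sin v` and
`κ = √2 cos v`. -/
noncomputable def derivCos (k : ℕ) (a₀ a₁ a₂ e₀ e₁ v : ℝ) : ℝ :=
  ((-(√2 * Real.sin v) * (a₀ + a₁ * (√2 * Real.sin v) + a₂ * (√2 * Real.sin v) ^ 2)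
      + (√2 * Real.cos v) ^ 2 * (a₁ + 2 * a₂ * (√2 * Real.sin v))) * (e₀ + e₁ * (√2 * Real.sin v))
    - (k + 1) * e₁ * (√2 * Real.cos v) ^ 2
      * (a₀ + a₁ * (√2 * Real.sin v) + a₂ * (√2 * Real.sin v) ^ 2))
    / (e₀ + e₁ * (√2 * Real.sin v)) ^ (k + 2)

theorem continuous_derivSin {X : Type*} [TopologicalSpace X] (k : ℕ) {b₀ b₁ b₂ d₀ d₁ u : X → ℝ}
    (hb₀ : Continuous b₀) (hb₁ : Continuous b₁) (hb₂ : Continuous b₂) (hd₀ : Continuous d₀)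
    (hd₁ : Continuous d₁) (hu : Continuous u) (h : ∀ x, d₀ x + d₁ x * Real.cos (u x) ≠ 0) :
    Continuous fun x => derivSin k (b₀ x) (b₁ x) (b₂ x) (d₀ x) (d₁ x) (u x) := by
  unfold derivSin
  exact Continuous.div (by fun_prop) (by fun_prop) fun x => pow_ne_zero _ (h x)

theorem continuous_derivCos {X : Type*} [TopologicalSpace X] (k : ℕ) {a₀ a₁ a₂ e₀ e₁ v : X → ℝ}
    (ha₀ : Continuous a₀) (ha₁ : Continuous a₁) (ha₂ : Continuous a₂) (he₀ : Continuous e₀)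
    (he₁ : Continuous e₁) (hv : Continuous v)
    (h : ∀ x, e₀ x + e₁ x * (√2 * Real.sin (v x)) ≠ 0) :
    Continuous fun x => derivCos k (a₀ x) (a₁ x) (a₂ x) (e₀ x) (e₁ x) (v x) := by
  unfold derivCos
  exact Continuous.div (by fun_prop) (by fun_prop) fun x => pow_ne_zero _ (h x)

/-- The primitive is periodic, so its end values cancel; the same holds for `derivCos`. -/
theorem integral_derivSin (k : ℕ) (b₀ b₁ b₂ : ℝ) {d₀ d₁ : ℝ}
    (h : ∀ u, d₀ + d₁ * Real.cos u ≠ 0) :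
    ∫ u in (0 : ℝ)..(2 * π), derivSin k b₀ b₁ b₂ d₀ d₁ u = 0 := by
  have hd : ∀ u, HasDerivAt (fun u => Real.sin u * (b₀ + b₁ * Real.cos u + b₂ * Real.cos u ^ 2)
      / (d₀ + d₁ * Real.cos u) ^ (k + 1)) (derivSin k b₀ b₁ b₂ d₀ d₁ u) u := by
    intro u
    have hs := Real.hasDerivAt_sin u
    have hc := Real.hasDerivAt_cos u
    refine (hasDerivAt_div_pow (hs.mul (((hc.const_mul b₁).const_add b₀).add
      ((hc.pow 2).const_mul b₂))) ((hc.const_mul d₁).const_add d₀) (h u) k).congr_deriv ?_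
    simp only [derivSin, Pi.add_apply, Pi.mul_apply, Pi.pow_apply]
    congr 1
    push_cast
    ring
  rw [intervalIntegral.integral_eq_sub_of_hasDerivAt (fun u _ => hd u)]
  · simp
  · exact (continuous_derivSin k continuous_const continuous_const continuous_const continuous_const
      continuous_const continuous_id h).intervalIntegrable _ _

theorem integral_derivCos (k : ℕ) (a₀ a₁ a₂ : ℝ) {e₀ e₁ : ℝ}
    (h : ∀ v, e₀ + e₁ * (√2 * Real.sin v) ≠ 0) :
    ∫ v in (0 : ℝ)..(2 * π), derivCos k a₀ a₁ a₂ e₀ e₁ v = 0 := by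
  have hd : ∀ v, HasDerivAt (fun v => (√2 * Real.cos v) * (a₀ + a₁ * (√2 * Real.sin v)
      + a₂ * (√2 * Real.sin v) ^ 2) / (e₀ + e₁ * (√2 * Real.sin v)) ^ (k + 1))
      (derivCos k a₀ a₁ a₂ e₀ e₁ v) v := by
    intro v
    have hs := (Real.hasDerivAt_sin v).const_mul √2
    have hc := (Real.hasDerivAt_cos v).const_mul √2
    refine (hasDerivAt_div_pow (hc.mul (((hs.const_mul a₁).const_add a₀).add
      ((hs.pow 2).const_mul a₂))) ((hs.const_mul e₁).const_add e₀) (h v) k).congr_deriv ?_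
    simp only [derivCos, Pi.add_apply, Pi.mul_apply, Pi.pow_apply]
    congr 1
    push_cast
    ring
  rw [intervalIntegral.integral_eq_sub_of_hasDerivAt (fun v _ => hd v)]
  · simp
  · exact (continuous_derivCos k continuous_const continuous_const continuous_const continuous_const
      continuous_const continuous_id h).intervalIntegrable _ _

theorem torusIntegral_derivSin_add_derivCos (k : ℕ) {b₀ b₁ b₂ d₀ d₁ a₀ a₁ a₂ e₀ e₁ : ℝ → ℝ}
    (hb₀ : Continuous b₀) (hb₁ : Continuous b₁) (hb₂ : Continuous b₂) (hd₀ : Continuous d₀)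
    (hd₁ : Continuous d₁) (ha₀ : Continuous a₀) (ha₁ : Continuous a₁) (ha₂ : Continuous a₂)
    (he₀ : Continuous e₀) (he₁ : Continuous e₁)
    (hd : ∀ u v, d₀ v + d₁ v * Real.cos u ≠ 0)
    (he : ∀ u v, e₀ u + e₁ u * (√2 * Real.sin v) ≠ 0) :
    torusIntegral (fun u v => derivSin k (b₀ v) (b₁ v) (b₂ v) (d₀ v) (d₁ v) u
      + derivCos k (a₀ u) (a₁ u) (a₂ u) (e₀ u) (e₁ u) v) = 0 := by
  have h₁ : Continuous fun p : ℝ × ℝ =>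
      derivSin k (b₀ p.2) (b₁ p.2) (b₂ p.2) (d₀ p.2) (d₁ p.2) p.1 :=
    continuous_derivSin k (by fun_prop) (by fun_prop) (by fun_prop) (by fun_prop) (by fun_prop)
      (by fun_prop) fun p => hd _ _
  have h₂ : Continuous fun p : ℝ × ℝ =>
      derivCos k (a₀ p.1) (a₁ p.1) (a₂ p.1) (e₀ p.1) (e₁ p.1) p.2 :=
    continuous_derivCos k (by fun_prop) (by fun_prop) (by fun_prop) (by fun_prop) (by fun_prop)
      (by fun_prop) fun p => he _ _
  rw [torusIntegral_add (f := fun u v => derivSin k (b₀ v) (b₁ v) (b₂ v) (d₀ v) (d₁ v) u)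
    (g := fun u v => derivCos k (a₀ u) (a₁ u) (a₂ u) (e₀ u) (e₁ u) v) h₁ h₂]
  rw [torusIntegral_eq_symm h₁, torusIntegral_eq h₂]
  have e₁' : ∀ v, ∫ u in (0 : ℝ)..(2 * π), derivSin k (b₀ v) (b₁ v) (b₂ v) (d₀ v) (d₁ v) u = 0 :=
    fun v => integral_derivSin k _ _ _ fun u => hd u v
  have e₂' : ∀ u, ∫ v in (0 : ℝ)..(2 * π), derivCos k (a₀ u) (a₁ u) (a₂ u) (e₀ u) (e₁ u) v = 0 :=
    fun u => integral_derivCos k _ _ _ fun v => he u v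
  simp_rw [e₁', e₂']
  simp

/-- Domination comes from a bound for `F'` on a compact neighbourhood. Over 𝕜 = ℝ this serves the
differential relations, over 𝕜 = ℂ the holomorphic extension. -/
theorem hasDerivAt_setIntegral_period {𝕜 : Type*} [RCLike 𝕜] {F F' : 𝕜 → ℝ → ℝ → 𝕜} {δ : ℝ} {t₀ : 𝕜}
    (ht₀ : ‖t₀‖ < δ)
    (hF : ContinuousOn (fun p : 𝕜 × ℝ × ℝ => F p.1 p.2.1 p.2.2) ({t | ‖t‖ < δ} ×ˢ univ))
    (hF' : ContinuousOn (fun p : 𝕜 × ℝ × ℝ => F' p.1 p.2.1 p.2.2) ({t | ‖t‖ < δ} ×ˢ univ))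
    (h : ∀ t, ‖t‖ < δ → ∀ u v, HasDerivAt (fun s => F s u v) (F' t u v) t) :
    HasDerivAt (fun t => ∫ p in Ioc 0 (2 * π) ×ˢ Ioc 0 (2 * π), F t p.1 p.2)
      (∫ p in Ioc 0 (2 * π) ×ˢ Ioc 0 (2 * π), F' t₀ p.1 p.2) t₀ := by
  have hopen : IsOpen {t : 𝕜 | ‖t‖ < δ} := isOpen_lt continuous_norm continuous_const
  obtain ⟨ε, hε, hball⟩ := Metric.nhds_basis_closedBall.mem_iff.1 (hopen.mem_nhds ht₀)
  have hslice : ∀ {G : 𝕜 → ℝ → ℝ → 𝕜} {t : 𝕜},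
      ContinuousOn (fun p : 𝕜 × ℝ × ℝ => G p.1 p.2.1 p.2.2) ({t | ‖t‖ < δ} ×ˢ univ) → ‖t‖ < δ →
      Continuous fun p : ℝ × ℝ => G t p.1 p.2 := by
    intro G t hG ht
    rw [← continuousOn_univ]
    exact hG.comp (f := fun p : ℝ × ℝ => (t, p)) (by fun_prop) fun p _ => ⟨ht, mem_univ _⟩
  obtain ⟨M, hM⟩ := ((isCompact_closedBall t₀ ε).prod
    ((isCompact_Icc (a := (0 : ℝ)) (b := 2 * π)).prod
      (isCompact_Icc (a := (0 : ℝ)) (b := 2 * π)))).exists_bound_of_continuousOn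
    (hF'.mono (prod_mono hball (subset_univ _)))
  have hmem : Metric.closedBall t₀ ε ∈ nhds t₀ := Metric.closedBall_mem_nhds t₀ hε
  have hmeas : MeasurableSet (Ioc 0 (2 * π) ×ˢ Ioc 0 (2 * π)) :=
    measurableSet_Ioc.prod measurableSet_Ioc
  refine (hasDerivAt_integral_of_dominated_loc_of_deriv_le (𝕜 := 𝕜)
    (F := fun t (p : ℝ × ℝ) => F t p.1 p.2) (F' := fun t (p : ℝ × ℝ) => F' t p.1 p.2)
    (bound := fun _ => M) hmem ?_ ?_ ?_ ?_ ?_ ?_).2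
  · filter_upwards [hmem] with t ht
    exact (hslice hF (hball ht)).aestronglyMeasurable
  · exact ((hslice hF ht₀).continuousOn.integrableOn_compact
      (isCompact_Icc.prod isCompact_Icc)).mono_set
      (prod_mono Ioc_subset_Icc_self Ioc_subset_Icc_self)
  · exact (hslice hF' ht₀).aestronglyMeasurable
  · filter_upwards [ae_restrict_mem hmeas] with p hp t ht
    exact hM (t, p) ⟨ht, Ioc_subset_Icc_self hp.1, Ioc_subset_Icc_self hp.2⟩
  · refine integrableOn_const ?_
    rw [Measure.volume_eq_prod, Measure.prod_prod]
    exact ENNReal.mul_ne_top measure_Ioc_lt_top.ne measure_Ioc_lt_top.ne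
  · exact Filter.Eventually.of_forall fun p t ht => h t (hball ht) p.1 p.2

theorem hasDerivAt_torusIntegral {F F' : ℝ → ℝ → ℝ → ℝ} {δ t₀ : ℝ} (ht₀ : |t₀| < δ)
    (hF : ContinuousOn (fun p : ℝ × ℝ × ℝ => F p.1 p.2.1 p.2.2) ({t | |t| < δ} ×ˢ univ))
    (hF' : ContinuousOn (fun p : ℝ × ℝ × ℝ => F' p.1 p.2.1 p.2.2) ({t | |t| < δ} ×ˢ univ))
    (h : ∀ t, |t| < δ → ∀ u v, HasDerivAt (fun s => F s u v) (F' t u v) t) :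
    HasDerivAt (fun t => torusIntegral (F t)) (torusIntegral (F' t₀)) t₀ :=
  hasDerivAt_setIntegral_period ht₀ hF hF' h

end Certificates

/-! ### Telescoping certificates for the integrands. -/

section Relations

open MeasureTheory Set

/-- The denominator of the conformal factor on the Clifford torus, where `τ = √2 t`. -/
noncomputable def surfaceDenom (τ u v : ℝ) : ℝ :=
  1 + τ * (2 + √2 * Real.sin v) * Real.cos u + τ ^ 2 * (3 + 2 * (√2 * Real.sin v)) / 2

/-- `τ` times the derivative of `surfaceDenom` with respect to `τ`. -/
noncomputable def surfaceDenomEuler (τ u v : ℝ) : ℝ :=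
  τ * (2 + √2 * Real.sin v) * Real.cos u + τ ^ 2 * (3 + 2 * (√2 * Real.sin v))

/-- The numerator of the flux density whose integral is three times the volume. -/
noncomputable def fluxNum (τ u v : ℝ) : ℝ :=
  (2 + √2 * Real.sin v) * ((1 + √2 * Real.sin v) * (1 + τ * (2 + √2 * Real.sin v) * Real.cos u)
    - τ / 2 * (3 + 2 * (√2 * Real.sin v)) * (√2 * Real.sin v) * Real.cos u)

/-- `τ` times the derivative of `fluxNum` with respect to `τ`. -/
noncomputable def fluxNumEuler (τ u v : ℝ) : ℝ :=
  (2 + √2 * Real.sin v) * ((1 + √2 * Real.sin v) * (τ * (2 + √2 * Real.sin v) * Real.cos u)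
    - τ / 2 * (3 + 2 * (√2 * Real.sin v)) * (√2 * Real.sin v) * Real.cos u)

theorem sqrt_two_mul_cos_sq (v : ℝ) : (√2 * Real.cos v) ^ 2 = 2 - (√2 * Real.sin v) ^ 2 := by
  rw [mul_pow, mul_pow, Real.cos_sq', Real.sq_sqrt zero_le_two]
  ring

theorem combination_div_pow {D : ℝ} (h : D ≠ 0) (a b c x y w : ℝ) (k : ℕ) :
    a * (x / D ^ k) + b * (y / D ^ (k + 1)) + c * (w / D ^ (k + 2))
      = (a * x * D ^ 2 + b * y * D + c * w) / D ^ (k + 2) := by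
  field_simp
  ring

theorem combination_div_pow' {D : ℝ} (h : D ≠ 0) (a b c x y w : ℝ) (k : ℕ) :
    a * (x / D ^ k) + b * (y / D ^ (k + 1)) + c * (w / D ^ (k + 1))
      = (a * x * D + b * y + c * w) / D ^ (k + 1) := by
  field_simp
  ring

/-- A creative-telescoping identity: the right side integrates to zero. Over the common denominator
`surfaceDenom ^ 3`, with sin² u = 1 - C² and (√2 cos v)² = 2 - σ², it is a polynomial identity in τ,
σ and C. -/
theorem area_certificate {τ u v : ℝ} (h : surfaceDenom τ u v ≠ 0) :
    (3 - 5 * τ ^ 2 - 5 / 4 * τ ^ 4) * ((2 + √2 * Real.sin v) / surfaceDenom τ u v ^ 2)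
      + (2 - τ ^ 4 / 2) * (-2 * (2 + √2 * Real.sin v) * surfaceDenomEuler τ u v
        / surfaceDenom τ u v ^ 3)
      + -2 * (1 + τ ^ 2 / 2) ^ 3 * (fluxNum τ u v / surfaceDenom τ u v ^ 3) =
    derivSin 1
      (-7 * τ - 6 * τ ^ 3 - τ ^ 5 / 2
        + (-3 * τ - 33 / 8 * τ ^ 3 - 7 / 16 * τ ^ 5) * (√2 * Real.sin v))
      (-4 * τ ^ 2 - τ ^ 4 / 4 + (-2 * τ ^ 2 - τ ^ 4 / 4) * (√2 * Real.sin v)) 0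
      (1 + τ ^ 2 * (3 + 2 * (√2 * Real.sin v)) / 2) (τ * (2 + √2 * Real.sin v)) u
    + derivCos 1
      (3 + τ ^ 2 - 3 / 2 * τ ^ 4 + (3 * τ - τ ^ 3 / 8 + τ ^ 5 / 16) * Real.cos u)
      (1 + τ ^ 2 - 7 / 8 * τ ^ 4 + 3 / 2 * τ * Real.cos u) 0
      (1 + 2 * τ * Real.cos u + 3 / 2 * τ ^ 2) (τ * Real.cos u + τ ^ 2) v := by
  have hd : 1 + τ ^ 2 * (3 + 2 * (√2 * Real.sin v)) / 2 + τ * (2 + √2 * Real.sin v) * Real.cos u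
      = surfaceDenom τ u v := by unfold surfaceDenom; ring
  have he : 1 + 2 * τ * Real.cos u + 3 / 2 * τ ^ 2 + (τ * Real.cos u + τ ^ 2) * (√2 * Real.sin v)
      = surfaceDenom τ u v := by unfold surfaceDenom; ring
  rw [derivSin, derivCos, hd, he, Real.sin_sq, sqrt_two_mul_cos_sq, ← add_div,
    combination_div_pow' h]
  congr 1
  unfold surfaceDenom surfaceDenomEuler fluxNum
  generalize √2 * Real.sin v = σ
  generalize Real.cos u = C
  push_cast
  ring

/-- The same mechanism one pole order higher, since differentiating the flux density produces
`surfaceDenom ^ 4`. -/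
theorem vol_certificate {τ u v : ℝ} (h : surfaceDenom τ u v ≠ 0) :
    (-3 + 9 * τ ^ 2 - 3 / 4 * τ ^ 4) * ((2 + √2 * Real.sin v) / surfaceDenom τ u v ^ 2)
      + (2 + 15 * τ ^ 2 - 13 / 2 * τ ^ 4 + 5 / 4 * τ ^ 6)
        * (fluxNum τ u v / surfaceDenom τ u v ^ 3)
      + (-4 / 3 + 14 / 3 * τ ^ 2 - 7 / 3 * τ ^ 4 + τ ^ 6 / 6)
        * ((fluxNumEuler τ u v * surfaceDenom τ u v - 3 * fluxNum τ u v * surfaceDenomEuler τ u v)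
          / surfaceDenom τ u v ^ 4) =
    derivSin 2
      (47 / 3 * τ + 97 / 6 * τ ^ 3 + 305 / 3 * τ ^ 5 - τ ^ 7 / 3
        + (52 / 3 * τ + 337 / 12 * τ ^ 3 + 883 / 12 * τ ^ 5 - 11 / 48 * τ ^ 7) * (√2 * Real.sin v))
      (44 * τ ^ 2 + 565 / 4 * τ ^ 4 + 11 / 8 * τ ^ 6
        + (131 / 3 * τ ^ 2 + 331 / 3 * τ ^ 4 + 13 / 12 * τ ^ 6) * (√2 * Real.sin v))
      (52 * τ ^ 3 + τ ^ 5 / 2 + (42 * τ ^ 3 + 5 / 12 * τ ^ 5) * (√2 * Real.sin v))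
      (1 + τ ^ 2 * (3 + 2 * (√2 * Real.sin v)) / 2) (τ * (2 + √2 * Real.sin v)) u
    + derivCos 2
      (-3 + 19 / 6 * τ ^ 2 + 1043 / 12 * τ ^ 4 - 5 / 24 * τ ^ 6
        + (-28 / 3 * τ + 841 / 12 * τ ^ 3 + 153 / 4 * τ ^ 5 - 21 / 16 * τ ^ 7) * Real.cos u
        + (20 / 3 * τ ^ 2 - 47 / 6 * τ ^ 4 - τ ^ 6 / 12) * Real.cos u ^ 2)
      (-1 - 5 / 2 * τ ^ 2 + 495 / 8 * τ ^ 4 + τ ^ 6 / 16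
        + (-27 / 2 * τ + 145 / 4 * τ ^ 3 + 141 / 4 * τ ^ 5 - 13 / 8 * τ ^ 7) * Real.cos u
        + -7 * τ ^ 2 * Real.cos u ^ 2)
      (-11 / 3 * τ ^ 2 + 10 * τ ^ 4 + τ ^ 6 / 8
        + (-7 / 3 * τ + 17 / 6 * τ ^ 3 + 155 / 24 * τ ^ 5 - τ ^ 7 / 2) * Real.cos u
        + -7 / 6 * τ ^ 2 * Real.cos u ^ 2)
      (1 + 2 * τ * Real.cos u + 3 / 2 * τ ^ 2) (τ * Real.cos u + τ ^ 2) v := by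
  have hd : 1 + τ ^ 2 * (3 + 2 * (√2 * Real.sin v)) / 2 + τ * (2 + √2 * Real.sin v) * Real.cos u
      = surfaceDenom τ u v := by unfold surfaceDenom; ring
  have he : 1 + 2 * τ * Real.cos u + 3 / 2 * τ ^ 2 + (τ * Real.cos u + τ ^ 2) * (√2 * Real.sin v)
      = surfaceDenom τ u v := by unfold surfaceDenom; ring
  rw [derivSin, derivCos, hd, he, Real.sin_sq, sqrt_two_mul_cos_sq, ← add_div,
    combination_div_pow h]
  congr 1
  unfold surfaceDenom surfaceDenomEuler fluxNum fluxNumEuler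
  generalize √2 * Real.sin v = σ
  generalize Real.cos u = C
  push_cast
  ring

/-- `denom` in terms of `τ = √2 t`. -/
noncomputable def boxDenom (τ u v r : ℝ) : ℝ :=
  1 + τ * (2 + r * (√2 * Real.sin v)) * Real.cos u
    + τ ^ 2 * (2 + 2 * r * (√2 * Real.sin v) + r ^ 2) / 2

theorem boxDenom_eq_denom (t u v r : ℝ) : boxDenom (√2 * t) u v r = denom t u v r := by
  have h : √2 ^ 2 = 2 := Real.sq_sqrt zero_le_two
  unfold boxDenom denom
  linear_combination (t * r * Real.sin v * Real.cos u
    + t ^ 2 * (2 + 2 * r * (√2 * Real.sin v) + r ^ 2) / 2) * h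

theorem boxDenom_one (τ u v : ℝ) : boxDenom τ u v 1 = surfaceDenom τ u v := by
  unfold boxDenom surfaceDenom
  ring

theorem continuous_boxDenom :
    Continuous fun p : ℝ × ℝ × ℝ × ℝ => boxDenom p.1 p.2.1 p.2.2.1 p.2.2.2 := by
  unfold boxDenom
  fun_prop

/-- The numerator of the radial component of the flux through the tori of tube radius `r`. -/
noncomputable def radialNum (τ u v r : ℝ) : ℝ :=
  r * (2 + r * (√2 * Real.sin v)) * ((r + √2 * Real.sin v)
      * (1 + τ * (2 + r * (√2 * Real.sin v)) * Real.cos u)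
    - τ / 2 * (2 + 2 * r * (√2 * Real.sin v) + r ^ 2) * (√2 * Real.sin v) * Real.cos u)

/-- The derivative of `radialNum / boxDenom ^ 3` with respect to `r`. -/
noncomputable def derivRadial (τ u v r : ℝ) : ℝ :=
  (((2 + 2 * r * (√2 * Real.sin v)) * ((r + √2 * Real.sin v)
      * (1 + τ * (2 + r * (√2 * Real.sin v)) * Real.cos u)
      - τ / 2 * (2 + 2 * r * (√2 * Real.sin v) + r ^ 2) * (√2 * Real.sin v) * Real.cos u)
    + r * (2 + r * (√2 * Real.sin v)) * (1 + τ * (2 + r * (√2 * Real.sin v)) * Real.cos u))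
      * boxDenom τ u v r
    - 3 * radialNum τ u v r
      * (τ * (√2 * Real.sin v) * Real.cos u + τ ^ 2 * (√2 * Real.sin v + r)))
    / boxDenom τ u v r ^ 4

theorem hasDerivAt_radial {τ u v r : ℝ} (h : boxDenom τ u v r ≠ 0) :
    HasDerivAt (fun r => radialNum τ u v r / boxDenom τ u v r ^ 3) (derivRadial τ u v r) r := by
  have hr := hasDerivAt_id r
  have hd : HasDerivAt (fun r => boxDenom τ u v r)
      (τ * (√2 * Real.sin v) * Real.cos u + τ ^ 2 * (√2 * Real.sin v + r)) r := by
    unfold boxDenom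
    refine (((((hr.mul_const _).const_add 2).const_mul τ).mul_const _).const_add 1).add
      ((((((hr.const_mul 2).mul_const _).const_add 2).add (hr.pow 2)).const_mul
        (τ ^ 2)).div_const 2) |>.congr_deriv ?_
    simp
    ring
  have hn : HasDerivAt (fun r => radialNum τ u v r)
      ((2 + 2 * r * (√2 * Real.sin v)) * ((r + √2 * Real.sin v)
      * (1 + τ * (2 + r * (√2 * Real.sin v)) * Real.cos u)
      - τ / 2 * (2 + 2 * r * (√2 * Real.sin v) + r ^ 2) * (√2 * Real.sin v) * Real.cos u)
    + r * (2 + r * (√2 * Real.sin v)) * (1 + τ * (2 + r * (√2 * Real.sin v)) * Real.cos u)) r := by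
    unfold radialNum
    have h2 := (hr.mul_const (√2 * Real.sin v)).const_add 2
    refine ((hr.mul h2).mul (((hr.add_const (√2 * Real.sin v)).mul
      (((h2.const_mul τ).mul_const (Real.cos u)).const_add 1)).sub
      ((((((hr.const_mul 2).mul_const _).const_add 2).add (hr.pow 2)).const_mul (τ / 2)).mul_const
        (√2 * Real.sin v) |>.mul_const (Real.cos u)))).congr_deriv ?_
    simp
    ring
  refine (hasDerivAt_div_pow hn hd h 2).congr_deriv ?_
  rw [derivRadial]
  norm_num

theorem continuousOn_derivRadial {τ : ℝ} {s : Set (ℝ × ℝ × ℝ)}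
    (h : ∀ p ∈ s, boxDenom τ p.1 p.2.1 p.2.2 ≠ 0) :
    ContinuousOn (fun p : ℝ × ℝ × ℝ => derivRadial τ p.1 p.2.1 p.2.2) s := by
  have hc : Continuous fun p : ℝ × ℝ × ℝ => boxDenom τ p.1 p.2.1 p.2.2 :=
    continuous_boxDenom.comp (f := fun p : ℝ × ℝ × ℝ => (τ, p)) (by fun_prop)
  unfold derivRadial radialNum
  exact ContinuousOn.div (by fun_prop) (by fun_prop) fun p hp => pow_ne_zero _ (h p hp)

/-- The position field of the image space has divergence 3. Pulled back by `sct` and weighted by the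
Jacobian of `sct`, it is D⁻³ ((1 + 2⟨a, x⟩) x - |x|² a). The identity is its divergence in the
coordinates r, u, v, multiplied by √2. -/
theorem box_certificate {τ u v r : ℝ} (h : boxDenom τ u v r ≠ 0) :
    3 * (r * (2 + r * (√2 * Real.sin v))) / boxDenom τ u v r ^ 3 =
    derivRadial τ u v r
    + (derivSin 2 (r * τ * (2 + 2 * r * (√2 * Real.sin v) + r ^ 2)) 0 0
      (1 + τ ^ 2 * (2 + 2 * r * (√2 * Real.sin v) + r ^ 2) / 2)
      (τ * (2 + r * (√2 * Real.sin v))) u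
    + derivCos 2 (2 * (1 + τ * Real.cos u * (1 - r ^ 2 / 2)))
      (r * (1 + τ * Real.cos u * (1 - r ^ 2 / 2))) 0
      (1 + 2 * τ * Real.cos u + τ ^ 2 * (2 + r ^ 2) / 2)
      (r * τ * Real.cos u + r * τ ^ 2) v) := by
  have hd : 1 + τ ^ 2 * (2 + 2 * r * (√2 * Real.sin v) + r ^ 2) / 2
      + τ * (2 + r * (√2 * Real.sin v)) * Real.cos u = boxDenom τ u v r := by unfold boxDenom; ring
  have he : 1 + 2 * τ * Real.cos u + τ ^ 2 * (2 + r ^ 2) / 2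
      + (r * τ * Real.cos u + r * τ ^ 2) * (√2 * Real.sin v) = boxDenom τ u v r := by
    unfold boxDenom; ring
  rw [derivRadial, derivSin, derivCos, hd, he, Real.sin_sq, sqrt_two_mul_cos_sq, ← add_div,
    ← add_div, ← mul_div_mul_right _ _ h, ← pow_succ]
  congr 1
  unfold boxDenom radialNum
  generalize √2 * Real.sin v = σ
  generalize Real.cos u = C
  push_cast
  ring

end Relations

/-! ### The linear relations between area, volume and their derivatives. -/

section Relations

open MeasureTheory Set

theorem boxDenom_pos {t : ℝ} (ht : |t| < √2 - 1) (u v : ℝ) {r : ℝ} (hr : r ∈ Icc (0 : ℝ) 1) :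
    0 < boxDenom (√2 * t) u v r := by
  rw [boxDenom_eq_denom]
  exact denom_pos ht u v hr

theorem surfaceDenom_pos {τ : ℝ} (hτ : |τ| < 2 - √2) (u v : ℝ) : 0 < surfaceDenom τ u v := by
  have h : √2 * √2 = 2 := Real.mul_self_sqrt zero_le_two
  have h0 : (0 : ℝ) < √2 := Real.sqrt_pos.2 zero_lt_two
  have hτ' : √2 * (τ / √2) = τ := by field_simp
  rw [← boxDenom_one, ← hτ']
  refine boxDenom_pos ?_ u v ⟨zero_le_one, le_rfl⟩
  rw [abs_div, abs_of_pos h0, div_lt_iff₀ h0]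
  linarith

theorem abs_sqrt_two_mul_lt {t : ℝ} (ht : |t| < √2 - 1) : |√2 * t| < 2 - √2 := by
  have h : √2 * √2 = 2 := Real.mul_self_sqrt zero_le_two
  have h0 : (0 : ℝ) < √2 := Real.sqrt_pos.2 zero_lt_two
  rw [abs_mul, abs_of_pos h0]
  nlinarith

theorem continuous_surfaceDenom : Continuous fun p : ℝ × ℝ × ℝ => surfaceDenom p.1 p.2.1 p.2.2 := by
  unfold surfaceDenom
  fun_prop

theorem continuousOn_div_surfaceDenom {f : ℝ → ℝ → ℝ → ℝ}
    (hf : Continuous fun p : ℝ × ℝ × ℝ => f p.1 p.2.1 p.2.2) (k : ℕ) :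
    ContinuousOn (fun p : ℝ × ℝ × ℝ => f p.1 p.2.1 p.2.2 / surfaceDenom p.1 p.2.1 p.2.2 ^ k)
      ({τ | |τ| < 2 - √2} ×ˢ univ) :=
  ContinuousOn.div hf.continuousOn (continuous_surfaceDenom.pow k).continuousOn
    fun _ hp => pow_ne_zero _ (surfaceDenom_pos hp.1 _ _).ne'

theorem continuous_div_surfaceDenom {f : ℝ → ℝ → ℝ}
    (hf : Continuous fun p : ℝ × ℝ => f p.1 p.2) (k : ℕ) {τ : ℝ} (hτ : |τ| < 2 - √2) :
    Continuous fun p : ℝ × ℝ => f p.1 p.2 / surfaceDenom τ p.1 p.2 ^ k :=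
  Continuous.div hf ((continuous_surfaceDenom.comp
    (f := fun p : ℝ × ℝ => (τ, p)) (by fun_prop)).pow k)
    fun _ => pow_ne_zero _ (surfaceDenom_pos hτ _ _).ne'

/-- `√2` times the area, as a function of `τ = √2 t`. -/
noncomputable def areaIntegral (τ : ℝ) : ℝ :=
  torusIntegral fun u v => (2 + √2 * Real.sin v) / surfaceDenom τ u v ^ 2

/-- `3 √2` times the volume, as a function of `τ = √2 t`. -/
noncomputable def fluxIntegral (τ : ℝ) : ℝ :=
  torusIntegral fun u v => fluxNum τ u v / surfaceDenom τ u v ^ 3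

theorem sqrt_two_mul_area {t : ℝ} (ht : |t| < √2 - 1) :
    √2 * area t = areaIntegral (√2 * t) := by
  have h : √2 * √2 = 2 := Real.mul_self_sqrt zero_le_two
  rw [areaIntegral, torusIntegral_eq (continuous_div_surfaceDenom (f := fun _ v => 2 + √2 * Real.sin v)
    (by fun_prop) 2 (abs_sqrt_two_mul_lt ht)), area_eq_integral ht, ← intervalIntegral.integral_const_mul]
  simp_rw [← intervalIntegral.integral_const_mul, ← boxDenom_one, boxDenom_eq_denom, ← mul_div_assoc,
    mul_add, h]

/-- On integrating `box_certificate`, the u- and v-terms vanish by periodicity, and the r-term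
leaves only its value at r = 1, because `radialNum` has the factor r. -/
theorem three_mul_sqrt_two_mul_vol {t : ℝ} (ht : |t| < √2 - 1) :
    3 * √2 * vol t = fluxIntegral (√2 * t) := by
  have h : √2 * √2 = 2 := Real.mul_self_sqrt zero_le_two
  set τ := √2 * t with hτ
  have hpos : ∀ p ∈ Icc 0 (2 * π) ×ˢ Icc 0 (2 * π) ×ˢ Icc (0 : ℝ) 1,
      boxDenom τ p.1 p.2.1 p.2.2 ≠ 0 := fun p hp => (boxDenom_pos ht _ _ hp.2.2).ne'
  have hc : Continuous fun p : ℝ × ℝ × ℝ => boxDenom τ p.1 p.2.1 p.2.2 :=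
    continuous_boxDenom.comp (f := fun p : ℝ × ℝ × ℝ => (τ, p)) (by fun_prop)
  set R : ℝ → ℝ → ℝ → ℝ := fun u v r => derivRadial τ u v r
  set S : ℝ → ℝ → ℝ → ℝ := fun u v r =>
    derivSin 2 (r * τ * (2 + 2 * r * (√2 * Real.sin v) + r ^ 2)) 0 0
      (1 + τ ^ 2 * (2 + 2 * r * (√2 * Real.sin v) + r ^ 2) / 2)
      (τ * (2 + r * (√2 * Real.sin v))) u with hS
  set K : ℝ → ℝ → ℝ → ℝ := fun u v r =>
    derivCos 2 (2 * (1 + τ * Real.cos u * (1 - r ^ 2 / 2)))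
      (r * (1 + τ * Real.cos u * (1 - r ^ 2 / 2))) 0
      (1 + 2 * τ * Real.cos u + τ ^ 2 * (2 + r ^ 2) / 2)
      (r * τ * Real.cos u + r * τ ^ 2) v with hK
  have hd : ∀ u v r, 1 + τ ^ 2 * (2 + 2 * r * (√2 * Real.sin v) + r ^ 2) / 2
      + τ * (2 + r * (√2 * Real.sin v)) * Real.cos u = boxDenom τ u v r := fun u v r => by
    unfold boxDenom; ring
  have he : ∀ u v r, 1 + 2 * τ * Real.cos u + τ ^ 2 * (2 + r ^ 2) / 2
      + (r * τ * Real.cos u + r * τ ^ 2) * (√2 * Real.sin v) = boxDenom τ u v r := fun u v r => by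
    unfold boxDenom; ring
  have hRc : ContinuousOn (fun p : ℝ × ℝ × ℝ => R p.1 p.2.1 p.2.2)
      (Icc 0 (2 * π) ×ˢ Icc 0 (2 * π) ×ˢ Icc 0 1) := continuousOn_derivRadial hpos
  have hSc : ContinuousOn (fun p : ℝ × ℝ × ℝ => S p.1 p.2.1 p.2.2)
      (Icc 0 (2 * π) ×ˢ Icc 0 (2 * π) ×ˢ Icc 0 1) := by
    simp only [hS, derivSin, hd]
    exact ContinuousOn.div (by fun_prop) (by fun_prop) fun p hp => pow_ne_zero _ (hpos p hp)
  have hKc : ContinuousOn (fun p : ℝ × ℝ × ℝ => K p.1 p.2.1 p.2.2)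
      (Icc 0 (2 * π) ×ˢ Icc 0 (2 * π) ×ˢ Icc 0 1) := by
    simp only [hK, derivCos, he]
    exact ContinuousOn.div (by fun_prop) (by fun_prop) fun p hp => pow_ne_zero _ (hpos p hp)
  have hVc : ContinuousOn (fun p : ℝ × ℝ × ℝ =>
      p.2.2 * (√2 + p.2.2 * Real.sin p.2.1) / denom t p.1 p.2.1 p.2.2 ^ 3)
      (Icc 0 (2 * π) ×ˢ Icc 0 (2 * π) ×ˢ Icc 0 1) := by
    simp only [← boxDenom_eq_denom, ← hτ]
    exact ContinuousOn.div (by fun_prop) (by fun_prop) fun p hp => pow_ne_zero _ (hpos p hp)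
  have hS0 := setIntegral_openBox_eq_zero_of_fst hSc fun v r hr =>
    integral_derivSin 2 _ _ _ fun u => by rw [hd]; exact (boxDenom_pos ht u v hr).ne'
  have hK0 := setIntegral_openBox_eq_zero_of_snd hKc fun u r hr =>
    integral_derivCos 2 _ _ _ fun v => by rw [he]; exact (boxDenom_pos ht u v hr).ne'
  have hR := setIntegral_openBox hRc
  have hV := setIntegral_openBox (g := fun u v r => r * (√2 + r * Real.sin v) / denom t u v r ^ 3)
    hVc
  have hRr : ∀ u v, ∫ r in (0 : ℝ)..1, R u v r = fluxNum τ u v / surfaceDenom τ u v ^ 3 := by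
    intro u v
    rw [intervalIntegral.integral_eq_sub_of_hasDerivAt
      (f := fun r => radialNum τ u v r / boxDenom τ u v r ^ 3)]
    · rw [boxDenom_one]
      have h1 : radialNum τ u v 1 = fluxNum τ u v := by unfold radialNum fluxNum; ring
      have h0 : radialNum τ u v 0 = 0 := by unfold radialNum; ring
      rw [h1, h0, zero_div, sub_zero]
    · intro r hr
      rw [uIcc_of_le zero_le_one] at hr
      exact hasDerivAt_radial (boxDenom_pos ht u v hr).ne'
    · refine ContinuousOn.intervalIntegrable ?_
      rw [uIcc_of_le zero_le_one]
      exact (continuousOn_derivRadial (s := {u} ×ˢ {v} ×ˢ Icc 0 1) fun p hp =>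
        (boxDenom_pos ht _ _ hp.2.2).ne').comp (f := fun r : ℝ => (u, v, r)) (by fun_prop)
        fun r hr => ⟨rfl, rfl, hr⟩
  rw [fluxIntegral, torusIntegral_eq (continuous_div_surfaceDenom
    (by unfold fluxNum; fun_prop) 3 (abs_sqrt_two_mul_lt ht))]
  simp_rw [← hRr]
  rw [← hR, vol_eq_integral ht, ← hV, ← integral_const_mul]
  have hsum : ∫ y in openBox, (R (y 0) (y 1) (y 2) + (S (y 0) (y 1) (y 2) + K (y 0) (y 1) (y 2)))
      = ∫ y in openBox, R (y 0) (y 1) (y 2) := by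
    have iR := (setIntegral_openBox_eq_prod hRc).1
    have iS := (setIntegral_openBox_eq_prod hSc).1
    have iK := (setIntegral_openBox_eq_prod hKc).1
    have h₁ := integral_add iR (iS.add iK)
    have h₂ := integral_add iS iK
    simp only [Pi.add_apply] at h₁
    rw [h₁, h₂, hS0, hK0, add_zero, add_zero]
  rw [← hsum]
  refine setIntegral_congr_fun measurableSet_openBox fun y hy => ?_
  have hb := box_certificate (boxDenom_pos ht (y 0) (y 1) (Ioo_subset_Icc_self hy.2.2)).ne'
  simp only [R, S, K]
  rw [← hb, boxDenom_eq_denom, ← mul_div_assoc]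
  congr 1
  linear_combination 3 * y 2 * h

/-- The derivative of `surfaceDenom` with respect to `τ`. -/
noncomputable def surfaceDenomDeriv (τ u v : ℝ) : ℝ :=
  (2 + √2 * Real.sin v) * Real.cos u + τ * (3 + 2 * (√2 * Real.sin v))

/-- The derivative of `fluxNum` with respect to `τ`. -/
noncomputable def fluxNumDeriv (u v : ℝ) : ℝ :=
  (2 + √2 * Real.sin v) * ((1 + √2 * Real.sin v) * ((2 + √2 * Real.sin v) * Real.cos u)
    - 1 / 2 * (3 + 2 * (√2 * Real.sin v)) * (√2 * Real.sin v) * Real.cos u)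

theorem hasDerivAt_surfaceDenom (τ u v : ℝ) :
    HasDerivAt (fun τ => surfaceDenom τ u v) (surfaceDenomDeriv τ u v) τ := by
  have hr := hasDerivAt_id τ
  unfold surfaceDenom surfaceDenomDeriv
  refine ((((hr.mul_const _).mul_const _).const_add 1).add
    (((hr.pow 2).mul_const _).div_const 2)).congr_deriv ?_
  simp
  ring

theorem hasDerivAt_fluxNum (τ u v : ℝ) :
    HasDerivAt (fun τ => fluxNum τ u v) (fluxNumDeriv u v) τ := by
  have hr := hasDerivAt_id τ
  unfold fluxNum fluxNumDeriv
  refine (((((hr.mul_const _).mul_const _).const_add 1).const_mul _).sub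
    ((((hr.div_const 2).mul_const _).mul_const _).mul_const _) |>.const_mul _).congr_deriv ?_
  ring

theorem hasDerivAt_areaIntegral {τ : ℝ} (hτ : |τ| < 2 - √2) :
    HasDerivAt areaIntegral (torusIntegral fun u v =>
      (-2 * (2 + √2 * Real.sin v) * surfaceDenomDeriv τ u v) / surfaceDenom τ u v ^ 3) τ := by
  refine hasDerivAt_torusIntegral (F := fun τ u v => (2 + √2 * Real.sin v) / surfaceDenom τ u v ^ 2)
    (F' := fun τ u v => (-2 * (2 + √2 * Real.sin v) * surfaceDenomDeriv τ u v)
      / surfaceDenom τ u v ^ 3) hτ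
    (continuousOn_div_surfaceDenom (f := fun _ _ v => 2 + √2 * Real.sin v) (by fun_prop) 2)
    (continuousOn_div_surfaceDenom (f := fun τ u v =>
      -2 * (2 + √2 * Real.sin v) * surfaceDenomDeriv τ u v)
      (by unfold surfaceDenomDeriv; fun_prop) 3) fun s hs u v => ?_
  refine (hasDerivAt_div_pow (hasDerivAt_const s _) (hasDerivAt_surfaceDenom s u v)
    (surfaceDenom_pos hs u v).ne' 1).congr_deriv ?_
  congr 1
  norm_num

theorem hasDerivAt_fluxIntegral {τ : ℝ} (hτ : |τ| < 2 - √2) :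
    HasDerivAt fluxIntegral (torusIntegral fun u v =>
      (fluxNumDeriv u v * surfaceDenom τ u v - 3 * fluxNum τ u v * surfaceDenomDeriv τ u v)
        / surfaceDenom τ u v ^ 4) τ := by
  refine hasDerivAt_torusIntegral (F := fun τ u v => fluxNum τ u v / surfaceDenom τ u v ^ 3)
    (F' := fun τ u v => (fluxNumDeriv u v * surfaceDenom τ u v
      - 3 * fluxNum τ u v * surfaceDenomDeriv τ u v) / surfaceDenom τ u v ^ 4) hτ
    (continuousOn_div_surfaceDenom (by unfold fluxNum; fun_prop) 3)
    (continuousOn_div_surfaceDenom (f := fun τ u v => fluxNumDeriv u v * surfaceDenom τ u v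
      - 3 * fluxNum τ u v * surfaceDenomDeriv τ u v)
      (by unfold surfaceDenomDeriv fluxNum surfaceDenom fluxNumDeriv; fun_prop) 4) fun s hs u v => ?_
  refine (hasDerivAt_div_pow (hasDerivAt_fluxNum s u v) (hasDerivAt_surfaceDenom s u v)
    (surfaceDenom_pos hs u v).ne' 2).congr_deriv ?_
  congr 1
  norm_num

theorem torusIntegral_combination {f g h : ℝ → ℝ → ℝ} (a b c : ℝ)
    (hf : Continuous fun p : ℝ × ℝ => f p.1 p.2) (hg : Continuous fun p : ℝ × ℝ => g p.1 p.2)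
    (hh : Continuous fun p : ℝ × ℝ => h p.1 p.2) :
    torusIntegral (fun u v => a * f u v + b * g u v + c * h u v)
      = a * torusIntegral f + b * torusIntegral g + c * torusIntegral h := by
  rw [torusIntegral_add (f := fun u v => a * f u v + b * g u v) (g := fun u v => c * h u v)
    (by fun_prop) (by fun_prop), torusIntegral_add (f := fun u v => a * f u v)
    (g := fun u v => b * g u v) (by fun_prop) (by fun_prop)]
  simp only [torusIntegral_const_mul]

theorem areaIntegral_relation {τ : ℝ} (hτ : |τ| < 2 - √2) :
    (3 - 5 * τ ^ 2 - 5 / 4 * τ ^ 4) * areaIntegral τ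
      + (2 - τ ^ 4 / 2) * (τ * deriv areaIntegral τ)
      + -2 * (1 + τ ^ 2 / 2) ^ 3 * fluxIntegral τ = 0 := by
  rw [(hasDerivAt_areaIntegral hτ).deriv, ← mul_assoc, areaIntegral, fluxIntegral,
    ← torusIntegral_combination]
  · refine Eq.trans ?_ (torusIntegral_derivSin_add_derivCos 1
      (b₀ := fun v => -7 * τ - 6 * τ ^ 3 - τ ^ 5 / 2
        + (-3 * τ - 33 / 8 * τ ^ 3 - 7 / 16 * τ ^ 5) * (√2 * Real.sin v))
      (b₁ := fun v => -4 * τ ^ 2 - τ ^ 4 / 4 + (-2 * τ ^ 2 - τ ^ 4 / 4) * (√2 * Real.sin v))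
      (b₂ := fun _ => 0)
      (d₀ := fun v => 1 + τ ^ 2 * (3 + 2 * (√2 * Real.sin v)) / 2)
      (d₁ := fun v => τ * (2 + √2 * Real.sin v))
      (a₀ := fun u => 3 + τ ^ 2 - 3 / 2 * τ ^ 4 + (3 * τ - τ ^ 3 / 8 + τ ^ 5 / 16) * Real.cos u)
      (a₁ := fun u => 1 + τ ^ 2 - 7 / 8 * τ ^ 4 + 3 / 2 * τ * Real.cos u) (a₂ := fun _ => 0)
      (e₀ := fun u => 1 + 2 * τ * Real.cos u + 3 / 2 * τ ^ 2) (e₁ := fun u => τ * Real.cos u + τ ^ 2)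
      (by fun_prop) (by fun_prop) (by fun_prop) (by fun_prop) (by fun_prop) (by fun_prop)
      (by fun_prop) (by fun_prop) (by fun_prop) (by fun_prop) (fun u v => ?_) (fun u v => ?_))
    · congr 1
      funext u v
      rw [← area_certificate (surfaceDenom_pos hτ u v).ne']
      unfold surfaceDenomDeriv surfaceDenomEuler
      ring
    all_goals
      refine Eq.trans_ne ?_ (surfaceDenom_pos hτ u v).ne'
      unfold surfaceDenom
      ring
  · exact continuous_div_surfaceDenom (f := fun _ v => 2 + √2 * Real.sin v) (by fun_prop) 2 hτ
  · exact continuous_div_surfaceDenom (f := fun u v =>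
      -2 * (2 + √2 * Real.sin v) * surfaceDenomDeriv τ u v)
      (by unfold surfaceDenomDeriv; fun_prop) 3 hτ
  · exact continuous_div_surfaceDenom (by unfold fluxNum; fun_prop) 3 hτ

theorem fluxIntegral_relation {τ : ℝ} (hτ : |τ| < 2 - √2) :
    (-3 + 9 * τ ^ 2 - 3 / 4 * τ ^ 4) * areaIntegral τ
      + (2 + 15 * τ ^ 2 - 13 / 2 * τ ^ 4 + 5 / 4 * τ ^ 6) * fluxIntegral τ
      + (-4 / 3 + 14 / 3 * τ ^ 2 - 7 / 3 * τ ^ 4 + τ ^ 6 / 6) * (τ * deriv fluxIntegral τ) = 0 := by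
  rw [(hasDerivAt_fluxIntegral hτ).deriv, ← mul_assoc, areaIntegral, fluxIntegral,
    ← torusIntegral_combination]
  · refine Eq.trans ?_ (torusIntegral_derivSin_add_derivCos 2
      (b₀ := fun v => 47 / 3 * τ + 97 / 6 * τ ^ 3 + 305 / 3 * τ ^ 5 - τ ^ 7 / 3
        + (52 / 3 * τ + 337 / 12 * τ ^ 3 + 883 / 12 * τ ^ 5 - 11 / 48 * τ ^ 7) * (√2 * Real.sin v))
      (b₁ := fun v => 44 * τ ^ 2 + 565 / 4 * τ ^ 4 + 11 / 8 * τ ^ 6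
        + (131 / 3 * τ ^ 2 + 331 / 3 * τ ^ 4 + 13 / 12 * τ ^ 6) * (√2 * Real.sin v))
      (b₂ := fun v => 52 * τ ^ 3 + τ ^ 5 / 2 + (42 * τ ^ 3 + 5 / 12 * τ ^ 5) * (√2 * Real.sin v))
      (d₀ := fun v => 1 + τ ^ 2 * (3 + 2 * (√2 * Real.sin v)) / 2)
      (d₁ := fun v => τ * (2 + √2 * Real.sin v))
      (a₀ := fun u => -3 + 19 / 6 * τ ^ 2 + 1043 / 12 * τ ^ 4 - 5 / 24 * τ ^ 6
        + (-28 / 3 * τ + 841 / 12 * τ ^ 3 + 153 / 4 * τ ^ 5 - 21 / 16 * τ ^ 7) * Real.cos u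
        + (20 / 3 * τ ^ 2 - 47 / 6 * τ ^ 4 - τ ^ 6 / 12) * Real.cos u ^ 2)
      (a₁ := fun u => -1 - 5 / 2 * τ ^ 2 + 495 / 8 * τ ^ 4 + τ ^ 6 / 16
        + (-27 / 2 * τ + 145 / 4 * τ ^ 3 + 141 / 4 * τ ^ 5 - 13 / 8 * τ ^ 7) * Real.cos u
        + -7 * τ ^ 2 * Real.cos u ^ 2)
      (a₂ := fun u => -11 / 3 * τ ^ 2 + 10 * τ ^ 4 + τ ^ 6 / 8
        + (-7 / 3 * τ + 17 / 6 * τ ^ 3 + 155 / 24 * τ ^ 5 - τ ^ 7 / 2) * Real.cos u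
        + -7 / 6 * τ ^ 2 * Real.cos u ^ 2)
      (e₀ := fun u => 1 + 2 * τ * Real.cos u + 3 / 2 * τ ^ 2) (e₁ := fun u => τ * Real.cos u + τ ^ 2)
      (by fun_prop) (by fun_prop) (by fun_prop) (by fun_prop) (by fun_prop) (by fun_prop)
      (by fun_prop) (by fun_prop) (by fun_prop) (by fun_prop) (fun u v => ?_) (fun u v => ?_))
    · congr 1
      funext u v
      rw [← vol_certificate (surfaceDenom_pos hτ u v).ne']
      have h₁ : fluxNumEuler τ u v = τ * fluxNumDeriv u v := by
        unfold fluxNumEuler fluxNumDeriv; ring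
      have h₂ : surfaceDenomEuler τ u v = τ * surfaceDenomDeriv τ u v := by
        unfold surfaceDenomEuler surfaceDenomDeriv; ring
      rw [h₁, h₂]
      ring
    all_goals
      refine Eq.trans_ne ?_ (surfaceDenom_pos hτ u v).ne'
      unfold surfaceDenom
      ring
  · exact continuous_div_surfaceDenom (f := fun _ v => 2 + √2 * Real.sin v) (by fun_prop) 2 hτ
  · exact continuous_div_surfaceDenom (by unfold fluxNum; fun_prop) 3 hτ
  · exact continuous_div_surfaceDenom (f := fun u v => fluxNumDeriv u v * surfaceDenom τ u v
      - 3 * fluxNum τ u v * surfaceDenomDeriv τ u v)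
      (by unfold surfaceDenomDeriv fluxNum surfaceDenom fluxNumDeriv; fun_prop) 4 hτ

theorem hasDerivAt_area {t : ℝ} (ht : |t| < √2 - 1) :
    HasDerivAt area (deriv areaIntegral (√2 * t)) t := by
  have h0 : √2 ≠ 0 := (Real.sqrt_pos.2 zero_lt_two).ne'
  have hd := (hasDerivAt_areaIntegral (abs_sqrt_two_mul_lt ht)).differentiableAt.hasDerivAt
  have h1 := ((hd.comp t ((hasDerivAt_id t).const_mul √2)).const_mul (√2)⁻¹).congr_deriv
    (g' := deriv areaIntegral (√2 * t)) (by field_simp)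
  refine h1.congr_of_eventuallyEq ?_
  filter_upwards [(isOpen_lt continuous_abs continuous_const).mem_nhds ht] with s hs
  simp only [Function.comp]
  rw [← sqrt_two_mul_area hs, inv_mul_cancel_left₀ h0]

theorem hasDerivAt_vol {t : ℝ} (ht : |t| < √2 - 1) :
    HasDerivAt vol (deriv fluxIntegral (√2 * t) / 3) t := by
  have h0 : √2 ≠ 0 := (Real.sqrt_pos.2 zero_lt_two).ne'
  have hd := (hasDerivAt_fluxIntegral (abs_sqrt_two_mul_lt ht)).differentiableAt.hasDerivAt
  have h1 := ((hd.comp t ((hasDerivAt_id t).const_mul √2)).const_mul (3 * √2)⁻¹).congr_deriv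
    (g' := deriv fluxIntegral (√2 * t) / 3) (by field_simp)
  refine h1.congr_of_eventuallyEq ?_
  filter_upwards [(isOpen_lt continuous_abs continuous_const).mem_nhds ht] with s hs
  simp only [Function.comp]
  rw [← three_mul_sqrt_two_mul_vol hs, inv_mul_cancel_left₀ (mul_ne_zero three_ne_zero h0)]

theorem area_relation {t : ℝ} (ht : |t| < √2 - 1) :
    6 * (1 + t ^ 2) ^ 3 * vol t = (3 - 10 * t ^ 2 - 5 * t ^ 4) * area t
      + 2 * (1 - t ^ 4) * (t * deriv area t) := by
  have h : √2 ^ 2 = 2 := Real.sq_sqrt zero_le_two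
  have h0 : √2 ≠ 0 := (Real.sqrt_pos.2 zero_lt_two).ne'
  have h4 : √2 ^ 4 = 4 := by linear_combination (√2 ^ 2 + 2) * h
  have hrel := areaIntegral_relation (abs_sqrt_two_mul_lt ht)
  rw [← sqrt_two_mul_area ht, ← three_mul_sqrt_two_mul_vol ht, ← (hasDerivAt_area ht).deriv] at hrel
  simp only [mul_pow, h, h4] at hrel
  refine mul_left_cancel₀ h0 ?_
  linear_combination -hrel

theorem vol_relation {t : ℝ} (ht : |t| < √2 - 1) :
    (-3 + 18 * t ^ 2 - 3 * t ^ 4) * area t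
      + (6 + 90 * t ^ 2 - 78 * t ^ 4 + 30 * t ^ 6) * vol t
      = 4 * (1 - t ^ 2) * (1 - 6 * t ^ 2 + t ^ 4) * (t * deriv vol t) := by
  have h : √2 ^ 2 = 2 := Real.sq_sqrt zero_le_two
  have h0 : √2 ≠ 0 := (Real.sqrt_pos.2 zero_lt_two).ne'
  have h4 : √2 ^ 4 = 4 := by linear_combination (√2 ^ 2 + 2) * h
  have h6 : √2 ^ 6 = 8 := by linear_combination (√2 ^ 4 + 2 * √2 ^ 2 + 4) * h
  have hrel := fluxIntegral_relation (abs_sqrt_two_mul_lt ht)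
  have hv : deriv fluxIntegral (√2 * t) = 3 * deriv vol t := by
    rw [(hasDerivAt_vol ht).deriv]; ring
  rw [← sqrt_two_mul_area ht, ← three_mul_sqrt_two_mul_vol ht, hv] at hrel
  simp only [mul_pow, h, h4, h6] at hrel
  refine mul_left_cancel₀ h0 ?_
  linear_combination hrel

end Relations

/-! ### Holomorphic extension in τ and even Taylor expansions. -/

section TaylorSeries

open MeasureTheory Set

/-- If τ were a zero, s = 1 / τ would be a root of s² + p s + q. The discriminant is not positive,
so the roots are complex conjugate or a double real root, and |s|² = q, against |τ|² q < 1. -/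
theorem one_add_mul_add_sq_mul_ne_zero {p q : ℝ} {τ : ℂ} (hpq : p ^ 2 ≤ 4 * q)
    (hq : ‖τ‖ ^ 2 * q < 1) : 1 + τ * p + τ ^ 2 * q ≠ 0 := by
  intro h
  have hτ : τ ≠ 0 := by rintro rfl; simp at h
  have hs : τ⁻¹ ^ 2 + p * τ⁻¹ + q = 0 := by
    field_simp
    linear_combination h
  set s := τ⁻¹ with hs'
  have hre := congrArg Complex.re hs
  have him := congrArg Complex.im hs
  simp [pow_two] at hre him
  have hn : s.re * s.re + s.im * s.im = q := by
    have h2 : s.im * (2 * s.re + p) = 0 := by linear_combination him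
    rcases mul_eq_zero.1 h2 with h0 | h0
    · rw [h0] at hre ⊢
      have : s.re = -p / 2 := by nlinarith [sq_nonneg (s.re + p / 2)]
      rw [this] at hre ⊢
      linarith
    · have hp : p = -2 * s.re := by linarith
      rw [hp] at hre
      linarith
  have hnorm : ‖s‖ ^ 2 = q := by rw [← Complex.normSq_eq_norm_sq, Complex.normSq_apply, hn]
  rw [← hnorm, ← mul_pow, hs', ← norm_mul, mul_inv_cancel₀ hτ] at hq
  simp at hq

/-- `surfaceDenom` at a complex parameter. -/
noncomputable def complexDenom (τ : ℂ) (u v : ℝ) : ℂ :=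
  1 + τ * ((2 + √2 * Real.sin v) * Real.cos u : ℝ) + τ ^ 2 * ((3 + 2 * (√2 * Real.sin v)) / 2 : ℝ)

theorem complexDenom_ofReal (τ u v : ℝ) : complexDenom τ u v = surfaceDenom τ u v := by
  unfold complexDenom surfaceDenom
  push_cast
  ring

/-- The discriminant condition follows from (2 + σ)² ≤ 6 + 4σ, that is, σ² ≤ 2. The radius fits
because (2 - √2)² (3 + 2√2) / 2 = 1. -/
theorem complexDenom_ne_zero {τ : ℂ} (hτ : ‖τ‖ < 2 - √2) (u v : ℝ) : complexDenom τ u v ≠ 0 := by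
  have h2 : √2 ^ 2 = 2 := Real.sq_sqrt zero_le_two
  have h0 : 0 < √2 := Real.sqrt_pos.2 zero_lt_two
  have hlt : √2 < 3 / 2 := by nlinarith
  set σ := √2 * Real.sin v with hσ
  have hσ2 : σ ^ 2 ≤ 2 := by
    rw [hσ, mul_pow, h2]
    linarith [Real.sin_sq_le_one v]
  obtain ⟨hσl, hσu⟩ := abs_le_of_sq_le_sq' (hσ2.trans h2.ge) h0.le
  refine one_add_mul_add_sq_mul_ne_zero ?_ ?_
  · rw [mul_pow]
    nlinarith [Real.cos_sq_le_one u, sq_nonneg (2 + σ)]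
  · have hsq : ‖τ‖ ^ 2 < (2 - √2) ^ 2 := pow_lt_pow_left₀ hτ (norm_nonneg τ) two_ne_zero
    have hq : 0 < (3 + 2 * σ) / 2 := by linarith
    calc ‖τ‖ ^ 2 * ((3 + 2 * σ) / 2) < (2 - √2) ^ 2 * ((3 + 2 * σ) / 2) := by gcongr
      _ ≤ (2 - √2) ^ 2 * ((3 + 2 * √2) / 2) := by gcongr
      _ = 1 := by linear_combination (√2 ^ 2 / 1 - 5 / 2 - √2 ^ 2 + √2) * h2

theorem continuous_complexDenom : Continuous fun p : ℂ × ℝ × ℝ => complexDenom p.1 p.2.1 p.2.2 := by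
  unfold complexDenom
  fun_prop

theorem hasDerivAt_complexDenom (τ : ℂ) (u v : ℝ) :
    HasDerivAt (fun τ => complexDenom τ u v) (((2 + √2 * Real.sin v) * Real.cos u : ℝ)
      + 2 * τ * ((3 + 2 * (√2 * Real.sin v)) / 2 : ℝ)) τ := by
  have hr := hasDerivAt_id τ
  unfold complexDenom
  refine (((hr.mul_const _).const_add 1).add ((hr.pow 2).mul_const _)).congr_deriv ?_
  simp

/-- An integral over the torus with linear numerator is a power series in the parameter. -/
theorem exists_hasSum_torusIntegral {n₀ n₁ : ℝ → ℝ → ℝ}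
    (h₀ : Continuous fun p : ℝ × ℝ => n₀ p.1 p.2) (h₁ : Continuous fun p : ℝ × ℝ => n₁ p.1 p.2)
    (k : ℕ) : ∃ c : ℕ → ℝ, ∀ τ : ℝ, |τ| < 2 - √2 → HasSum (fun n => c n * τ ^ n)
      (torusIntegral fun u v => (n₀ u v + τ * n₁ u v) / surfaceDenom τ u v ^ (k + 1)) := by
  set F : ℂ → ℝ → ℝ → ℂ := fun τ u v =>
    ((n₀ u v : ℂ) + τ * (n₁ u v : ℂ)) / complexDenom τ u v ^ (k + 1) with hF
  set G : ℂ → ℂ := fun τ => ∫ p in Ioc 0 (2 * π) ×ˢ Ioc 0 (2 * π), F τ p.1 p.2 with hG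
  have hc₀ : Continuous fun p : ℂ × ℝ × ℝ => (n₀ p.2.1 p.2.2 : ℂ) :=
    Complex.continuous_ofReal.comp (h₀.comp continuous_snd)
  have hc₁ : Continuous fun p : ℂ × ℝ × ℝ => (n₁ p.2.1 p.2.2 : ℂ) :=
    Complex.continuous_ofReal.comp (h₁.comp continuous_snd)
  have hcd := continuous_complexDenom
  have hdiff : DifferentiableOn ℂ G (Metric.ball 0 (2 - √2)) := by
    intro τ hτ
    rw [mem_ball_zero_iff] at hτ
    refine (hasDerivAt_setIntegral_period (F := F) (F' := fun τ u v => (n₁ u v * complexDenom τ u v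
      - (k + 1) * (n₀ u v + τ * n₁ u v) * (((2 + √2 * Real.sin v) * Real.cos u : ℝ)
        + 2 * τ * ((3 + 2 * (√2 * Real.sin v)) / 2 : ℝ))) / complexDenom τ u v ^ (k + 2)) hτ
      ?_ ?_ fun s hs u v => ?_).differentiableAt.differentiableWithinAt
    · exact ContinuousOn.div (by fun_prop) (by fun_prop)
        fun p hp => pow_ne_zero _ (complexDenom_ne_zero hp.1 _ _)
    · exact ContinuousOn.div (by fun_prop) (by fun_prop)
        fun p hp => pow_ne_zero _ (complexDenom_ne_zero hp.1 _ _)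
    · refine hasDerivAt_div_pow ?_ (hasDerivAt_complexDenom s u v) (complexDenom_ne_zero hs u v) k
      simpa using ((hasDerivAt_id s).mul_const (n₁ u v : ℂ)).const_add (n₀ u v : ℂ)
  -- The Taylor series of the holomorphic `G` converges on the whole disc. At real τ its sum is
  -- real, so the real parts of the coefficients suffice.
  refine ⟨fun n => ((n.factorial : ℂ)⁻¹ * iteratedDeriv n G 0).re, fun τ hτ => ?_⟩
  have hsum := Complex.hasSum_taylorSeries_on_ball hdiff (z := (τ : ℂ)) (by simpa using hτ)
  have hre := Complex.hasSum_re hsum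
  have hval : G τ = ((torusIntegral fun u v =>
      (n₀ u v + τ * n₁ u v) / surfaceDenom τ u v ^ (k + 1) : ℝ) : ℂ) := by
    rw [torusIntegral, ← integral_complex_ofReal]
    refine integral_congr_ae (Filter.Eventually.of_forall fun p => ?_)
    simp only [hF, complexDenom_ofReal]
    push_cast
    rfl
  rw [hval, Complex.ofReal_re] at hre
  refine hre.congr_fun fun n => ?_
  have : ((n.factorial : ℂ)⁻¹ • ((τ : ℂ) - 0) ^ n • iteratedDeriv n G 0)
      = ((τ ^ n : ℝ) : ℂ) * ((n.factorial : ℂ)⁻¹ * iteratedDeriv n G 0) := by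
    simp only [smul_eq_mul, sub_zero]
    push_cast
    ring
  rw [this, Complex.re_ofReal_mul, mul_comm]

/-- Source of evenness: u ↦ u + π changes the sign of cos u, which acts on `surfaceDenom` and
`fluxNum` like τ ↦ -τ. -/
theorem torusIntegral_shift {f : ℝ → ℝ → ℝ} (hf : Continuous fun p : ℝ × ℝ => f p.1 p.2)
    (hper : ∀ u v, f (u + 2 * π) v = f u v) :
    torusIntegral (fun u v => f (u + π) v) = torusIntegral f := by
  rw [torusIntegral_eq hf, torusIntegral_eq (f := fun u v => f (u + π) v)
    (hf.comp (f := fun p : ℝ × ℝ => (p.1 + π, p.2)) (by fun_prop))]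
  have hp : Function.Periodic (fun u => ∫ v in (0 : ℝ)..(2 * π), f u v) (2 * π) := fun u => by
    simp only [hper]
  rw [intervalIntegral.integral_comp_add_right (fun u => ∫ v in (0 : ℝ)..(2 * π), f u v) π,
    zero_add, add_comm (2 * π) π, hp.intervalIntegral_add_eq π 0, zero_add]

/-- Averaging the series at τ and -τ cancels the odd terms. -/
theorem exists_hasSum_of_even {f : ℝ → ℝ} {ρ : ℝ} {c : ℕ → ℝ}
    (hc : ∀ τ, |τ| < ρ → HasSum (fun n => c n * τ ^ n) (f τ)) (hf : ∀ τ, |τ| < ρ → f (-τ) = f τ) :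
    ∀ τ, |τ| < ρ → HasSum (fun n => c (2 * n) * τ ^ (2 * n)) (f τ) := by
  intro τ hτ
  have h₁ := hc τ hτ
  have h₂ := hc (-τ) (by rwa [abs_neg])
  rw [hf τ hτ] at h₂
  have h₃ := (h₁.add h₂).mul_left (1 / 2)
  rw [show 1 / 2 * (f τ + f τ) = f τ by ring] at h₃
  have hinj : Function.Injective fun n : ℕ => 2 * n := fun a b h => by simpa using h
  rw [← hinj.hasSum_iff] at h₃
  · refine h₃.congr_fun fun n => ?_
    simp only [Function.comp, (even_two_mul n).neg_pow]
    ring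
  · intro n hn
    have hodd : Odd n := by
      rw [← Nat.not_even_iff_odd]
      rintro ⟨m, rfl⟩
      exact hn ⟨m, by simp [two_mul]⟩
    rw [hodd.neg_pow]
    ring

theorem areaIntegral_neg {τ : ℝ} (hτ : |τ| < 2 - √2) : areaIntegral (-τ) = areaIntegral τ := by
  rw [areaIntegral, areaIntegral, ← torusIntegral_shift (f := fun u v =>
    (2 + √2 * Real.sin v) / surfaceDenom τ u v ^ 2)
    (continuous_div_surfaceDenom (f := fun _ v => 2 + √2 * Real.sin v) (by fun_prop) 2 hτ)]
  · simp only [surfaceDenom, Real.cos_add_pi]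
    congr 1
    funext u v
    congr 2
    ring
  · intro u v
    simp only [surfaceDenom, Real.cos_add_two_pi]

theorem fluxIntegral_neg {τ : ℝ} (hτ : |τ| < 2 - √2) : fluxIntegral (-τ) = fluxIntegral τ := by
  rw [fluxIntegral, fluxIntegral, ← torusIntegral_shift (f := fun u v =>
    fluxNum τ u v / surfaceDenom τ u v ^ 3)
    (continuous_div_surfaceDenom (by unfold fluxNum; fun_prop) 3 hτ)]
  · simp only [fluxNum, surfaceDenom, Real.cos_add_pi]
    congr 1
    funext u v
    congr 2 <;> ring
  · intro u v
    simp only [fluxNum, surfaceDenom, Real.cos_add_two_pi]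

theorem exists_hasSum_area :
    ∃ c : ℕ → ℝ, ∀ t, |t| < √2 - 1 → HasSum (fun n => c n * t ^ (2 * n)) (area t) := by
  have h0 : √2 ≠ 0 := (Real.sqrt_pos.2 zero_lt_two).ne'
  obtain ⟨c, hc⟩ := exists_hasSum_torusIntegral (n₀ := fun _ v => 2 + √2 * Real.sin v)
    (n₁ := fun _ _ => 0) (by fun_prop) (by fun_prop) 1
  have hc' := exists_hasSum_of_even (f := areaIntegral) (c := c) (ρ := 2 - √2)
    (fun τ hτ => by simpa [areaIntegral] using hc τ hτ) fun τ => areaIntegral_neg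
  refine ⟨fun n => (√2)⁻¹ * (c (2 * n) * √2 ^ (2 * n)), fun t ht => ?_⟩
  have h := (hc' (√2 * t) (abs_sqrt_two_mul_lt ht)).mul_left (√2)⁻¹
  rw [← sqrt_two_mul_area ht, inv_mul_cancel_left₀ h0] at h
  refine h.congr_fun fun n => ?_
  rw [mul_pow]
  ring

theorem exists_hasSum_vol :
    ∃ c : ℕ → ℝ, ∀ t, |t| < √2 - 1 → HasSum (fun n => c n * t ^ (2 * n)) (vol t) := by
  have h0 : 3 * √2 ≠ 0 := mul_ne_zero three_ne_zero (Real.sqrt_pos.2 zero_lt_two).ne'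
  obtain ⟨c, hc⟩ := exists_hasSum_torusIntegral
    (n₀ := fun _ v => (2 + √2 * Real.sin v) * (1 + √2 * Real.sin v)) (n₁ := fluxNumDeriv)
    (by fun_prop) (by unfold fluxNumDeriv; fun_prop) 2
  have hn : ∀ τ u v, (2 + √2 * Real.sin v) * (1 + √2 * Real.sin v) + τ * fluxNumDeriv u v
      = fluxNum τ u v := fun τ u v => by
    unfold fluxNum fluxNumDeriv
    ring
  simp only [hn] at hc
  have hc' := exists_hasSum_of_even (f := fluxIntegral) (c := c) (ρ := 2 - √2) hc
    fun τ => fluxIntegral_neg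
  refine ⟨fun n => (3 * √2)⁻¹ * (c (2 * n) * √2 ^ (2 * n)), fun t ht => ?_⟩
  have h := (hc' (√2 * t) (abs_sqrt_two_mul_lt ht)).mul_left (3 * √2)⁻¹
  rw [← three_mul_sqrt_two_mul_vol ht, inv_mul_cancel_left₀ h0] at h
  refine h.congr_fun fun n => ?_
  rw [mul_pow]
  ring

end TaylorSeries

/-! ### Calculus of functions given by power series in t². -/

section EvenSeries

open PowerSeries

variable {ρ : ℝ}

/-- `f t` is the sum of the power series `G` at `t ^ 2` for all `t` with `|t| < ρ`. -/
def Represents (ρ : ℝ) (G : ℝ⟦X⟧) (f : ℝ → ℝ) : Prop :=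
  ∀ t, |t| < ρ → HasSum (fun n => coeff n G * t ^ (2 * n)) (f t)

namespace Represents

variable {G H : ℝ⟦X⟧} {f g : ℝ → ℝ}

theorem add (hf : Represents ρ G f) (hg : Represents ρ H g) :
    Represents ρ (G + H) fun t => f t + g t := fun t ht => by
  simpa only [map_add, add_mul] using (hf t ht).add (hg t ht)

theorem sub (hf : Represents ρ G f) (hg : Represents ρ H g) :
    Represents ρ (G - H) fun t => f t - g t := fun t ht => by
  simpa only [map_sub, sub_mul] using (hf t ht).sub (hg t ht)

theorem const (ρ a : ℝ) : Represents ρ (C a) fun _ => a := fun t _ => by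
  convert hasSum_single (f := fun n => coeff n (C a) * t ^ (2 * n)) 0 fun n hn => ?_
  · simp
  · rw [coeff_C, if_neg hn, zero_mul]

theorem X (ρ : ℝ) : Represents ρ PowerSeries.X fun t => t ^ 2 := fun t _ => by
  convert hasSum_single (f := fun n => coeff n (PowerSeries.X : ℝ⟦X⟧) * t ^ (2 * n)) 1
    fun n hn => ?_
  · simp
  · rw [coeff_X, if_neg hn, zero_mul]

theorem mul (hf : Represents ρ G f) (hg : Represents ρ H g) :
    Represents ρ (G * H) fun t => f t * g t := fun t ht => by
  have h₁ := (hf t ht).summable.norm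
  have h₂ := (hg t ht).summable.norm
  have hs := (summable_norm_sum_mul_antidiagonal_of_summable_norm h₁ h₂).of_norm
  have he := tsum_mul_tsum_eq_tsum_sum_antidiagonal_of_summable_norm h₁ h₂
  rw [(hf t ht).tsum_eq, (hg t ht).tsum_eq] at he
  have := hs.hasSum
  rw [← he] at this
  refine this.congr_fun fun n => ?_
  rw [coeff_mul, Finset.sum_mul]
  refine Finset.sum_congr rfl fun p hp => ?_
  obtain rfl : p.1 + p.2 = n := by simpa using hp
  ring

theorem congr (hf : Represents ρ G f) (h : ∀ t, |t| < ρ → f t = g t) : Represents ρ G g :=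
  fun t ht => h t ht ▸ hf t ht

/-- For |t| < r < R < ρ, convergence at R bounds the terms there by some M, so the differentiated
terms on |y| < r are dominated by a multiple of n (r / R)^(2n). -/
theorem hasDerivAt (hf : Represents ρ G f) {t : ℝ} (ht : |t| < ρ) :
    HasDerivAt f (∑' n, coeff n G * ((2 * n : ℕ) * t ^ (2 * n - 1))) t ∧
      Summable fun n => coeff n G * ((2 * n : ℕ) * t ^ (2 * n - 1)) := by
  obtain ⟨r, htr, hrρ⟩ := exists_between ht
  obtain ⟨R, hrR, hRρ⟩ := exists_between hrρ
  have hr : 0 < r := (abs_nonneg t).trans_lt htr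
  have hR : 0 < R := hr.trans hrR
  obtain ⟨M, hM⟩ := (hf R (by rwa [abs_of_pos hR])).summable.norm.tendsto_atTop_zero.bddAbove_range
  have hx : ‖(r / R) ^ 2‖ < 1 := by
    rw [norm_pow, Real.norm_eq_abs, abs_of_pos (div_pos hr hR)]
    exact pow_lt_one₀ (div_pos hr hR).le ((div_lt_one hR).2 hrR) two_ne_zero
  have hu : Summable fun n : ℕ => 2 * M / r * ((n : ℝ) ^ 1 * ((r / R) ^ 2) ^ n) :=
    (summable_pow_mul_geometric_of_norm_lt_one 1 hx).mul_left _
  have hbound : ∀ (n : ℕ), ∀ y ∈ Metric.ball (0 : ℝ) r,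
      ‖coeff n G * ((2 * n : ℕ) * y ^ (2 * n - 1))‖
        ≤ 2 * M / r * ((n : ℝ) ^ 1 * ((r / R) ^ 2) ^ n) := by
    intro n y hy
    rw [mem_ball_zero_iff, Real.norm_eq_abs] at hy
    rcases n with _ | n
    · simp
    have hMn : ‖coeff (n + 1) G * R ^ (2 * (n + 1))‖ ≤ M := hM ⟨n + 1, rfl⟩
    rw [norm_mul, norm_pow, Real.norm_eq_abs R, abs_of_pos hR, ← le_div_iff₀ (by positivity)] at hMn
    rw [norm_mul, norm_mul, norm_pow, Real.norm_eq_abs y, Real.norm_natCast,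
      show 2 * (n + 1) - 1 = 2 * n + 1 by omega]
    calc ‖coeff (n + 1) G‖ * ((2 * (n + 1) : ℕ) * |y| ^ (2 * n + 1))
        ≤ M / R ^ (2 * (n + 1)) * ((2 * (n + 1) : ℕ) * r ^ (2 * n + 1)) := by
          gcongr
          exact (norm_nonneg _).trans hMn
      _ = 2 * M / r * (((n + 1 : ℕ) : ℝ) ^ 1 * ((r / R) ^ 2) ^ (n + 1)) := by
          push_cast
          rw [← pow_mul, div_pow]
          field_simp
          ring
  have ht' : t ∈ Metric.ball (0 : ℝ) r := by simpa using htr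
  have hd := hasDerivAt_tsum_of_isPreconnected
    (g := fun n y => coeff n G * y ^ (2 * n))
    (g' := fun n y => coeff n G * ((2 * n : ℕ) * y ^ (2 * n - 1))) hu Metric.isOpen_ball
    (Metric.isPreconnected_ball) (fun n y _ => (hasDerivAt_pow (2 * n) y).const_mul _) hbound
    ht' (hf t ht).summable ht'
  refine ⟨hd.congr_of_eventuallyEq ?_, hu.of_norm_bounded fun n => hbound n t ht'⟩
  filter_upwards [Metric.isOpen_ball.mem_nhds ht'] with y hy
  rw [mem_ball_zero_iff, Real.norm_eq_abs] at hy
  exact (hf y (hy.trans hrρ)).tsum_eq.symm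

/-- With X = t², the operator t d/dt multiplies t^(2n) by 2n, hence is 2 θ. -/
theorem mul_deriv (hf : Represents ρ G f) :
    Represents ρ (2 * euler G) fun t => t * deriv f t := fun t ht => by
  obtain ⟨hd, hs⟩ := hf.hasDerivAt ht
  beta_reduce
  rw [hd.deriv]
  refine (hs.hasSum.mul_left t).congr_fun fun n => ?_
  rw [two_mul, map_add, coeff_euler]
  rcases n with _ | n
  · simp
  · rw [show 2 * (n + 1) - 1 = 2 * n + 1 by omega]
    push_cast
    ring

theorem coeff_eq (hρ : 0 < ρ) (hf : Represents ρ G f) (n : ℕ) :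
    coeff n G = iteratedDeriv (2 * n) f 0 / (Nat.factorial (2 * n) : ℝ) := by
  -- Interleaving with zeros gives an ordinary power series in t, to which uniqueness of Taylor
  -- coefficients applies.
  set c : ℕ → ℝ := fun k => if Even k then coeff (k / 2) G else 0 with hc
  have hinj : Function.Injective fun n : ℕ => 2 * n := fun a b h => by simpa using h
  have hp : HasFPowerSeriesAt f (FormalMultilinearSeries.ofScalars ℝ c) 0 := by
    rw [hasFPowerSeriesAt_iff]
    filter_upwards [Metric.ball_mem_nhds (0 : ℝ) hρ] with t ht
    rw [mem_ball_zero_iff, Real.norm_eq_abs] at ht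
    rw [zero_add, ← hinj.hasSum_iff]
    · refine (hf t ht).congr_fun fun n => ?_
      simp only [Function.comp, FormalMultilinearSeries.coeff_ofScalars, hc, even_two_mul, if_true,
        smul_eq_mul, Nat.mul_div_cancel_left n two_pos]
      ring
    · intro k hk
      have : ¬ Even k := by
        rintro ⟨m, rfl⟩
        exact hk ⟨m, by simp [two_mul]⟩
      simp [FormalMultilinearSeries.coeff_ofScalars, hc, this]
  have h := hp.eq_formalMultilinearSeries hp.analyticAt.hasFPowerSeriesAt
  have h' := congrArg (fun p => p.coeff (2 * n)) h
  simp only [FormalMultilinearSeries.coeff_ofScalars, hc, even_two_mul, if_true,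
    Nat.mul_div_cancel_left n two_pos] at h'
  exact h'

theorem unique (hρ : 0 < ρ) (hf : Represents ρ G f) (hg : Represents ρ H f) : G = H := by
  ext n
  rw [hf.coeff_eq hρ, hg.coeff_eq hρ]

end Represents

end EvenSeries

/-! ### Transfer of the relations to the Taylor series of area and volume. -/

section Assembly

open PowerSeries

theorem sqrt_two_sub_one_pos : 0 < √2 - 1 := by
  have := Real.lt_sqrt_of_sq_lt (show (1 : ℝ) ^ 2 < 2 by norm_num)
  linarith

theorem represents_area : Represents (√2 - 1) (mk areaCoeff) area := by
  obtain ⟨c, hc⟩ := exists_hasSum_area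
  have h : Represents (√2 - 1) (mk c) area := fun t ht => by simpa using hc t ht
  have : c = areaCoeff := funext fun n =>
    (coeff_mk n c).symm.trans (h.coeff_eq sqrt_two_sub_one_pos n)
  rwa [← this]

theorem represents_vol : Represents (√2 - 1) (mk volCoeff) vol := by
  obtain ⟨c, hc⟩ := exists_hasSum_vol
  have h : Represents (√2 - 1) (mk c) vol := fun t ht => by simpa using hc t ht
  have : c = volCoeff := funext fun n =>
    (coeff_mk n c).symm.trans (h.coeff_eq sqrt_two_sub_one_pos n)
  rwa [← this]

/-- The scaling factor between the Taylor coefficients and the integer lists is a multiple of this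
value, so it must not vanish. At t = 0 the denominator is 1. -/
theorem areaCoeff_zero_ne_zero : areaCoeff 0 ≠ 0 := by
  have h := area_eq_integral (t := 0) (by simpa using sqrt_two_sub_one_pos)
  have h0 : √2 ≠ 0 := (Real.sqrt_pos.2 zero_lt_two).ne'
  simp only [areaCoeff, mul_zero, iteratedDeriv_zero, Nat.factorial_zero, Nat.cast_one, div_one]
  have hd : ∀ u v, denom 0 u v 1 = 1 := fun u v => by simp [denom]
  have hi : ∫ v in (0 : ℝ)..(2 * π), (√2 + Real.sin v) = √2 * (2 * π) := by
    rw [intervalIntegral.integral_add (by simp) (Real.continuous_sin.intervalIntegrable _ _)]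
    simp
    ring
  rw [h]
  simp only [hd, one_pow, div_one, hi, intervalIntegral.integral_const, smul_eq_mul, sub_zero]
  positivity

theorem area_series_relation :
    6 * (1 + X) ^ 3 * mk volCoeff = (3 - 10 * X - 5 * X ^ 2) * mk areaCoeff
      + 4 * (1 - X ^ 2) * euler (mk areaCoeff) := by
  have hX := Represents.X (√2 - 1)
  have c := Represents.const (√2 - 1)
  have h₁ := (c 6).mul ((((c 1).add hX).mul (((c 1).add hX).mul ((c 1).add hX))).mul represents_vol)
  have h₂ := ((((c 3).sub ((c 10).mul hX)).sub ((c 5).mul (hX.mul hX))).mul represents_area).add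
    (((c 2).mul ((c 1).sub (hX.mul hX))).mul represents_area.mul_deriv)
  have h := h₁.unique sqrt_two_sub_one_pos (h₂.congr fun t ht => by
    linear_combination -area_relation ht)
  simp only [map_ofNat, map_one] at h
  linear_combination h

theorem vol_series_relation :
    (-3 + 18 * X - 3 * X ^ 2) * mk areaCoeff + (6 + 90 * X - 78 * X ^ 2 + 30 * X ^ 3) * mk volCoeff
      = 8 * (1 - X) * (1 - 6 * X + X ^ 2) * euler (mk volCoeff) := by
  have hX := Represents.X (√2 - 1)
  have c := Represents.const (√2 - 1)
  have h₁ := ((((c 18).mul hX).sub (c 3)).sub ((c 3).mul (hX.mul hX))).mul represents_area |>.add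
    (((((c 6).add ((c 90).mul hX)).sub ((c 78).mul (hX.mul hX))).add
      ((c 30).mul (hX.mul (hX.mul hX)))).mul represents_vol)
  have h₂ := ((c 4).mul (((c 1).sub hX).mul (((c 1).sub ((c 6).mul hX)).add (hX.mul hX)))).mul
    represents_vol.mul_deriv
  have h := h₁.unique sqrt_two_sub_one_pos (h₂.congr fun t ht => by
    linear_combination -vol_relation ht)
  simp only [map_ofNat, map_one] at h
  linear_combination h

/-- The product of the series gives t times the required identity, so t = 0 is separate: there both
derivatives vanish by evenness. -/
theorem hasSum_isoCoeff {t : ℝ} (ht : |t| < √2 - 1) :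
    HasSum (fun n : ℕ => 2 * isoCoeff n * t ^ (2 * n + 1))
      (2 * deriv vol t * area t - 3 * vol t * deriv area t) := by
  rcases eq_or_ne t 0 with rfl | h0
  · have hd : ∀ {G : ℝ⟦X⟧} {f : ℝ → ℝ}, Represents (√2 - 1) G f → deriv f 0 = 0 := by
      intro G f hf
      rw [(hf.hasDerivAt ht).1.deriv, ← tsum_zero (β := ℕ)]
      congr 1
      funext n
      rcases n with _ | n
      · simp
      · rw [show 2 * (n + 1) - 1 = 2 * n + 1 by omega]
        simp
    rw [hd represents_area, hd represents_vol]
    simp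
  · have c := Represents.const (√2 - 1)
    have h := ((c 2).mul (represents_vol.mul_deriv.mul represents_area)).sub
      ((c 3).mul (represents_vol.mul represents_area.mul_deriv)) t ht
    have hX := X_mul_mk_eq (sa := areaCoeff) (sv := volCoeff) (sd := isoCoeff) fun n => rfl
    have hs : C 2 * (2 * euler (mk volCoeff) * mk areaCoeff)
        - C 3 * (mk volCoeff * (2 * euler (mk areaCoeff))) = X * mk (fun n => 2 * isoCoeff n) := by
      have : (mk fun n => 2 * isoCoeff n : ℝ⟦X⟧) = 2 * mk isoCoeff := by
        ext n
        rw [two_mul, map_add, coeff_mk, coeff_mk, two_mul]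
      rw [this, map_ofNat, map_ofNat]
      linear_combination -2 * hX
    rw [hs, ← hasSum_nat_add_iff' 1] at h
    simp only [coeff_succ_X_mul, coeff_mk, Finset.sum_range_one, coeff_zero_X_mul, zero_mul,
      sub_zero] at h
    have h' := h.mul_left t⁻¹
    rw [show t⁻¹ * (2 * (t * deriv vol t * area t) - 3 * (vol t * (t * deriv area t)))
      = 2 * deriv vol t * area t - 3 * vol t * deriv area t by field_simp] at h'
    refine h'.congr_fun fun n => ?_
    field_simp
    ring

end Assembly

end CliffordTorus

theorem mainTheorem5 :
    -- the area and the volume are the sums of their Taylor series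
    (∀ t : ℝ, |t| < √2 - 1 →
      HasSum (fun n : ℕ => CliffordTorus.areaCoeff n * t ^ (2 * n)) (CliffordTorus.area t) ∧
      HasSum (fun n : ℕ => CliffordTorus.volCoeff n * t ^ (2 * n)) (CliffordTorus.vol t) ∧
      DifferentiableAt ℝ CliffordTorus.area t ∧ DifferentiableAt ℝ CliffordTorus.vol t ∧
      HasSum (fun n : ℕ => 2 * CliffordTorus.isoCoeff n * t ^ (2 * n + 1))
        (2 * deriv CliffordTorus.vol t * CliffordTorus.area t
          - 3 * CliffordTorus.vol t * deriv CliffordTorus.area t)) ∧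
    -- the recurrences
    CliffordTorus.SatisfiesPRec CliffordTorus.areaRec CliffordTorus.areaCoeff ∧
    CliffordTorus.SatisfiesPRec CliffordTorus.volRec CliffordTorus.volCoeff ∧
    CliffordTorus.SatisfiesPRec CliffordTorus.isoRec CliffordTorus.isoCoeff ∧
    -- their uniqueness, up to a constant factor
    (∀ M : Matrix (Fin (3 + 1)) (Fin (4 + 1)) ℝ,
      CliffordTorus.SatisfiesPRec M CliffordTorus.areaCoeff →
        ∃ c : ℝ, M = c • CliffordTorus.areaRec) ∧
    (∀ M : Matrix (Fin (3 + 1)) (Fin (4 + 1)) ℝ,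
      CliffordTorus.SatisfiesPRec M CliffordTorus.volCoeff →
        ∃ c : ℝ, M = c • CliffordTorus.volRec) ∧
    (∀ M : Matrix (Fin (7 + 1)) (Fin (7 + 1)) ℝ,
      CliffordTorus.SatisfiesPRec M CliffordTorus.isoCoeff →
        ∃ c : ℝ, M = c • CliffordTorus.isoRec) := by
  have h₁ := CliffordTorus.area_series_relation
  have h₂ := CliffordTorus.vol_series_relation
  have hd : ∀ n, CliffordTorus.isoCoeff n = _ := fun n => rfl
  have hu := CliffordTorus.uniqueness_of_relations h₁ h₂ hd CliffordTorus.areaCoeff_zero_ne_zero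
  have hr := CliffordTorus.satisfiesPRec_of_relations h₁ h₂ (CliffordTorus.X_mul_mk_eq hd)
  refine ⟨fun t ht => ⟨?_, ?_, (CliffordTorus.hasDerivAt_area ht).differentiableAt,
    (CliffordTorus.hasDerivAt_vol ht).differentiableAt, CliffordTorus.hasSum_isoCoeff ht⟩,
    hr.1, hr.2.1, hr.2.2, hu.1, hu.2.1, hu.2.2⟩
  · simpa using CliffordTorus.represents_area t ht
  · simpa using CliffordTorus.represents_vol t ht
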